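/- **Model.** Let $n\ge 1$, $E=\{1,\dots,n\}$ (the phases), $\Delta=n+1$, and $c,\beta,\delta>0$. Let $T=(\lambda_{ij})_{i,j\in E}$ be a real matrix with $\lambda_{ij}\ge 0$ for $i\ne j$, $\lambda_i:=-\lambda_{ii}>0$ and $\lambda_{i,n+1}:=-\sum_{j\in E}\lambda_{ij}\ge 0$, such that every phase is transient for the Markov chain on $E\cup\{\Delta\}$ with rates $\lambda_{ij}$ and absorbing state $\Delta$. Let $\pi$ be a probability vector on $E$. On a complete probability space $(\Omega,\mathcal F,\mathbb P)$ the phase process $J$ evolves as follows: it stays in a phase $i$ for an exponential time of parameter $\lambda_i$ and then, independently of that time and of the past, jumps to $j\in (E\cup\{\Delta\})\setminus\{i\}$ with probability $\lambda_{ij}/\lambda_i$; when $\Delta$ is entered a claim occurs and $J$ restarts at once in a phase drawn from $\pi$ (so the interclaim times are of $n$-order phase type). The initial law charges every phase. Let $N_t$ be the number of claims up to time $t$; the claim sizes $Y_1,Y_2,\dots$ are i.i.d. exponential with parameter $\beta$ and independent of the phase process (hence of $N$). Let $(\mathcal F_t)$ be the $\mathbb P$-completed filtration generated by the phases and the claims.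 For $x\ge 0$, an admissible strategy is an $(\mathcal F_t)$-predictable, nondecreasing, càglàd process $D$ with $D_{0-}=D_0=0$ such that, with $X^D_t=x+ct-\sum_{k=1}^{N_t}Y_k-D_t$, almost surely dividends never make the surplus negative: $D_t\le x+ct-\sum_{k=1}^{N_t}Y_k$ for every $t$ such that $X^D_s\ge 0$ at all claim times $s\le t$. Let $\mathcal U_x$ be the set of these strategies, $\tau=\inf\{t:X^D_t<0\}$, $\mathbb E_i=\mathbb E[\,\cdot\mid J_0=i]$, and $$V_i(x)=\sup_{D\in\mathcal U_x}\mathbb E_i\Big[\int_{0-}^{\tau-}e^{-\delta t}\,dD_t\Big]\qquad(i\in E,\ x\ge 0),$$ where the integral includes the payment $D_{0+}$ at time $0$ and excludes a payment at time $\tau$. **Iterates.** Let $\tau_1$ be the first jump time and $\bar J_{\tau_1}\in E\cup\{\Delta\}$ the state entered at $\tau_1$. Put $V^{(0)}_i\equiv 0$ and, for $k\ge 1$, $i\in E$, $x\ge0$, $$V^{(k)}_i(x)=\sup_{D\in\mathcal U_x}\mathbb E_i\Big[\int_{0-}^{\tau_1-}e^{-\delta t}\,dD_t+e^{-\delta\tau_1}V^{(k-1)}_{\bar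 J_{\tau_1}}\big(x+c\tau_1-D_{\tau_1}\big)\Big],$$ where $V^{(k)}_{n+1}(u)=\sum_{i=1}^n\pi_i\int_0^u\beta e^{-\beta y}\,V^{(k)}_i(u-y)\,dy$ for $u\ge 0$. **Proposition.** For every phase $i\in E$ and every $x\ge 0$, $$0=V^{(0)}_i(x)\le V^{(1)}_i(x)\le\cdots\le V^{(k)}_i(x)\le\cdots\le V_i(x)<\infty\qquad\text{and}\qquad \lim_{k\to\infty}V^{(k)}_i(x)=V_i(x).$$ -/

import Mathlib

open MeasureTheory ProbabilityTheory Filter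
open scoped NNReal ENNReal Topology

noncomputable section

namespace Dividend

/-- Intensity of entering the absorbing (claim) state from phase `i`: the vector `-T e`. -/
def exitRate {n : ℕ} (T : Matrix (Fin n) (Fin n) ℝ) (i : Fin n) : ℝ := -∑ j, T i j

/-- Parameters of the risk model.  `T` is the restriction to the `n` phases of the intensity
matrix of the terminating chain, `init` the law of the phase right after a claim, `c` the premium
rate, `β` the parameter of the exponential claim sizes, `δ` the discount rate. -/
structure Model (n : ℕ) where
  T : Matrix (Fin n) (Fin n) ℝ
  init : Fin n → ℝ
  c : ℝ
  β : ℝ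
  δ : ℝ
  offdiag_nonneg : ∀ i j, i ≠ j → 0 ≤ T i j
  diag_neg : ∀ i, T i i < 0
  exit_nonneg : ∀ i, 0 ≤ exitRate T i
  /-- every phase is transient: the absorbing state can be reached from it -/
  transient : ∀ i, ∃ j, Relation.ReflTransGen (fun a b => 0 < T a b) i j ∧ 0 < exitRate T j
  init_nonneg : ∀ i, 0 ≤ init i
  init_sum : ∑ i, init i = 1
  c_pos : 0 < c
  β_pos : 0 < β
  δ_pos : 0 < δ

namespace Model

variable {n : ℕ} (M : Model n)

/-- `λ_i`, the parameter of the exponential sojourn time in phase `i`. -/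
def leaveRate (i : Fin n) : ℝ := -M.T i i

/-- `λ_{ij}` for a phase `i` and a state `j` of `E ∪ {Δ}`.  The phases are the states
`Fin.castSucc j`, the absorbing state `Δ` is `Fin.last n`. -/
def rate (i : Fin n) : Fin (n + 1) → ℝ :=
  Fin.snoc (α := fun _ => ℝ) (fun j => M.T i j) (exitRate M.T i)

/-- Probability that the jump out of phase `i` leads to the state `a` of `E ∪ {Δ}`. -/
def jumpProb (i : Fin n) (a : Fin (n + 1)) : ℝ :=
  if a = i.castSucc then 0 else M.rate i a / M.leaveRate i

/-- Probability that the next phase is `j` when the jump leads to the state `a`: that state itself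
if it is a phase, and a phase drawn from `init` if a claim occurs. -/
def restartProb (a : Fin (n + 1)) (j : Fin n) : ℝ :=
  if a = Fin.last n then M.init j else if a = j.castSucc then 1 else 0

/-- `∑ i, π_i E[W_i(u - Y); Y ≤ u]` with `Y` exponential of parameter `β`: the value at the instant
of a claim, when `u` is the surplus just before the claim, `W` gives the values after it, and ruin
is worth nothing. -/
def claimValue (W : Fin n → ℝ → ℝ≥0∞) (u : ℝ) : ℝ≥0∞ :=
  ∑ i, ENNReal.ofReal (M.init i) * ∫⁻ y in Set.Iic u, W i (u - y) ∂(expMeasure M.β)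

/-- The extension of `(W_1, …, W_n)` to the states of `E ∪ {Δ}`, with `W_{n+1} = claimValue W`. -/
def extend (W : Fin n → ℝ → ℝ≥0∞) : Fin (n + 1) → ℝ → ℝ≥0∞ :=
  Fin.snoc (α := fun _ => ℝ → ℝ≥0∞) W (M.claimValue W)

end Model

/-- A realisation on `(Ω, P)` of the observed phase process and of the claims, through jump chain
and holding times.  `phase m` is the phase during the `m`-th sojourn (`m = 0, 1, …`), `hold m` its
length, `target m` the state of `E ∪ {Δ}` entered when it ends (a claim occurs if that is
`Fin.last n`), and `claim k` the size of the `k`-th claim (`k = 0, 1, …`). -/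
structure RiskProcess {n : ℕ} (M : Model n) {Ω : Type*} [MeasurableSpace Ω] (P : Measure Ω) where
  phase : ℕ → Ω → Fin n
  hold : ℕ → Ω → ℝ≥0
  target : ℕ → Ω → Fin (n + 1)
  claim : ℕ → Ω → ℝ
  measurable_phase : ∀ m, Measurable (phase m)
  measurable_hold : ∀ m, Measurable (hold m)
  measurable_target : ∀ m, Measurable (target m)
  measurable_claim : ∀ k, Measurable (claim k)
  /-- every phase is a possible initial phase, so that one can condition on it -/
  initial : ∀ i, P {ω | phase 0 ω = i} ≠ 0
  /-- Given the completed sojourns and the current phase `i`, the sojourn in `i` is exponential of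
  parameter `λ_i`, and it is independent of the state entered next, whose law is `jumpProb i`;
  after a claim the phase restarts from the law `init`. -/
  markov : ∀ (m : ℕ) (B : Set (Fin m → Fin n × ℝ≥0 × Fin (n + 1))), MeasurableSet B →
    ∀ (i : Fin n) (t : ℝ≥0) (a : Fin (n + 1)) (j : Fin n),
      P {ω | (fun l : Fin m => (phase l ω, hold l ω, target l ω)) ∈ B ∧ phase m ω = i ∧
          t < hold m ω ∧ target m ω = a ∧ phase (m + 1) ω = j} =
        P {ω | (fun l : Fin m => (phase l ω, hold l ω, target l ω)) ∈ B ∧ phase m ω = i} *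
          ENNReal.ofReal
            (Real.exp (-M.leaveRate i * t) * M.jumpProb i a * M.restartProb a j)
  /-- the claim sizes are i.i.d. exponential and independent of the phase process -/
  claim_law : ∀ k, HasLaw (claim k) (expMeasure M.β) P
  claim_indep : iIndepFun claim P
  claim_indep_phase :
    IndepFun (fun ω (k : ℕ) => claim k ω) (fun ω (m : ℕ) => (phase m ω, hold m ω, target m ω)) P

namespace RiskProcess

variable {n : ℕ} {M : Model n} {Ω : Type*} [MeasurableSpace Ω] {P : Measure Ω}
  (R : RiskProcess M P)

/-- `τ_m`, the time of the `m`-th jump (a claim counts as one jump), with `τ_0 = 0`. -/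
def jumpTime (m : ℕ) (ω : Ω) : ℝ≥0 := ∑ l ∈ Finset.range m, R.hold l ω

/-- Number of jumps up to and including time `t`; almost surely only finitely many jumps occur
before `t`, and the value of the supremum on the exceptional null set is irrelevant. -/
def jumpCount (t : ℝ≥0) (ω : Ω) : ℕ := ⨆ m : ℕ, if R.jumpTime m ω ≤ t then m else 0

/-- `J_t`, the current phase (right-continuous). -/
def phaseAt (t : ℝ≥0) (ω : Ω) : Fin n := R.phase (R.jumpCount t ω) ω

/-- `N_t`, the number of claims up to and including time `t`. -/
def claimCount (t : ℝ≥0) (ω : Ω) : ℕ :=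
  ∑ l ∈ Finset.range (R.jumpCount t ω), if R.target l ω = Fin.last n then 1 else 0

/-- `Y_1 + … + Y_{N_t}`, the aggregate claims up to and including time `t`. -/
def totalClaims (t : ℝ≥0) (ω : Ω) : ℝ := ∑ k ∈ Finset.range (R.claimCount t ω), R.claim k ω

/-- `s` is the time of a claim. -/
def IsClaimTime (s : ℝ≥0) (ω : Ω) : Prop :=
  ∃ m, R.target m ω = Fin.last n ∧ s = R.jumpTime (m + 1) ω

/-- The σ-algebra generated by the phases and the claims up to time `t`. -/
def history (t : ℝ≥0) : MeasurableSpace Ω :=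
  ⨆ s : Set.Iic t, MeasurableSpace.comap
    (fun ω => (R.phaseAt s ω, R.claimCount s ω, R.totalClaims s ω)) inferInstance

lemma measurable_eval {γ : Type*} [MeasurableSpace γ] {f : ℕ → Ω → γ} {N : Ω → ℕ}
    (hf : ∀ k, Measurable (f k)) (hN : Measurable N) : Measurable fun ω => f (N ω) ω :=
  (measurable_from_prod_countable_right (f := fun p : ℕ × Ω => f p.1 p.2) hf).comp
    (hN.prodMk measurable_id)

lemma measurable_jumpTime (m : ℕ) : Measurable (R.jumpTime m) :=
  Finset.measurable_fun_sum _ fun l _ => R.measurable_hold l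

lemma measurable_jumpCount (t : ℝ≥0) : Measurable (R.jumpCount t) :=
  Measurable.iSup fun m =>
    Measurable.ite (measurableSet_le (R.measurable_jumpTime m) measurable_const)
      measurable_const measurable_const

lemma measurable_phaseAt (t : ℝ≥0) : Measurable (R.phaseAt t) :=
  measurable_eval R.measurable_phase (R.measurable_jumpCount t)

lemma measurable_claimCount (t : ℝ≥0) : Measurable (R.claimCount t) := by
  refine measurable_eval (f := fun k ω => ∑ l ∈ Finset.range k,
    if R.target l ω = Fin.last n then 1 else 0) (fun k => ?_) (R.measurable_jumpCount t)
  exact Finset.measurable_fun_sum _ fun l _ =>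
    Measurable.ite (R.measurable_target l (measurableSet_singleton _))
      measurable_const measurable_const

lemma measurable_totalClaims (t : ℝ≥0) : Measurable (R.totalClaims t) :=
  measurable_eval (f := fun k ω => ∑ l ∈ Finset.range k, R.claim l ω)
    (fun _ => Finset.measurable_fun_sum _ fun l _ => R.measurable_claim l)
    (R.measurable_claimCount t)

lemma history_le (t : ℝ≥0) : R.history t ≤ (inferInstance : MeasurableSpace Ω) :=
  iSup_le fun s => Measurable.comap_le <|
    (R.measurable_phaseAt s).prodMk ((R.measurable_claimCount s).prodMk (R.measurable_totalClaims s))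

lemma history_mono {s t : ℝ≥0} (h : s ≤ t) : R.history s ≤ R.history t :=
  iSup_le fun u => le_iSup (fun v : Set.Iic t => MeasurableSpace.comap
    (fun ω => (R.phaseAt v ω, R.claimCount v ω, R.totalClaims v ω)) inferInstance)
    ⟨u.1, le_trans u.2 h⟩

/-- The `P`-completed filtration generated by the phases and the claims: a set belongs to the
σ-algebra at time `t` if it differs from a set in `history t` by a `P`-null set. -/
def filtration [P.IsComplete] : Filtration ℝ≥0 (inferInstance : MeasurableSpace Ω) where
  seq t := @eventuallyMeasurableSpace Ω (R.history t) (ae P) inferInstance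
  mono' := by
    rintro s t h A ⟨B, hB, hAB⟩
    exact ⟨B, R.history_mono h B hB, hAB⟩
  le' := by
    rintro t A ⟨B, hB, hAB⟩
    exact NullMeasurableSet.measurable_of_complete ⟨B, R.history_le t B hB, hAB⟩

/-- `X_t = x + c t - (Y_1 + … + Y_{N_t}) - D_t`. -/
def surplus (x : ℝ) (D : ℝ≥0 → Ω → ℝ) (t : ℝ≥0) (ω : Ω) : ℝ :=
  x + M.c * t - R.totalClaims t ω - D t ω

/-- The admissible dividend strategies for the initial capital `x`: `D_t` is the total amount paid
before time `t` (so that `D_0 = 0` and a payment at time `0` is the jump of `D` to its right limit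
at `0`); as a nondecreasing left-continuous process, `D` is càglàd. -/
structure Strategy [P.IsComplete] (x : ℝ) where
  D : ℝ≥0 → Ω → ℝ
  predictable : IsStronglyPredictable R.filtration D
  zero : ∀ ω, D 0 ω = 0
  mono : ∀ ω, Monotone fun t => D t ω
  left_continuous : ∀ ω t, ContinuousWithinAt (fun s => D s ω) (Set.Iic t) t
  /-- `D_t ≤ x + c t - (Y_1 + … + Y_{N_t})`, unless a claim up to time `t` has ruined the company:
  dividend payments never make the surplus negative. -/
  budget : ∀ᵐ ω ∂P, ∀ t : ℝ≥0,
    (∀ s ≤ t, R.IsClaimTime s ω → 0 ≤ R.surplus x D s ω) →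
      D t ω ≤ x + M.c * t - R.totalClaims t ω

namespace Strategy

variable {R} [P.IsComplete] {x : ℝ} (S : R.Strategy x)

lemma mono_real (ω : Ω) : Monotone fun s : ℝ => S.D s.toNNReal ω :=
  fun _ _ h => S.mono ω (Real.toNNReal_le_toNNReal h)

/-- The Stieltjes measure `dD` on the half-line, with mass `D_{t+} - D_t` at each `t ≥ 0`. -/
def dividendMeasure (ω : Ω) : Measure ℝ := (S.mono_real ω).stieltjesFunction.measure

/-- `∫_{0-}^{σ-} e^{-δ s} dD_s`: a payment at time `0` counts, a payment at time `σ` does not. -/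
def discounted (σ : ℝ≥0∞) (ω : Ω) : ℝ≥0∞ :=
  ∫⁻ s in {s : ℝ | 0 ≤ s ∧ ENNReal.ofReal s < σ},
    ENNReal.ofReal (Real.exp (-M.δ * s)) ∂(S.dividendMeasure ω)

/-- The time of ruin `inf {t | X_t < 0}`. -/
def ruinTime (ω : Ω) : ℝ≥0∞ := ⨅ (t : ℝ≥0) (_ : R.surplus x S.D t ω < 0), (t : ℝ≥0∞)

end Strategy

variable [P.IsComplete]

/-- The optimal value function `V_i(x)`, the supremum over all admissible strategies of the
conditional expectation, given the initial phase `i`, of the discounted dividends before ruin. -/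
def value (i : Fin n) (x : ℝ) : ℝ≥0∞ :=
  ⨆ S : R.Strategy x, ∫⁻ ω, S.discounted (S.ruinTime ω) ω ∂(cond P {ω | R.phase 0 ω = i})

/-- The value of the problem that ends at the first jump time `τ_1 = hold 0`, with the terminal
payoff `W` evaluated at the state `target 0` entered at `τ_1` and at the surplus
`x + c τ_1 - D_{τ_1}` just before a possible claim at `τ_1`. -/
def onePhaseValue (W : Fin n → ℝ → ℝ≥0∞) (i : Fin n) (x : ℝ) : ℝ≥0∞ :=
  ⨆ S : R.Strategy x, ∫⁻ ω, (S.discounted (R.hold 0 ω) ω +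
      ENNReal.ofReal (Real.exp (-M.δ * R.hold 0 ω)) *
        M.extend W (R.target 0 ω) (x + M.c * R.hold 0 ω - S.D (R.hold 0 ω) ω))
    ∂(cond P {ω | R.phase 0 ω = i})

/-- The iterates `V_i^{(k)}`. -/
def iterate : ℕ → Fin n → ℝ → ℝ≥0∞
  | 0 => fun _ _ => 0
  | k + 1 => R.onePhaseValue (iterate k)

end RiskProcess

end Dividend

end

/-! No information arrives strictly between two jumps, so during a sojourn an adapted
left-continuous dividend process is a function of time and of the history at the last jump
(`exists_factor_of_adapted`). The problem is therefore a discrete-time Markov decision problem whose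
actions are deterministic affordable paths, with one-step operator `optimalStep`. By
`onePhaseValue_eq` this is also the operator behind the iterates, so `R.iterate k` equals
`M.stepIterate k`, which depends on the parameters only.

The operator is monotone and is started at `0`, hence the iterates increase. They stay below the
finite function `payoutBound`, a supersolution of the one-step problem
(`pathValue_add_payoutBound_le`).

To compare with the value function, the discounted dividends before ruin are split at the jump times
(`discounted_ruinTime`), and the Markov property at the jumps (`lintegral_hist_next`) yields the
one-step identity `lintegral_sojournGain_add`. Applied `k` times to an arbitrary strategy, it bounds
the dividends of the first `k` sojourns by the `k`-th iterate (`sum_lintegral_sojournGain_le`);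
monotone convergence then bounds the value by the supremum of the iterates. Conversely, paths that
are nearly optimal and measurable in the capital (`exists_measurable_nearly_optimal`) are pasted
sojourn by sojourn into an admissible strategy (`exists_continuation`), so every iterate is at most
the value. Neither a contraction argument nor a dynamic programming equation for the value is
needed, since payments are nonnegative and the jump times tend to infinity almost surely
(`ae_unbounded`).

Discounting is treated as killing at an independent exponential time (`pathValue`). Stieltjes
integrals thereby become ordinary integrals of the path, and discount factors come from the lack of
memory. -/

namespace Dividend

/-! ### The exponential law on the half-line -/

/-- The exponential law of parameter `r` as a measure on `ℝ≥0`. -/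
noncomputable def expLaw (r : ℝ) : Measure ℝ≥0 := (expMeasure r).map Real.toNNReal

lemma isProbabilityMeasure_expLaw {r : ℝ} (hr : 0 < r) : IsProbabilityMeasure (expLaw r) :=
  have := isProbabilityMeasure_expMeasure hr
  Measure.isProbabilityMeasure_map (by fun_prop)

lemma measurable_exponentialPDF (r : ℝ) : Measurable (exponentialPDF r) := by
  unfold exponentialPDF; fun_prop

lemma lintegral_expMeasure (r : ℝ) {F : ℝ → ℝ≥0∞} (hF : Measurable F) :
    ∫⁻ u, F u ∂expMeasure r = ∫⁻ u in Set.Ioi 0, exponentialPDF r u * F u := by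
  have h1 : expMeasure r = volume.withDensity (exponentialPDF r) := rfl
  rw [h1, lintegral_withDensity_eq_lintegral_mul _ (measurable_exponentialPDF r) hF,
    ← lintegral_indicator measurableSet_Ioi]
  refine lintegral_congr_ae ?_
  have : ∀ᵐ u : ℝ, u ≠ 0 := by simp [ae_iff]
  filter_upwards [this] with u hu
  rcases lt_or_gt_of_ne hu with h | h
  · simp [exponentialPDF_of_neg h, Set.indicator]
  · simp [Set.indicator, h]

lemma lintegral_expLaw (r : ℝ) {F : ℝ≥0 → ℝ≥0∞} (hF : Measurable F) :
    ∫⁻ u, F u ∂expLaw r = ∫⁻ u in Set.Ioi 0, exponentialPDF r u * F u.toNNReal := by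
  rw [expLaw, lintegral_map hF (by fun_prop), lintegral_expMeasure r (by fun_prop)]

/-- Lack of memory: translate by `t` and split the exponential. Every discount factor that appears
when a path is cut at a jump comes from here. -/
lemma setLIntegral_Ioi_expLaw (r : ℝ) (t : ℝ≥0) {F : ℝ≥0 → ℝ≥0∞} (hF : Measurable F) :
    ∫⁻ u in Set.Ioi t, F u ∂expLaw r =
      ENNReal.ofReal (Real.exp (-r * t)) * ∫⁻ u, F (t + u) ∂expLaw r := by
  rw [← lintegral_indicator measurableSet_Ioi, lintegral_expLaw r (hF.indicator measurableSet_Ioi),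
    lintegral_expLaw r (by fun_prop), ← lintegral_const_mul' _ _ ENNReal.ofReal_ne_top]
  have h1 : ∀ u ∈ Set.Ioi (0 : ℝ), exponentialPDF r u * (Set.Ioi t).indicator F u.toNNReal =
      (Set.Ioi (t : ℝ)).indicator (fun u => exponentialPDF r u * F u.toNNReal) u := by
    intro u hu
    by_cases h : (t : ℝ) < u
    · rw [Set.indicator_of_mem (show u ∈ Set.Ioi (t : ℝ) from h), Set.indicator_of_mem]
      exact Real.lt_toNNReal_iff_coe_lt.2 h
    · rw [Set.indicator_of_notMem (show u ∉ Set.Ioi (t : ℝ) from h), Set.indicator_of_notMem,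
        mul_zero]
      exact fun h' => h (Real.lt_toNNReal_iff_coe_lt.1 h')
  rw [setLIntegral_congr_fun measurableSet_Ioi h1, lintegral_indicator measurableSet_Ioi,
    Measure.restrict_restrict measurableSet_Ioi,
    Set.inter_eq_self_of_subset_left (Set.Ioi_subset_Ioi (NNReal.coe_nonneg t))]
  have h2 : (fun v : ℝ => (t : ℝ) + v) ⁻¹' Set.Ioi (t : ℝ) = Set.Ioi 0 := by ext; simp
  have h3 : Measurable fun u : ℝ => exponentialPDF r u * F u.toNNReal :=
    (measurable_exponentialPDF r).mul (by fun_prop)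
  rw [← (measurePreserving_add_left volume (t : ℝ)).setLIntegral_comp_preimage measurableSet_Ioi h3,
    h2]
  refine setLIntegral_congr_fun measurableSet_Ioi fun v hv => ?_
  have hv : 0 < v := hv
  rw [exponentialPDF_of_nonneg (by positivity), exponentialPDF_of_nonneg hv.le, ← mul_assoc,
    ← ENNReal.ofReal_mul (by positivity), Real.toNNReal_add (NNReal.coe_nonneg t) hv.le, Real.toNNReal_coe]
  congr 2
  rw [mul_left_comm, ← Real.exp_add]
  ring_nf

lemma expLaw_Ioi {r : ℝ} (hr : 0 < r) (t : ℝ≥0) :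
    expLaw r (Set.Ioi t) = ENNReal.ofReal (Real.exp (-r * t)) := by
  have := isProbabilityMeasure_expLaw hr
  simpa using setLIntegral_Ioi_expLaw r t (F := fun _ => 1) measurable_const

lemma ae_expLaw_pos {r : ℝ} (hr : 0 < r) : ∀ᵐ s ∂expLaw r, 0 < s := by
  have := isProbabilityMeasure_expLaw hr
  have h := expLaw_Ioi hr 0
  rw [NNReal.coe_zero, mul_zero, Real.exp_zero, ENNReal.ofReal_one] at h
  exact (mem_ae_iff_prob_eq_one measurableSet_Ioi).2 h

lemma ae_expMeasure_nonneg {r : ℝ} (hr : 0 < r) : ∀ᵐ s ∂expMeasure r, 0 ≤ s := by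
  have := isProbabilityMeasure_expMeasure hr
  refine (mem_ae_iff_prob_eq_one measurableSet_Ici).2 ?_
  rw [← lintegral_indicator_one measurableSet_Ici, lintegral_expMeasure r
    (measurable_one.indicator measurableSet_Ici)]
  have h : ∀ u ∈ Set.Ioi (0 : ℝ), exponentialPDF r u * (Set.Ici (0 : ℝ)).indicator 1 u =
      exponentialPDF r u * 1 := fun u hu => by
    rw [Set.indicator_of_mem (Set.mem_Ici.2 (le_of_lt hu))]; rfl
  rw [setLIntegral_congr_fun measurableSet_Ioi h, ← lintegral_expMeasure r measurable_const]
  simp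

lemma lintegral_id_expLaw_lt_top {r : ℝ} (hr : 0 < r) : ∫⁻ u : ℝ≥0, u ∂expLaw r < ⊤ := by
  rw [lintegral_expLaw r measurable_coe_nnreal_ennreal]
  calc ∫⁻ u in Set.Ioi 0, exponentialPDF r u * (u.toNNReal : ℝ≥0∞)
      ≤ ∫⁻ u in Set.Ioi 0, ENNReal.ofReal (4 / r) * exponentialPDF (r / 2) u := by
        refine setLIntegral_mono' measurableSet_Ioi fun u hu => ?_
        have hu : 0 < u := hu
        rw [exponentialPDF_of_nonneg hu.le, exponentialPDF_of_nonneg hu.le,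
          ← ENNReal.ofReal_mul (by positivity)]
        change _ * ENNReal.ofReal u ≤ _
        rw [← ENNReal.ofReal_mul (by positivity)]
        refine ENNReal.ofReal_le_ofReal ?_
        -- Half of the exponential decay absorbs the factor `u`. This costs `2 / r`, and a further
        -- factor `2` renormalises the density to the rate `r / 2`, whence `4 / r`.
        have h1 : r / 2 * u ≤ Real.exp (r / 2 * u) := by
          linarith [Real.add_one_le_exp (r / 2 * u)]
        have h2 : Real.exp (-(r / 2 * u)) = Real.exp (r / 2 * u) * Real.exp (-(r * u)) := by
          rw [← Real.exp_add]; ring_nf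
        rw [h2]
        have h3 := mul_le_mul_of_nonneg_right h1 (Real.exp_pos (-(r * u))).le
        have h4 : 4 / r * (r / 2 * (Real.exp (r / 2 * u) * Real.exp (-(r * u)))) =
          2 * (Real.exp (r / 2 * u) * Real.exp (-(r * u))) := by field_simp; norm_num
        rw [h4]
        linarith
    _ ≤ ∫⁻ u, ENNReal.ofReal (4 / r) * exponentialPDF (r / 2) u := setLIntegral_le_lintegral _ _
    _ = ENNReal.ofReal (4 / r) := by
        rw [lintegral_const_mul' _ _ ENNReal.ofReal_ne_top,
          lintegral_exponentialPDF_eq_one (by positivity), mul_one]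
    _ < ⊤ := ENNReal.ofReal_lt_top

/-! ### Discounted payments along a deterministic path -/

/-- The payments up to `h` of the cumulative dividend path `d`, discounted at rate `δ`: discounting
amounts to stopping at an independent exponential time. -/
noncomputable def pathValue (δ : ℝ) (d : ℝ≥0 → ℝ) (h : ℝ≥0) : ℝ≥0∞ :=
  ∫⁻ u, ENNReal.ofReal (d (min u h)) ∂expLaw δ

lemma pathValue_congr {δ : ℝ} {d d' : ℝ≥0 → ℝ} {h : ℝ≥0} (hd : ∀ s ≤ h, d s = d' s) :
    pathValue δ d h = pathValue δ d' h := by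
  unfold pathValue
  simp_rw [hd _ (min_le_right _ h)]

lemma pathValue_mono {δ : ℝ} {d d' : ℝ≥0 → ℝ} (hd : ∀ s, d s ≤ d' s) (h : ℝ≥0) :
    pathValue δ d h ≤ pathValue δ d' h :=
  lintegral_mono fun _ => ENNReal.ofReal_le_ofReal (hd _)

lemma measurable_pathValue {α : Type*} [MeasurableSpace α] {δ : ℝ} (hδ : 0 < δ)
    {d : α → ℝ≥0 → ℝ} (hd : Measurable (Function.uncurry d)) {h : α → ℝ≥0} (hh : Measurable h) :
    Measurable fun a => pathValue δ (d a) (h a) := by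
  have := isProbabilityMeasure_expLaw hδ
  unfold pathValue
  refine Measurable.lintegral_prod_right' (f := fun p : α × ℝ≥0 =>
    ENNReal.ofReal (d p.1 (min p.2 (h p.1)))) ?_
  refine ENNReal.measurable_ofReal.comp ?_
  exact hd.comp (measurable_fst.prodMk (measurable_snd.min (hh.comp measurable_fst)))

/-- If killing occurs after `a`, the amount paid is `d a`, already counted in the first term, plus
the increment since `a`; lack of memory turns the latter into a discounted path value. -/
lemma pathValue_add {δ : ℝ} {d : ℝ≥0 → ℝ} (hd : Monotone d) (h0 : d 0 = 0)
    (a h : ℝ≥0) :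
    pathValue δ d (a + h) = pathValue δ d a +
      ENNReal.ofReal (Real.exp (-δ * a)) * pathValue δ (fun s => d (a + s) - d a) h := by
  have hm : Measurable d := hd.measurable
  have h1 : ∀ u : ℝ≥0, ENNReal.ofReal (d (min u (a + h))) = ENNReal.ofReal (d (min u a)) +
      (Set.Ioi a).indicator (fun u => ENNReal.ofReal (d (min u (a + h)) - d a)) u := by
    intro u
    by_cases hu : a < u
    · rw [Set.indicator_of_mem (show u ∈ Set.Ioi a from hu), min_eq_right hu.le,
        ← ENNReal.ofReal_add]
      · congr 1; ring
      · rw [← h0]; exact hd zero_le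
      · exact sub_nonneg.2 (hd (le_min hu.le le_self_add))
    · rw [Set.indicator_of_notMem (show u ∉ Set.Ioi a from hu), add_zero, min_eq_left (not_lt.1 hu),
        min_eq_left ((not_lt.1 hu).trans le_self_add)]
  unfold pathValue
  simp_rw [h1]
  rw [lintegral_add_left (by fun_prop), lintegral_indicator measurableSet_Ioi,
    setLIntegral_Ioi_expLaw δ a (by fun_prop)]
  simp_rw [min_add_add_left]

/-- `f` is a cumulative dividend path. -/
structure IsPath (f : ℝ≥0 → ℝ) : Prop where
  mono : Monotone f
  left_continuous : ∀ t, ContinuousWithinAt f (Set.Iic t) t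
  zero : f 0 = 0

lemma IsPath.nonneg {f : ℝ≥0 → ℝ} (hf : IsPath f) (t : ℝ≥0) : 0 ≤ f t :=
  hf.zero ▸ hf.mono zero_le

/-- By left continuity a path is the supremum of its values at strictly earlier rational times. The
measurability and predictability arguments for dividend processes use this countable description.
Taking `0 ≤ a` disposes of `t = 0`, which has no earlier times. -/
lemma IsPath.lt_iff {f : ℝ≥0 → ℝ} (hf : IsPath f) {a : ℝ} (ha : 0 ≤ a) (t : ℝ≥0) :
    a < f t ↔ ∃ q : ℚ, (q : ℝ).toNNReal < t ∧ a < f (q : ℝ).toNNReal := by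
  constructor
  · intro h
    have ht : 0 < t := by
      rcases eq_zero_or_pos t with rfl | ht
      · rw [hf.zero] at h; exact absurd h (not_lt.2 ha)
      · exact ht
    have h1 : ∀ᶠ s in 𝓝[≤] t, a < f s := (hf.left_continuous t).eventually_const_lt h
    obtain ⟨l, hl, h2⟩ := (mem_nhdsLE_iff_exists_Ioc_subset' ht).1 h1
    obtain ⟨q, -, h3, h4⟩ := (NNReal.lt_iff_exists_rat_btwn l t).1 hl
    exact ⟨q, h4, h2 ⟨h3, h4.le⟩⟩
  · rintro ⟨q, h1, h2⟩
    exact h2.trans_le (hf.mono h1.le)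

lemma IsPath.shift {f : ℝ≥0 → ℝ} (hf : IsPath f) (a : ℝ≥0) : IsPath fun s => f (a + s) - f a where
  mono _ _ h := sub_le_sub_right (hf.mono (by gcongr)) _
  left_continuous t := by
    refine ContinuousWithinAt.sub ?_ continuousWithinAt_const
    exact (hf.left_continuous (a + t)).comp (by fun_prop) fun s (hs : s ≤ t) =>
      Set.mem_Iic.2 (by gcongr)
  zero := by simp

/-- `f` is a cumulative dividend path that is affordable with the capital `y` as long as no claim
occurs. -/
structure IsPayout (c y : ℝ) (f : ℝ≥0 → ℝ) : Prop extends IsPath f where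
  le : ∀ t : ℝ≥0, f t ≤ y + c * t

/-- The path `f` preceded by an immediate payment `r`. -/
noncomputable def raise (r : ℝ) (f : ℝ≥0 → ℝ) (t : ℝ≥0) : ℝ := (if 0 < t then r else 0) + f t

lemma raise_of_pos {r : ℝ} {f : ℝ≥0 → ℝ} {t : ℝ≥0} (ht : 0 < t) : raise r f t = r + f t := by
  simp [raise, ht]

lemma le_raise {r : ℝ} (hr : 0 ≤ r) (f : ℝ≥0 → ℝ) (t : ℝ≥0) : f t ≤ raise r f t := by
  unfold raise; split_ifs <;> linarith

lemma IsPayout.measurable {c y : ℝ} {f : ℝ≥0 → ℝ} (hf : IsPayout c y f) : Measurable f :=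
  hf.mono.measurable

lemma IsPayout.start_nonneg {c y : ℝ} {f : ℝ≥0 → ℝ} (hf : IsPayout c y f) : 0 ≤ y := by
  simpa [hf.zero] using hf.le 0

lemma IsPayout.raise {c q y : ℝ} {f : ℝ≥0 → ℝ} (hf : IsPayout c q f) (hqy : q ≤ y) :
    IsPayout c y (raise (y - q) f) where
  mono s t hst := by
    have h := hf.mono hst
    unfold Dividend.raise
    split_ifs with h1 h2 h2
    · linarith
    · exact absurd (h1.trans_le hst) h2
    · linarith
    · linarith
  left_continuous t := by
    -- The payment at time `0` is a jump to the right, invisible to left continuity because the left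
    -- neighbourhood of `0` is a single point.
    rcases eq_zero_or_pos t with rfl | ht
    · have : Set.Iic (0 : ℝ≥0) = {0} := by ext; simp
      rw [this]; exact continuousWithinAt_singleton
    · refine ((continuousWithinAt_const (b := y - q)).add (hf.left_continuous t)).congr_of_eventuallyEq
        ?_ (raise_of_pos ht)
      filter_upwards [mem_nhdsWithin_of_mem_nhds (Ioi_mem_nhds ht)] with s hs
      exact raise_of_pos hs
  zero := by simp [Dividend.raise, hf.zero]
  le t := by
    have h := hf.le t
    unfold Dividend.raise
    split_ifs <;> linarith

lemma isPayout_zero {c y : ℝ} (hc : 0 ≤ c) (hy : 0 ≤ y) : IsPayout c y fun _ => 0 :=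
  ⟨⟨monotone_const, fun _ => continuousWithinAt_const, rfl⟩, fun _ => by positivity⟩

/-! ### Transition probabilities and the a priori bound -/

namespace Model

variable {n : ℕ} (M : Model n)

lemma leaveRate_pos (i : Fin n) : 0 < M.leaveRate i := neg_pos.2 (M.diag_neg i)

lemma rate_nonneg {i : Fin n} {a : Fin (n + 1)} (h : a ≠ i.castSucc) : 0 ≤ M.rate i a := by
  induction a using Fin.lastCases with
  | last => simpa [rate] using M.exit_nonneg i
  | cast j =>
    have : i ≠ j := fun h' => h (by rw [h'])
    simpa [rate] using M.offdiag_nonneg i j this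

lemma jumpProb_nonneg (i : Fin n) (a : Fin (n + 1)) : 0 ≤ M.jumpProb i a := by
  unfold jumpProb
  split_ifs with h
  · exact le_rfl
  · exact div_nonneg (M.rate_nonneg h) (M.leaveRate_pos i).le

lemma sum_jumpProb (i : Fin n) : ∑ a, M.jumpProb i a = 1 := by
  have h : ∀ a, M.jumpProb i a = (M.rate i a - if a = i.castSucc then M.rate i a else 0) /
      M.leaveRate i := fun a => by unfold jumpProb; split_ifs <;> simp
  simp_rw [h]
  rw [← Finset.sum_div, Finset.sum_sub_distrib, Finset.sum_ite_eq' Finset.univ i.castSucc,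
    Fin.sum_univ_castSucc]
  simp only [rate, Fin.snoc_castSucc, Fin.snoc_last, exitRate, Finset.mem_univ, if_true]
  rw [add_neg_cancel, zero_sub]
  exact div_self (M.leaveRate_pos i).ne'

lemma restartProb_nonneg (a : Fin (n + 1)) (j : Fin n) : 0 ≤ M.restartProb a j := by
  unfold restartProb
  split_ifs <;> simp [M.init_nonneg]

lemma sum_restartProb (a : Fin (n + 1)) : ∑ j, M.restartProb a j = 1 := by
  induction a using Fin.lastCases with
  | last => simpa [restartProb] using M.init_sum
  | cast j => simp [restartProb]

lemma sum_ofReal_jumpProb (i : Fin n) : ∑ a, ENNReal.ofReal (M.jumpProb i a) = 1 := by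
  rw [← ENNReal.ofReal_sum_of_nonneg fun a _ => M.jumpProb_nonneg i a, sum_jumpProb,
    ENNReal.ofReal_one]

lemma sum_ofReal_init : ∑ i, ENNReal.ofReal (M.init i) = 1 := by
  rw [← ENNReal.ofReal_sum_of_nonneg fun a _ => M.init_nonneg a, M.init_sum, ENNReal.ofReal_one]

instance (i : Fin n) : IsProbabilityMeasure (expLaw (M.leaveRate i)) :=
  isProbabilityMeasure_expLaw (M.leaveRate_pos i)

instance : IsProbabilityMeasure (expLaw M.δ) := isProbabilityMeasure_expLaw M.δ_pos

instance : IsProbabilityMeasure (expMeasure M.β) := isProbabilityMeasure_expMeasure M.β_pos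

variable {M}

lemma claimValue_mono {W W' : Fin n → ℝ → ℝ≥0∞} (h : ∀ i u, W i u ≤ W' i u) (u : ℝ) :
    M.claimValue W u ≤ M.claimValue W' u :=
  Finset.sum_le_sum fun _ _ => by gcongr; exact h _ _

lemma extend_mono {W W' : Fin n → ℝ → ℝ≥0∞} (h : ∀ i u, W i u ≤ W' i u) (a : Fin (n + 1))
    (u : ℝ) : M.extend W a u ≤ M.extend W' a u := by
  induction a using Fin.lastCases with
  | last => simpa [extend] using claimValue_mono h u
  | cast j => simpa [extend] using h j u

lemma measurable_claimValue {W : Fin n → ℝ → ℝ≥0∞} (hW : ∀ i, Measurable (W i)) :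
    Measurable (M.claimValue W) := by
  unfold claimValue
  refine Finset.measurable_fun_sum _ fun i _ => Measurable.const_mul ?_ _
  have h : ∀ u, ∫⁻ y in Set.Iic u, W i (u - y) ∂expMeasure M.β =
      ∫⁻ y, (if y ≤ u then W i (u - y) else 0) ∂expMeasure M.β := fun u => by
    rw [← lintegral_indicator measurableSet_Iic]; rfl
  simp_rw [h]
  refine Measurable.lintegral_prod_right' (f := fun p : ℝ × ℝ =>
    if p.2 ≤ p.1 then W i (p.1 - p.2) else 0) ?_
  exact Measurable.ite (measurableSet_le measurable_snd measurable_fst)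
    ((hW i).comp (measurable_fst.sub measurable_snd)) measurable_const

lemma measurable_extend {W : Fin n → ℝ → ℝ≥0∞} (hW : ∀ i, Measurable (W i)) (a : Fin (n + 1)) :
    Measurable (M.extend W a) := by
  induction a using Fin.lastCases with
  | last => simpa [extend] using measurable_claimValue hW
  | cast j => simpa [extend] using hW j

variable (M)

/-- The discounted value of paying out all the capital and all premiums for ever. -/
noncomputable def payoutBound (y : ℝ) : ℝ≥0∞ := ∫⁻ u, ENNReal.ofReal (y + M.c * u) ∂expLaw M.δ

lemma payoutBound_lt_top (y : ℝ) : M.payoutBound y < ⊤ := by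
  have hc := M.c_pos
  calc M.payoutBound y
      ≤ ∫⁻ u : ℝ≥0, ENNReal.ofReal y + ENNReal.ofReal M.c * u ∂expLaw M.δ := by
        refine lintegral_mono fun u => ENNReal.ofReal_add_le.trans ?_
        rw [ENNReal.ofReal_mul hc.le, ENNReal.ofReal_coe_nnreal]
    _ = ENNReal.ofReal y + ENNReal.ofReal M.c * ∫⁻ u : ℝ≥0, u ∂expLaw M.δ := by
        rw [lintegral_add_left measurable_const, lintegral_const_mul' _ _ ENNReal.ofReal_ne_top]
        simp
    _ < ⊤ := ENNReal.add_lt_top.2 ⟨ENNReal.ofReal_lt_top,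
        ENNReal.mul_lt_top ENNReal.ofReal_lt_top (lintegral_id_expLaw_lt_top M.δ_pos)⟩

lemma monotone_payoutBound : Monotone M.payoutBound := fun _ _ h =>
  lintegral_mono fun _ => ENNReal.ofReal_le_ofReal (by linarith)

variable {M}

/-- The inequality holds for each killing time `u`. If `u ≤ s`, affordability bounds the payments by
`y + c u`; if `u > s`, the amount `f s` already paid and the remaining capital and premiums add up
to exactly `y + c u`. -/
lemma pathValue_add_payoutBound_le {y : ℝ} {f : ℝ≥0 → ℝ} (hf : IsPayout M.c y f) (s : ℝ≥0) :
    pathValue M.δ f s + ENNReal.ofReal (Real.exp (-M.δ * s)) * M.payoutBound (y + M.c * s - f s) ≤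
      M.payoutBound y := by
  have h1 : ENNReal.ofReal (Real.exp (-M.δ * s)) * M.payoutBound (y + M.c * s - f s) =
      ∫⁻ u in Set.Ioi s, ENNReal.ofReal (y + M.c * u - f s) ∂expLaw M.δ := by
    rw [setLIntegral_Ioi_expLaw _ _ (by fun_prop), payoutBound]
    congr 2 with u
    congr 1
    push_cast
    ring
  have hm := hf.measurable
  rw [h1, ← lintegral_indicator measurableSet_Ioi, pathValue, ← lintegral_add_left (by fun_prop)]
  refine lintegral_mono fun u => ?_
  by_cases hu : s < u
  · rw [Set.indicator_of_mem (show u ∈ Set.Ioi s from hu), min_eq_right hu.le, ← ENNReal.ofReal_add]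
    · exact ENNReal.ofReal_le_ofReal (by linarith)
    · exact hf.nonneg s
    · have := hf.le u
      have := hf.mono hu.le
      linarith
  · rw [Set.indicator_of_notMem (show u ∉ Set.Ioi s from hu), add_zero, min_eq_left (not_lt.1 hu)]
    exact ENNReal.ofReal_le_ofReal (hf.le u)

/-- A claim only lowers the capital and the bound is monotone, while averaging over the restart
phase has total mass one. -/
lemma extend_le_payoutBound {W : Fin n → ℝ → ℝ≥0∞} (h : ∀ i u, W i u ≤ M.payoutBound u)
    (a : Fin (n + 1)) (u : ℝ) : M.extend W a u ≤ M.payoutBound u := by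
  induction a using Fin.lastCases with
  | cast j => simpa [extend] using h j u
  | last =>
    simp only [extend, Fin.snoc_last, claimValue]
    calc ∑ i, ENNReal.ofReal (M.init i) * ∫⁻ y in Set.Iic u, W i (u - y) ∂expMeasure M.β
        ≤ ∑ i, ENNReal.ofReal (M.init i) * M.payoutBound u := by
          refine Finset.sum_le_sum fun i _ => ?_
          gcongr
          calc ∫⁻ y in Set.Iic u, W i (u - y) ∂expMeasure M.β
              ≤ ∫⁻ y, M.payoutBound u ∂expMeasure M.β := by
                refine (lintegral_mono_ae ?_).trans (setLIntegral_le_lintegral _ _)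
                filter_upwards [ae_restrict_of_ae (ae_expMeasure_nonneg M.β_pos)] with y hy
                exact (h i _).trans (M.monotone_payoutBound (by linarith))
            _ = M.payoutBound u := by simp
      _ = M.payoutBound u := by rw [← Finset.sum_mul, M.sum_ofReal_init, one_mul]

variable (M)

/-! ### The one-sojourn problem for deterministic dividend paths -/

/-- The payoff of the dividend path `f` during a sojourn of length `s` that ends in the state `a`,
with terminal payoff `W`. -/
noncomputable def sojournValue (W : Fin n → ℝ → ℝ≥0∞) (y : ℝ) (f : ℝ≥0 → ℝ) (s : ℝ≥0)
    (a : Fin (n + 1)) : ℝ≥0∞ :=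
  pathValue M.δ f s + ENNReal.ofReal (Real.exp (-M.δ * s)) * M.extend W a (y + M.c * s - f s)

/-- The expected payoff of the dividend path `f` during a sojourn in the phase `i`. -/
noncomputable def stepValue (W : Fin n → ℝ → ℝ≥0∞) (i : Fin n) (y : ℝ) (f : ℝ≥0 → ℝ) : ℝ≥0∞ :=
  ∫⁻ s, ∑ a, ENNReal.ofReal (M.jumpProb i a) * M.sojournValue W y f s a ∂expLaw (M.leaveRate i)

/-- The best expected payoff over one sojourn. -/
noncomputable def optimalStep (W : Fin n → ℝ → ℝ≥0∞) (i : Fin n) (y : ℝ) : ℝ≥0∞ :=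
  ⨆ (f : ℝ≥0 → ℝ) (_ : IsPayout M.c y f), M.stepValue W i y f

/-- The iterates of the deterministic one-sojourn problem. -/
noncomputable def stepIterate : ℕ → Fin n → ℝ → ℝ≥0∞
  | 0 => fun _ _ => 0
  | k + 1 => M.optimalStep (stepIterate k)

variable {M}

lemma measurable_sojournValue {α : Type*} [MeasurableSpace α] {W : Fin n → ℝ → ℝ≥0∞}
    (hW : ∀ i, Measurable (W i)) {y : α → ℝ} (hy : Measurable y) {f : α → ℝ≥0 → ℝ}
    (hf : Measurable (Function.uncurry f)) {s : α → ℝ≥0} (hs : Measurable s)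
    {a : α → Fin (n + 1)} (ha : Measurable a) :
    Measurable fun x => M.sojournValue W (y x) (f x) (s x) (a x) := by
  have hfs : Measurable fun x => f x (s x) := hf.comp (measurable_id.prodMk hs)
  refine (measurable_pathValue M.δ_pos hf hs).add (Measurable.mul (by fun_prop) ?_)
  have : Measurable fun p : Fin (n + 1) × ℝ => M.extend W p.1 p.2 :=
    measurable_from_prod_countable_right (measurable_extend hW)
  exact this.comp (ha.prodMk (by fun_prop))

lemma stepValue_mono {W W' : Fin n → ℝ → ℝ≥0∞} (h : ∀ i u, W i u ≤ W' i u) (i : Fin n) (y : ℝ)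
    (f : ℝ≥0 → ℝ) : M.stepValue W i y f ≤ M.stepValue W' i y f :=
  lintegral_mono fun _ => Finset.sum_le_sum fun _ _ => by
    unfold sojournValue; gcongr; exact extend_mono h _ _

/-- Paying the excess `y - q` at once leaves the same surplus afterwards and only adds dividends.
The extra payment takes effect after time `0`, so the comparison uses that the sojourn has positive
length almost surely. -/
lemma stepValue_le_raise (W : Fin n → ℝ → ℝ≥0∞) (i : Fin n) {q y : ℝ} (hqy : q ≤ y) (f : ℝ≥0 → ℝ) :
    M.stepValue W i q f ≤ M.stepValue W i y (raise (y - q) f) := by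
  refine lintegral_mono_ae ?_
  filter_upwards [ae_expLaw_pos (M.leaveRate_pos i)] with s hs
  refine Finset.sum_le_sum fun a _ => ?_
  unfold sojournValue
  rw [raise_of_pos hs]
  gcongr
  · exact pathValue_mono (le_raise (sub_nonneg.2 hqy) f) s
  · exact le_of_eq (by congr 1; ring)

lemma stepValue_le_payoutBound {W : Fin n → ℝ → ℝ≥0∞} (h : ∀ i u, W i u ≤ M.payoutBound u)
    (i : Fin n) {y : ℝ} {f : ℝ≥0 → ℝ} (hf : IsPayout M.c y f) :
    M.stepValue W i y f ≤ M.payoutBound y := by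
  calc M.stepValue W i y f
      ≤ ∫⁻ _, ∑ a, ENNReal.ofReal (M.jumpProb i a) * M.payoutBound y ∂expLaw (M.leaveRate i) := by
        refine lintegral_mono fun s => Finset.sum_le_sum fun a _ => ?_
        gcongr
        refine le_trans ?_ (pathValue_add_payoutBound_le hf s)
        unfold sojournValue
        gcongr
        exact extend_le_payoutBound h a _
    _ = M.payoutBound y := by
        rw [← Finset.sum_mul, M.sum_ofReal_jumpProb, one_mul]; simp

lemma stepValue_le_optimalStep (W : Fin n → ℝ → ℝ≥0∞) (i : Fin n) {y : ℝ} {f : ℝ≥0 → ℝ}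
    (hf : IsPayout M.c y f) : M.stepValue W i y f ≤ M.optimalStep W i y :=
  le_iSup₂_of_le f hf le_rfl

lemma optimalStep_mono {W W' : Fin n → ℝ → ℝ≥0∞} (h : ∀ i u, W i u ≤ W' i u) (i : Fin n) (y : ℝ) :
    M.optimalStep W i y ≤ M.optimalStep W' i y :=
  iSup₂_mono fun f _ => stepValue_mono h i y f

/-- Monotonicity makes this uncountable supremum Borel measurable, and it allows approximation on a
countable set of capitals. -/
lemma monotone_optimalStep (W : Fin n → ℝ → ℝ≥0∞) (i : Fin n) : Monotone (M.optimalStep W i) :=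
  fun _ _ h => iSup₂_le fun f hf =>
    (stepValue_le_raise W i h f).trans (stepValue_le_optimalStep W i (hf.raise h))

lemma optimalStep_le_payoutBound {W : Fin n → ℝ → ℝ≥0∞} (h : ∀ i u, W i u ≤ M.payoutBound u)
    (i : Fin n) (y : ℝ) : M.optimalStep W i y ≤ M.payoutBound y :=
  iSup₂_le fun _ hf => stepValue_le_payoutBound h i hf

lemma optimalStep_of_neg (W : Fin n → ℝ → ℝ≥0∞) (i : Fin n) {y : ℝ} (hy : y < 0) :
    M.optimalStep W i y = 0 := by
  refine le_antisymm (iSup₂_le fun f hf => ?_) bot_le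
  exact absurd hf.start_nonneg (not_le.2 hy)

lemma stepIterate_le_payoutBound (k : ℕ) (i : Fin n) (y : ℝ) :
    M.stepIterate k i y ≤ M.payoutBound y := by
  induction k generalizing i y with
  | zero => exact bot_le
  | succ k ih => exact optimalStep_le_payoutBound ih i y

lemma measurable_stepIterate (k : ℕ) (i : Fin n) : Measurable (M.stepIterate k i) := by
  cases k with
  | zero => exact measurable_const
  | succ k => exact (monotone_optimalStep _ i).measurable

lemma stepIterate_mono : Monotone (M.stepIterate) := by
  refine monotone_nat_of_le_succ fun k => ?_
  induction k with
  | zero => exact fun i y => bot_le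
  | succ k ih => exact fun i y => optimalStep_mono ih i y

end Model

/-! ### Measurable selection of nearly optimal paths -/

/-- The sequence enumerates the rationals and the countably many discontinuities of `V`. A
discontinuity serves as its own approximation; at a positive continuity point a rational slightly
below works. -/
lemma exists_countable_approx_of_monotone {V : ℝ → ℝ≥0∞} (hV : Monotone V) (hfin : ∀ y, V y ≠ ⊤)
    {ε : ℝ≥0∞} (hε : ε ≠ 0) :
    ∃ q : ℕ → ℝ, ∀ y, 0 ≤ y → ∃ k, 0 ≤ q k ∧ q k ≤ y ∧ V y ≤ V (q k) + ε := by
  have hQ : ({y | ¬ContinuousAt V y} ∪ Set.range ((↑) : ℚ → ℝ)).Countable :=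
    hV.countable_not_continuousAt.union (Set.countable_range _)
  obtain ⟨q, hq⟩ := hQ.exists_eq_range ⟨0, Or.inr ⟨0, by simp⟩⟩
  have key : ∀ z ∈ {y | ¬ContinuousAt V y} ∪ Set.range ((↑) : ℚ → ℝ), ∃ k, q k = z := by
    rw [hq]; exact fun z hz => hz
  refine ⟨q, fun y hy => ?_⟩
  suffices ∃ z ∈ {y | ¬ContinuousAt V y} ∪ Set.range ((↑) : ℚ → ℝ), 0 ≤ z ∧ z ≤ y ∧
      V y ≤ V z + ε by
    obtain ⟨z, hz, h⟩ := this
    obtain ⟨k, rfl⟩ := key z hz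
    exact ⟨k, h⟩
  by_cases hc : ContinuousAt V y
  · rcases hy.eq_or_lt with rfl | hy
    · exact ⟨0, Or.inr ⟨0, by simp⟩, le_rfl, le_rfl, le_self_add⟩
    · have h1 : Tendsto (fun z => V z + ε) (𝓝 y) (𝓝 (V y + ε)) := hc.tendsto.add tendsto_const_nhds
      have h2 : ∀ᶠ z in 𝓝 y, V y < V z + ε :=
        h1.eventually_const_lt (ENNReal.lt_add_right (hfin y) hε)
      obtain ⟨l, hl, h3⟩ := exists_Ioc_subset_of_mem_nhds h2 ⟨_, hy⟩
      obtain ⟨z, hz1, hz2⟩ := exists_rat_btwn (max_lt hl hy)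
      exact ⟨z, Or.inr ⟨z, rfl⟩, ((le_max_right _ _).trans hz1.le), hz2.le,
        (h3 ⟨(le_max_left _ _).trans_lt hz1, hz2.le⟩ : V y < V z + ε).le⟩
  · exact ⟨y, Or.inl hc, hy, le_rfl, le_self_add⟩

namespace Model

variable {n : ℕ} {M : Model n}

/-- Nearly optimal dividend paths can be chosen measurably in the initial capital. -/
lemma exists_measurable_nearly_optimal {W : Fin n → ℝ → ℝ≥0∞} (h : ∀ i u, W i u ≤ M.payoutBound u)
    {ε : ℝ≥0∞} (hε : ε ≠ 0) (i : Fin n) :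
    ∃ φ : ℝ → ℝ≥0 → ℝ, Measurable (Function.uncurry φ) ∧ (∀ y, 0 ≤ y → IsPayout M.c y (φ y)) ∧
      ∀ y, 0 ≤ y → M.optimalStep W i y ≤ M.stepValue W i y (φ y) + (ε + ε) := by
  have hfin : ∀ y, M.optimalStep W i y ≠ ⊤ := fun y =>
    ((optimalStep_le_payoutBound h i y).trans_lt (M.payoutBound_lt_top y)).ne
  obtain ⟨q, hq⟩ := exists_countable_approx_of_monotone (monotone_optimalStep W i) hfin hε
  have hf : ∀ y, 0 ≤ y → ∃ f, IsPayout M.c y f ∧ M.optimalStep W i y ≤ M.stepValue W i y f + ε := by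
    intro y hy
    by_cases h0 : M.optimalStep W i y = 0
    · exact ⟨fun _ => 0, isPayout_zero M.c_pos.le hy, by simp [h0]⟩
    · obtain ⟨f, hf⟩ := lt_iSup_iff.1 (ENNReal.sub_lt_self (hfin y) h0 hε)
      obtain ⟨hf1, hf2⟩ := lt_iSup_iff.1 hf
      exact ⟨f, hf1, tsub_le_iff_right.1 hf2.le⟩
  -- This choice need not be measurable in the capital, since it will be used only at the countably
  -- many values `q k`.
  choose! f hf1 hf2 using hf
  classical
  -- The disjunct `y < 0` makes the least admissible index a total measurable function of `y`.
  have hp : ∀ y : ℝ, ∃ k, y < 0 ∨ (0 ≤ q k ∧ q k ≤ y ∧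
      M.optimalStep W i y ≤ M.optimalStep W i (q k) + ε) := fun y => by
    rcases lt_or_ge y 0 with hy | hy
    · exact ⟨0, Or.inl hy⟩
    · obtain ⟨k, hk⟩ := hq y hy
      exact ⟨k, Or.inr hk⟩
  have hm : Measurable fun y => Nat.find (hp y) := by
    refine measurable_find hp fun k => ?_
    have := (monotone_optimalStep (M := M) W i).measurable
    exact measurableSet_Iio.union (MeasurableSet.inter (MeasurableSet.const _)
      (measurableSet_Ici.inter (measurableSet_le this measurable_const)))
  have hspec : ∀ y, 0 ≤ y → 0 ≤ q (Nat.find (hp y)) ∧ q (Nat.find (hp y)) ≤ y ∧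
      M.optimalStep W i y ≤ M.optimalStep W i (q (Nat.find (hp y))) + ε := fun y hy =>
    (Nat.find_spec (hp y)).resolve_left (not_lt.2 hy)
  -- Round the capital down to `q k`, pay the difference at once and follow the path chosen for `q
  -- k`. One `ε` is lost in the rounding and one in the choice of the path. The value `0` for `q k <
  -- 0` serves only measurability in the index.
  refine ⟨fun y => raise (y - q (Nat.find (hp y)))
    (if 0 ≤ q (Nat.find (hp y)) then f (q (Nat.find (hp y))) else 0), ?_, fun y hy => ?_,
    fun y hy => ?_⟩
  · have h1 : Measurable fun p : ℕ × (ℝ × ℝ≥0) =>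
        raise (p.2.1 - q p.1) (if 0 ≤ q p.1 then f (q p.1) else 0) p.2.2 := by
      refine measurable_from_prod_countable_right fun k => ?_
      refine Measurable.add (Measurable.ite ?_ (by fun_prop) measurable_const) ?_
      · exact measurableSet_lt measurable_const measurable_snd
      · by_cases hk : 0 ≤ q k
        · simp only [hk, if_true]
          exact (hf1 _ hk).measurable.comp measurable_snd
        · simp only [hk, if_false]
          exact measurable_const
    exact h1.comp ((hm.comp measurable_fst).prodMk measurable_id)
  · obtain ⟨h1, h2, -⟩ := hspec y hy
    simp only [if_pos h1]
    exact (hf1 _ h1).raise h2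
  · obtain ⟨h1, h2, h3⟩ := hspec y hy
    simp only [if_pos h1]
    rw [← add_assoc]
    refine h3.trans ?_
    gcongr
    refine (hf2 _ h1).trans ?_
    gcongr
    exact stepValue_le_raise W i h2 _

end Model

end Dividend

/-! ### The law of the next sojourn given the completed ones -/

namespace Dividend

lemma lintegral_eq_tsum_fiber {Ω γ : Type*} [MeasurableSpace Ω] {P : Measure Ω} [Countable γ]
    [MeasurableSpace γ] [MeasurableSingletonClass γ] {g : Ω → γ} (hg : Measurable g)
    (F : Ω → ℝ≥0∞) : ∫⁻ ω, F ω ∂P = ∑' b, ∫⁻ ω in g ⁻¹' {b}, F ω ∂P := by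
  rw [← lintegral_iUnion (fun b => hg (measurableSet_singleton b)), ← Set.preimage_iUnion,
    Set.iUnion_of_singleton, Set.preimage_univ, Measure.restrict_univ]
  exact fun b b' h => Disjoint.preimage _ (Set.disjoint_singleton.2 h)

/-- The open rays miss the point `0` and hence do not span the half-line; `univ` is added so that
uniqueness of product measures applies. -/
lemma generateFrom_insert_univ_Ioi :
    MeasurableSpace.generateFrom (insert Set.univ (Set.range (Set.Ioi : ℝ≥0 → Set ℝ≥0))) =
      (inferInstance : MeasurableSpace ℝ≥0) := by
  have h : (inferInstance : MeasurableSpace ℝ≥0) =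
      MeasurableSpace.generateFrom (Set.range (Set.Ioi : ℝ≥0 → Set ℝ≥0)) := by
    rw [BorelSpace.measurable_eq (α := ℝ≥0), borel_eq_generateFrom_Ioi]
  rw [h]
  refine le_antisymm (MeasurableSpace.generateFrom_le ?_)
    (MeasurableSpace.generateFrom_mono (Set.subset_insert _ _))
  rintro s (rfl | hs)
  · exact MeasurableSet.univ
  · exact MeasurableSpace.measurableSet_generateFrom hs

lemma isPiSystem_insert_univ_Ioi :
    IsPiSystem (insert Set.univ (Set.range (Set.Ioi : ℝ≥0 → Set ℝ≥0))) := by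
  rintro s (rfl | ⟨a, rfl⟩) t (rfl | ⟨b, rfl⟩) -
  · exact Or.inl (by simp)
  · exact Or.inr ⟨b, by simp⟩
  · exact Or.inr ⟨a, by simp⟩
  · exact Or.inr ⟨a ⊔ b, by simp [Set.Ioi_inter_Ioi]⟩

lemma measurable_lintegral_of_countable {ι γ α : Type*} [Countable ι] [MeasurableSpace ι]
    [MeasurableSingletonClass ι] [MeasurableSpace γ] [MeasurableSpace α] (K : ι → Measure γ)
    [∀ i, SFinite (K i)] {i : α → ι} (hi : Measurable i) {F : α → γ → ℝ≥0∞}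
    (hF : Measurable (Function.uncurry F)) : Measurable fun x => ∫⁻ z, F x z ∂K (i x) := by
  have h : ∀ j, Measurable fun x => ∫⁻ z, F x z ∂K j := fun j => by
    have h' : Measurable fun x => ∫⁻ z, Function.uncurry F (x, z) ∂K j :=
      Measurable.lintegral_prod_right' hF
    exact h'
  exact (measurable_from_prod_countable_right
    (f := fun p : ι × α => ∫⁻ z, F p.2 z ∂K p.1) h).comp (hi.prodMk measurable_id)

namespace Model

variable {n : ℕ} (M : Model n)

/-- The law of a sojourn in the phase `i`, of the state entered next and of the next phase. -/
noncomputable def nextLaw (i : Fin n) : Measure (ℝ≥0 × Fin (n + 1) × Fin n) :=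
  ∑ a, ∑ j, ENNReal.ofReal (M.jumpProb i a * M.restartProb a j) •
    (expLaw (M.leaveRate i)).map fun s => (s, a, j)

lemma lintegral_nextLaw (i : Fin n) {F : ℝ≥0 × Fin (n + 1) × Fin n → ℝ≥0∞} (hF : Measurable F) :
    ∫⁻ z, F z ∂M.nextLaw i = ∑ a, ∑ j, ENNReal.ofReal (M.jumpProb i a * M.restartProb a j) *
      ∫⁻ s, F (s, a, j) ∂expLaw (M.leaveRate i) := by
  unfold nextLaw
  rw [lintegral_finsetSum_measure]
  refine Finset.sum_congr rfl fun a _ => ?_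
  rw [lintegral_finsetSum_measure]
  refine Finset.sum_congr rfl fun j _ => ?_
  rw [lintegral_smul_measure, lintegral_map hF (by fun_prop), smul_eq_mul]

lemma sum_jumpProb_mul_restartProb (i : Fin n) :
    ∑ a, ∑ j, ENNReal.ofReal (M.jumpProb i a * M.restartProb a j) = 1 := by
  simp_rw [ENNReal.ofReal_mul (M.jumpProb_nonneg i _), ← Finset.mul_sum,
    ← ENNReal.ofReal_sum_of_nonneg fun j _ => M.restartProb_nonneg _ j, sum_restartProb,
    ENNReal.ofReal_one, mul_one]
  exact M.sum_ofReal_jumpProb i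

instance (i : Fin n) : IsProbabilityMeasure (M.nextLaw i) := by
  constructor
  rw [← lintegral_one, M.lintegral_nextLaw i measurable_const]
  simpa using M.sum_jumpProb_mul_restartProb i

end Model

namespace RiskProcess

variable {n : ℕ} {M : Model n} {Ω : Type*} [MeasurableSpace Ω] {P : Measure Ω}
  (R : RiskProcess M P)

/-- The sojourns completed at the `m`-th jump. -/
def sojourns (m : ℕ) (ω : Ω) (l : Fin m) : Fin n × ℝ≥0 × Fin (n + 1) :=
  (R.phase l ω, R.hold l ω, R.target l ω)

/-- What happens from the `m`-th jump to the next one, the size of a claim excepted. -/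
def next (m : ℕ) (ω : Ω) : ℝ≥0 × Fin (n + 1) × Fin n :=
  (R.hold m ω, R.target m ω, R.phase (m + 1) ω)

lemma measurable_sojourns (m : ℕ) : Measurable (R.sojourns m) :=
  measurable_pi_lambda _ fun l => (R.measurable_phase l).prodMk
    ((R.measurable_hold l).prodMk (R.measurable_target l))

lemma measurable_next (m : ℕ) : Measurable (R.next m) :=
  (R.measurable_hold m).prodMk ((R.measurable_target m).prodMk (R.measurable_phase (m + 1)))

/-- At `t = 0` the exponential in `markov` equals one; summing over the current phase, the target
and the next phase leaves total mass one. -/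
lemma ae_hold_pos [IsProbabilityMeasure P] (m : ℕ) : ∀ᵐ ω ∂P, 0 < R.hold m ω := by
  have hms : MeasurableSet {ω | 0 < R.hold m ω} :=
    measurableSet_lt measurable_const (R.measurable_hold m)
  refine (mem_ae_iff_prob_eq_one hms).2 ?_
  have hg : Measurable fun ω => (R.phase m ω, R.target m ω, R.phase (m + 1) ω) :=
    (R.measurable_phase m).prodMk ((R.measurable_target m).prodMk (R.measurable_phase (m + 1)))
  rw [← lintegral_indicator_one hms, lintegral_eq_tsum_fiber hg, tsum_fintype,
    Fintype.sum_prod_type]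
  simp_rw [Fintype.sum_prod_type]
  have key : ∀ (i : Fin n) (a : Fin (n + 1)) (j : Fin n),
      ∫⁻ ω in (fun ω => (R.phase m ω, R.target m ω, R.phase (m + 1) ω)) ⁻¹' {(i, a, j)},
        {ω | 0 < R.hold m ω}.indicator 1 ω ∂P =
      P (R.phase m ⁻¹' {i}) * ENNReal.ofReal (M.jumpProb i a * M.restartProb a j) := by
    intro i a j
    have h := R.markov m Set.univ MeasurableSet.univ i 0 a j
    simp only [Set.mem_univ, true_and, NNReal.coe_zero, mul_zero, Real.exp_zero, one_mul] at h
    rw [lintegral_indicator_one hms, Measure.restrict_apply hms]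
    refine Eq.trans (congrArg P ?_) h
    ext ω
    simp only [Set.mem_inter_iff, Set.mem_preimage, Set.mem_singleton_iff, Set.mem_ofPred_eq,
      Prod.mk.injEq]
    tauto
  simp_rw [key, ← Finset.mul_sum, M.sum_jumpProb_mul_restartProb, mul_one]
  have h1 := lintegral_eq_tsum_fiber (P := P) (R.measurable_phase m) 1
  simp only [Pi.one_apply, lintegral_one, measure_univ, tsum_fintype, Measure.restrict_apply,
    MeasurableSet.univ, Set.univ_inter] at h1
  exact h1.symm

/-- On rectangles with a ray as second side this is `markov`, and such rectangles, together with
those having `univ` as second side, determine the measure. -/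
lemma map_sojourns_hold [IsProbabilityMeasure P] (m : ℕ) (i : Fin n) (a : Fin (n + 1))
    (j : Fin n) :
    (P.restrict (R.phase m ⁻¹' {i} ∩ (R.target m ⁻¹' {a} ∩ R.phase (m + 1) ⁻¹' {j}))).map
        (fun ω => (R.sojourns m ω, R.hold m ω)) =
      (ENNReal.ofReal (M.jumpProb i a * M.restartProb a j) •
        (P.restrict (R.phase m ⁻¹' {i})).map (R.sojourns m)).prod (expLaw (M.leaveRate i)) := by
  symm
  have hfin : IsFiniteMeasure (ENNReal.ofReal (M.jumpProb i a * M.restartProb a j) •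
      (P.restrict (R.phase m ⁻¹' {i})).map (R.sojourns m)) :=
    Measure.smul_finite _ ENNReal.ofReal_ne_top
  refine Measure.prod_eq_generateFrom MeasurableSpace.generateFrom_measurableSet
    generateFrom_insert_univ_Ioi MeasurableSpace.isPiSystem_measurableSet
    isPiSystem_insert_univ_Ioi (Measure.toFiniteSpanningSetsIn _)
    ⟨fun _ => Set.univ, fun _ => Or.inl rfl, fun _ => measure_lt_top _ _, Set.iUnion_const _⟩ ?_
  have hIoi : ∀ s, MeasurableSet s → ∀ t : ℝ≥0,
      ((P.restrict (R.phase m ⁻¹' {i} ∩ (R.target m ⁻¹' {a} ∩ R.phase (m + 1) ⁻¹' {j}))).map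
        (fun ω => (R.sojourns m ω, R.hold m ω))) (s ×ˢ Set.Ioi t) =
      (ENNReal.ofReal (M.jumpProb i a * M.restartProb a j) •
        (P.restrict (R.phase m ⁻¹' {i})).map (R.sojourns m)) s *
        ENNReal.ofReal (Real.exp (-M.leaveRate i * t)) := by
    intro s hs t
    rw [Measure.map_apply ((R.measurable_sojourns m).prodMk (R.measurable_hold m))
      (hs.prod measurableSet_Ioi), Measure.restrict_apply
      (((R.measurable_sojourns m).prodMk (R.measurable_hold m)) (hs.prod measurableSet_Ioi)),
      Measure.smul_apply, Measure.map_apply (R.measurable_sojourns m) hs,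
      Measure.restrict_apply (R.measurable_sojourns m hs), smul_eq_mul,
      mul_comm (ENNReal.ofReal _) (P _), mul_assoc, ← ENNReal.ofReal_mul
      (mul_nonneg (M.jumpProb_nonneg i a) (M.restartProb_nonneg a j)), mul_comm (_ * _) (Real.exp _),
      ← mul_assoc]
    refine Eq.trans (congrArg P ?_) (R.markov m s hs i t a j)
    ext ω
    simp only [Set.mem_inter_iff, Set.mem_preimage, Set.mem_singleton_iff, Set.mem_ofPred_eq,
      Set.mem_prod, Set.mem_Ioi]
    unfold sojourns
    tauto
  intro s hs t ht
  have hs : MeasurableSet s := hs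
  obtain rfl | ⟨t, rfl⟩ := ht
  -- The whole half-line differs from the ray at `0` by a null event, because the holding time is
  -- almost surely positive.
  · have h := hIoi s hs 0
    rw [NNReal.coe_zero, mul_zero, Real.exp_zero, ENNReal.ofReal_one, mul_one] at h
    rw [measure_univ, mul_one, ← h]
    rw [Measure.map_apply ((R.measurable_sojourns m).prodMk (R.measurable_hold m))
      (hs.prod MeasurableSet.univ), Measure.map_apply
      ((R.measurable_sojourns m).prodMk (R.measurable_hold m)) (hs.prod measurableSet_Ioi)]
    refine measure_congr (ae_restrict_of_ae ?_)
    filter_upwards [R.ae_hold_pos m] with ω hω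
    refine propext (and_congr_right fun _ => ?_)
    simpa using hω
  · rw [hIoi s hs t, expLaw_Ioi (M.leaveRate_pos i)]

/-- Given the completed sojourns and the current phase, what happens up to the next jump is
distributed according to `nextLaw`. -/
lemma lintegral_next [IsProbabilityMeasure P] (m : ℕ)
    {F : (Fin m → Fin n × ℝ≥0 × Fin (n + 1)) × Fin n → ℝ≥0 × Fin (n + 1) × Fin n → ℝ≥0∞}
    (hF : Measurable (Function.uncurry F)) :
    ∫⁻ ω, F (R.sojourns m ω, R.phase m ω) (R.next m ω) ∂P =
      ∫⁻ ω, ∫⁻ z, F (R.sojourns m ω, R.phase m ω) z ∂M.nextLaw (R.phase m ω) ∂P := by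
  rw [lintegral_eq_tsum_fiber (R.measurable_phase m), lintegral_eq_tsum_fiber (R.measurable_phase m)]
  refine tsum_congr fun i => ?_
  have hi : MeasurableSet (R.phase m ⁻¹' {i}) := R.measurable_phase m (measurableSet_singleton i)
  have hg : Measurable fun ω => (R.target m ω, R.phase (m + 1) ω) :=
    (R.measurable_target m).prodMk (R.measurable_phase (m + 1))
  have hFi : ∀ a j, Measurable fun p : (Fin m → Fin n × ℝ≥0 × Fin (n + 1)) × ℝ≥0 =>
      F (p.1, i) (p.2, a, j) := fun a j =>
    hF.comp (f := fun p : (Fin m → Fin n × ℝ≥0 × Fin (n + 1)) × ℝ≥0 => ((p.1, i), (p.2, a, j)))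
      (by fun_prop)
  have h1 : ∀ ω ∈ R.phase m ⁻¹' {i},
      ∫⁻ z, F (R.sojourns m ω, R.phase m ω) z ∂M.nextLaw (R.phase m ω) =
        ∑ a, ∑ j, ENNReal.ofReal (M.jumpProb i a * M.restartProb a j) *
          ∫⁻ s, F (R.sojourns m ω, i) (s, a, j) ∂expLaw (M.leaveRate i) := fun ω hω => by
    have hω : R.phase m ω = i := hω
    rw [hω, M.lintegral_nextLaw i (by exact hF.comp measurable_prodMk_left)]
  have h2 : ∀ a j, Measurable fun ω => ∫⁻ s, F (R.sojourns m ω, i) (s, a, j)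
      ∂expLaw (M.leaveRate i) := fun a j =>
    (hFi a j).lintegral_prod_right'.comp (R.measurable_sojourns m)
  rw [setLIntegral_congr_fun hi h1, lintegral_eq_tsum_fiber hg, tsum_fintype,
    Fintype.sum_prod_type, lintegral_finsetSum _ fun a _ =>
      Finset.measurable_fun_sum _ fun j _ => (h2 a j).const_mul _]
  refine Finset.sum_congr rfl fun a _ => ?_
  rw [lintegral_finsetSum _ fun j _ => (h2 a j).const_mul _]
  refine Finset.sum_congr rfl fun j _ => ?_
  have h3 : (P.restrict (R.phase m ⁻¹' {i})).restrict
      ((fun ω => (R.target m ω, R.phase (m + 1) ω)) ⁻¹' {(a, j)}) =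
      P.restrict (R.phase m ⁻¹' {i} ∩ (R.target m ⁻¹' {a} ∩ R.phase (m + 1) ⁻¹' {j})) := by
    rw [Measure.restrict_restrict (hg (measurableSet_singleton _)), Set.inter_comm]
    congr 2
    ext ω; simp
  have hms : MeasurableSet (R.phase m ⁻¹' {i} ∩ (R.target m ⁻¹' {a} ∩ R.phase (m + 1) ⁻¹' {j})) :=
    hi.inter ((R.measurable_target m (measurableSet_singleton a)).inter
      (R.measurable_phase (m + 1) (measurableSet_singleton j)))
  rw [h3]
  have h4 : ∀ ω ∈ R.phase m ⁻¹' {i} ∩ (R.target m ⁻¹' {a} ∩ R.phase (m + 1) ⁻¹' {j}),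
      F (R.sojourns m ω, R.phase m ω) (R.next m ω) =
        F (R.sojourns m ω, i) (R.hold m ω, a, j) := by
    rintro ω ⟨h5, h6, h7⟩
    have h5 : R.phase m ω = i := h5
    have h6 : R.target m ω = a := h6
    have h7 : R.phase (m + 1) ω = j := h7
    simp only [next, h5, h6, h7]
  rw [setLIntegral_congr_fun hms h4, ← lintegral_map
    (f := fun p : (Fin m → Fin n × ℝ≥0 × Fin (n + 1)) × ℝ≥0 => F (p.1, i) (p.2, a, j)) (hFi a j)
    ((R.measurable_sojourns m).prodMk (R.measurable_hold m)), map_sojourns_hold,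
    lintegral_prod _ (hFi a j).aemeasurable, lintegral_smul_measure, smul_eq_mul,
    lintegral_map (hFi a j).lintegral_prod_right' (R.measurable_sojourns m),
    lintegral_const_mul' _ _ ENNReal.ofReal_ne_top]

end RiskProcess

end Dividend

/-! ### The history including claim sizes, and the Markov property at jumps -/

namespace Dividend

lemma lintegral_comp_of_indepFun {Ω α γ : Type*} [MeasurableSpace Ω] [MeasurableSpace α]
    [MeasurableSpace γ] {P : Measure Ω} [IsProbabilityMeasure P] {X : Ω → α} {Y : Ω → γ}
    (hXY : IndepFun X Y P) (hX : Measurable X) (hY : Measurable Y) {g : α → γ → ℝ≥0∞}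
    (hg : Measurable (Function.uncurry g)) :
    ∫⁻ ω, g (X ω) (Y ω) ∂P = ∫⁻ ω, ∫⁻ ω', g (X ω) (Y ω') ∂P ∂P := by
  have h := (indepFun_iff_map_prod_eq_prod_map_map hX.aemeasurable hY.aemeasurable).1 hXY
  have := Measure.isProbabilityMeasure_map (μ := P) hX.aemeasurable
  have := Measure.isProbabilityMeasure_map (μ := P) hY.aemeasurable
  have h1 : ∫⁻ ω, g (X ω) (Y ω) ∂P =
      ∫⁻ p, Function.uncurry g p ∂(P.map fun ω => (X ω, Y ω)) := by
    rw [lintegral_map hg (hX.prodMk hY)]; rfl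
  rw [h1, h, lintegral_prod _ hg.aemeasurable, lintegral_map hg.lintegral_prod_right' hX]
  refine lintegral_congr fun ω => ?_
  rw [lintegral_map (by exact hg.comp measurable_prodMk_left) hY]
  rfl

/-- The sequence `v` with the entries from `r` on replaced by `0`. -/
def truncate (r : ℕ) (v : ℕ → ℝ) (k : ℕ) : ℝ := if k < r then v k else 0

lemma measurable_truncate (r : ℕ) : Measurable (truncate r) := by
  refine measurable_pi_lambda _ fun k => ?_
  by_cases h : k < r
  · simp only [truncate, h, if_true]; fun_prop
  · simp only [truncate, h, if_false]; fun_prop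

/-- The information available just after the `m`-th jump: the completed sojourns, the current
phase, and the sizes of the past claims. -/
abbrev Hist (n m : ℕ) : Type :=
  ((Fin m → Fin n × ℝ≥0 × Fin (n + 1)) × Fin n) × (ℕ → ℝ)

namespace Hist

variable {n m : ℕ}

/-- The number of past claims. -/
def claimCount (s : Fin m → Fin n × ℝ≥0 × Fin (n + 1)) : ℕ :=
  ∑ l, if (s l).2.2 = Fin.last n then 1 else 0

lemma measurable_claimCount : Measurable (claimCount (n := n) (m := m)) :=
  Finset.measurable_fun_sum _ fun l _ => Measurable.ite
    ((measurable_snd.comp (measurable_snd.comp (measurable_pi_apply l))) (measurableSet_singleton _))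
    measurable_const measurable_const

/-- The current phase. -/
def phase (h : Hist n m) : Fin n := h.1.2

lemma measurable_phase : Measurable (phase (n := n) (m := m)) := measurable_snd.comp measurable_fst

end Hist

namespace RiskProcess

variable {n : ℕ} {M : Model n} {Ω : Type*} [MeasurableSpace Ω] {P : Measure Ω}
  (R : RiskProcess M P)

/-- The number of claims among the first `m` jumps. -/
def claimsBefore (m : ℕ) (ω : Ω) : ℕ :=
  ∑ l ∈ Finset.range m, if R.target l ω = Fin.last n then 1 else 0

lemma claimCount_sojourns (m : ℕ) (ω : Ω) :
    Hist.claimCount (R.sojourns m ω) = R.claimsBefore m ω :=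
  Fin.sum_univ_eq_sum_range (fun l => if R.target l ω = Fin.last n then 1 else 0) m

lemma measurable_claimsBefore (m : ℕ) : Measurable (R.claimsBefore m) :=
  Finset.measurable_fun_sum _ fun l _ => Measurable.ite
    (R.measurable_target l (measurableSet_singleton _)) measurable_const measurable_const

/-- The information available just after the `m`-th jump. -/
def hist (m : ℕ) (ω : Ω) : Hist n m :=
  ((R.sojourns m ω, R.phase m ω), truncate (R.claimsBefore m ω) fun k => R.claim k ω)

/-- The claim that occurs at the `m`-th jump, if that is a claim. -/
def nextClaim (m : ℕ) (ω : Ω) : ℝ := R.claim (R.claimsBefore m ω) ω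

lemma measurable_claims : Measurable fun ω (k : ℕ) => R.claim k ω :=
  measurable_pi_lambda _ R.measurable_claim

lemma measurable_hist (m : ℕ) : Measurable (R.hist m) :=
  ((R.measurable_sojourns m).prodMk (R.measurable_phase m)).prodMk
    (measurable_eval (f := fun r ω => truncate r fun k => R.claim k ω)
      (fun r => (measurable_truncate r).comp R.measurable_claims) (R.measurable_claimsBefore m))

lemma indepFun_claims_sojourns (m : ℕ) :
    IndepFun (fun ω (k : ℕ) => R.claim k ω)
      (fun ω => ((R.sojourns m ω, R.phase m ω), R.next m ω)) P := by
  refine R.claim_indep_phase.comp (φ := id)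
    (ψ := fun z : ℕ → Fin n × ℝ≥0 × Fin (n + 1) =>
      (((fun l : Fin m => z l), (z m).1), ((z m).2.1, (z m).2.2, (z (m + 1)).1))) measurable_id ?_
  fun_prop

lemma indepFun_truncate_claim (r : ℕ) :
    IndepFun (fun ω => truncate r fun k => R.claim k ω) (R.claim r) P := by
  have h := R.claim_indep.indepFun_finset (Finset.range r) {r} (by simp) R.measurable_claim
  have h1 : Measurable fun (v : Finset.range r → ℝ) (k : ℕ) =>
      if hk : k ∈ Finset.range r then v ⟨k, hk⟩ else 0 := by
    refine measurable_pi_lambda _ fun k => ?_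
    by_cases hk : k ∈ Finset.range r
    · simp only [hk, dif_pos]; fun_prop
    · simp only [hk, dif_neg, not_false_iff]; fun_prop
  have h2 : Measurable fun v : ({r} : Finset ℕ) → ℝ => v ⟨r, by simp⟩ := by fun_prop
  have h3 := h.comp h1 h2
  simp only [Function.comp_def, Finset.mem_range, dite_eq_ite] at h3
  exact h3

/-- The joint law of the information at the `m`-th jump and of what happens at the next jump. -/
lemma lintegral_hist_next [IsProbabilityMeasure P] (m : ℕ)
    {F : Hist n m → ℝ≥0 × Fin (n + 1) × Fin n → ℝ → ℝ≥0∞}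
    (hF : Measurable fun p : (Hist n m × (ℝ≥0 × Fin (n + 1) × Fin n)) × ℝ => F p.1.1 p.1.2 p.2) :
    ∫⁻ ω, F (R.hist m ω) (R.next m ω) (R.nextClaim m ω) ∂P =
      ∫⁻ ω, ∫⁻ z, ∫⁻ y, F (R.hist m ω) z y ∂expMeasure M.β ∂M.nextLaw (R.phase m ω) ∂P := by
  -- The index of the next claim is random. On the event of exactly `r` past claims it is `r`, and
  -- independence at a fixed index can be used.
  rw [lintegral_eq_tsum_fiber (R.measurable_claimsBefore m),
    lintegral_eq_tsum_fiber (R.measurable_claimsBefore m)]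
  refine tsum_congr fun r => ?_
  have hr : MeasurableSet (R.claimsBefore m ⁻¹' {r}) :=
    R.measurable_claimsBefore m (measurableSet_singleton r)
  -- The restriction to `r` past claims is built into the integrand. It is a function of the
  -- sojourns alone, so it remains meaningful once claims and phases are integrated over separate
  -- copies of `Ω`.
  let G : (Fin m → Fin n × ℝ≥0 × Fin (n + 1)) × Fin n → ℝ≥0 × Fin (n + 1) × Fin n →
      (ℕ → ℝ) → ℝ → ℝ≥0∞ :=
    fun θ z v y => if Hist.claimCount θ.1 = r then F (θ, v) z y else 0
  have hG : Measurable fun p : (((Fin m → Fin n × ℝ≥0 × Fin (n + 1)) × Fin n) ×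
      (ℝ≥0 × Fin (n + 1) × Fin n)) × (ℕ → ℝ) × ℝ => G p.1.1 p.1.2 p.2.1 p.2.2 := by
    refine Measurable.ite ?_ ?_ measurable_const
    · exact (Hist.measurable_claimCount.comp
        (measurable_fst.comp (measurable_fst.comp measurable_fst))) (measurableSet_singleton r)
    · exact hF.comp (f := fun p : (((Fin m → Fin n × ℝ≥0 × Fin (n + 1)) × Fin n) ×
        (ℝ≥0 × Fin (n + 1) × Fin n)) × (ℕ → ℝ) × ℝ => (((p.1.1, p.2.1), p.1.2), p.2.2)) (by fun_prop)
  let Θ : Ω → (Fin m → Fin n × ℝ≥0 × Fin (n + 1)) × Fin n := fun ω => (R.sojourns m ω, R.phase m ω)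
  let V : Ω → ℕ → ℝ := fun ω => truncate r fun k => R.claim k ω
  have hΘ : Measurable Θ := (R.measurable_sojourns m).prodMk (R.measurable_phase m)
  have hV : Measurable V := (measurable_truncate r).comp R.measurable_claims
  have h1 : ∫⁻ ω in R.claimsBefore m ⁻¹' {r}, F (R.hist m ω) (R.next m ω) (R.nextClaim m ω) ∂P =
      ∫⁻ ω, G (Θ ω) (R.next m ω) (V ω) (R.claim r ω) ∂P := by
    rw [← lintegral_indicator hr]
    refine lintegral_congr fun ω => ?_
    by_cases h : R.claimsBefore m ω = r
    · rw [Set.indicator_of_mem (show ω ∈ R.claimsBefore m ⁻¹' {r} from h)]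
      simp only [G, Θ, V, claimCount_sojourns, h, if_true, hist, nextClaim]
    · rw [Set.indicator_of_notMem (show ω ∉ R.claimsBefore m ⁻¹' {r} from h)]
      simp only [G, Θ, claimCount_sojourns, h, if_false]
  have h2 : ∫⁻ ω in R.claimsBefore m ⁻¹' {r}, ∫⁻ z, ∫⁻ y, F (R.hist m ω) z y ∂expMeasure M.β
        ∂M.nextLaw (R.phase m ω) ∂P =
      ∫⁻ ω, ∫⁻ z, ∫⁻ y, G (Θ ω) z (V ω) y ∂expMeasure M.β ∂M.nextLaw (Θ ω).2 ∂P := by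
    rw [← lintegral_indicator hr]
    refine lintegral_congr fun ω => ?_
    by_cases h : R.claimsBefore m ω = r
    · rw [Set.indicator_of_mem (show ω ∈ R.claimsBefore m ⁻¹' {r} from h)]
      simp only [G, Θ, V, claimCount_sojourns, h, if_true, hist]
    · rw [Set.indicator_of_notMem (show ω ∉ R.claimsBefore m ⁻¹' {r} from h)]
      simp only [G, Θ, claimCount_sojourns, h, if_false, lintegral_zero]
  rw [h1, h2]
  have hGvy : ∀ v y, Measurable (Function.uncurry fun θ z => G θ z v y) := fun v y =>
    hG.comp (f := fun p : ((Fin m → Fin n × ℝ≥0 × Fin (n + 1)) × Fin n) ×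
      (ℝ≥0 × Fin (n + 1) × Fin n) => (p, (v, y))) (by fun_prop)
  have hK : Measurable fun p : ((ℕ → ℝ) × ℝ) × Ω =>
      ∫⁻ z, G (Θ p.2) z p.1.1 p.1.2 ∂M.nextLaw (Θ p.2).2 :=
    measurable_lintegral_of_countable M.nextLaw
      (F := fun (p : ((ℕ → ℝ) × ℝ) × Ω) z => G (Θ p.2) z p.1.1 p.1.2)
      (measurable_snd.comp (hΘ.comp measurable_snd))
      (hG.comp (f := fun q : (((ℕ → ℝ) × ℝ) × Ω) × (ℝ≥0 × Fin (n + 1) × Fin n) =>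
        ((Θ q.1.2, q.2), q.1.1)) (by fun_prop))
  have hL : Measurable (Function.uncurry fun (v : ℕ → ℝ)
      (θ : (Fin m → Fin n × ℝ≥0 × Fin (n + 1)) × Fin n) =>
        ∫⁻ z, ∫⁻ y, G θ z v y ∂expMeasure M.β ∂M.nextLaw θ.2) := by
    refine measurable_lintegral_of_countable M.nextLaw
      (F := fun (p : (ℕ → ℝ) × ((Fin m → Fin n × ℝ≥0 × Fin (n + 1)) × Fin n)) z =>
        ∫⁻ y, G p.2 z p.1 y ∂expMeasure M.β) (by fun_prop) ?_
    refine Measurable.lintegral_prod_right'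
      (f := fun q : (((ℕ → ℝ) × ((Fin m → Fin n × ℝ≥0 × Fin (n + 1)) × Fin n)) ×
        (ℝ≥0 × Fin (n + 1) × Fin n)) × ℝ => G q.1.1.2 q.1.2 q.1.1.1 q.2) ?_
    exact hG.comp (f := fun q : (((ℕ → ℝ) × ((Fin m → Fin n × ℝ≥0 × Fin (n + 1)) × Fin n)) ×
        (ℝ≥0 × Fin (n + 1) × Fin n)) × ℝ => ((q.1.1.2, q.1.2), (q.1.1.1, q.2))) (by fun_prop)
  -- Freeze the claims and apply the Markov property of the phases; separate claim `r` from the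
  -- earlier ones and insert its law; exchange integrals and finally undo the freezing of the past.
  calc ∫⁻ ω, G (Θ ω) (R.next m ω) (V ω) (R.claim r ω) ∂P
      = ∫⁻ ω, ∫⁻ ω', G (Θ ω') (R.next m ω') (V ω) (R.claim r ω) ∂P ∂P := by
        refine lintegral_comp_of_indepFun
          (X := fun ω => (V ω, R.claim r ω)) (Y := fun ω => (Θ ω, R.next m ω))
          (g := fun u w => G w.1 w.2 u.1 u.2) ?_ (hV.prodMk (R.measurable_claim r))
          (hΘ.prodMk (R.measurable_next m)) (hG.comp measurable_swap)
        exact (R.indepFun_claims_sojourns m).comp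
          (φ := fun v : ℕ → ℝ => (truncate r v, v r)) (ψ := id)
          ((measurable_truncate r).prodMk (measurable_pi_apply r)) measurable_id
    _ = ∫⁻ ω, ∫⁻ ω', ∫⁻ z, G (Θ ω') z (V ω) (R.claim r ω) ∂M.nextLaw (Θ ω').2 ∂P ∂P :=
        lintegral_congr fun ω => R.lintegral_next m (hGvy (V ω) (R.claim r ω))
    _ = ∫⁻ ω, ∫⁻ ω'', ∫⁻ ω', ∫⁻ z, G (Θ ω') z (V ω) (R.claim r ω'') ∂M.nextLaw (Θ ω').2 ∂P ∂P ∂P :=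
        lintegral_comp_of_indepFun (X := V) (Y := R.claim r)
          (g := fun v y => ∫⁻ ω', ∫⁻ z, G (Θ ω') z v y ∂M.nextLaw (Θ ω').2 ∂P)
          (R.indepFun_truncate_claim r) hV (R.measurable_claim r) hK.lintegral_prod_right'
    _ = ∫⁻ ω, ∫⁻ y, ∫⁻ ω', ∫⁻ z, G (Θ ω') z (V ω) y ∂M.nextLaw (Θ ω').2 ∂P ∂expMeasure M.β ∂P := by
        refine lintegral_congr fun ω => ?_
        rw [← (R.claim_law r).map_eq, lintegral_map _ (R.measurable_claim r)]
        exact hK.lintegral_prod_right'.comp measurable_prodMk_left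
    _ = ∫⁻ ω, ∫⁻ ω', ∫⁻ z, ∫⁻ y, G (Θ ω') z (V ω) y ∂expMeasure M.β ∂M.nextLaw (Θ ω').2 ∂P ∂P := by
        refine lintegral_congr fun ω => ?_
        rw [lintegral_lintegral_swap]
        · refine lintegral_congr fun ω' => ?_
          rw [lintegral_lintegral_swap]
          exact (hG.comp (f := fun q : ℝ × (ℝ≥0 × Fin (n + 1) × Fin n) =>
            ((Θ ω', q.2), (V ω, q.1))) (by fun_prop)).aemeasurable
        · exact (hK.comp (f := fun q : ℝ × Ω => ((V ω, q.1), q.2)) (by fun_prop)).aemeasurable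
    _ = ∫⁻ ω, ∫⁻ z, ∫⁻ y, G (Θ ω) z (V ω) y ∂expMeasure M.β ∂M.nextLaw (Θ ω).2 ∂P := by
        refine (lintegral_comp_of_indepFun (X := V) (Y := Θ)
          (g := fun v θ => ∫⁻ z, ∫⁻ y, G θ z v y ∂expMeasure M.β ∂M.nextLaw θ.2) ?_ hV hΘ hL).symm
        exact (R.indepFun_claims_sojourns m).comp (measurable_truncate r) measurable_fst

/-! ### Almost sure properties of the jumps -/

/-- The regular behaviour of the jumps, which is almost sure. -/
structure IsRegular (ω : Ω) : Prop where
  hold_pos : ∀ m, 0 < R.hold m ω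
  unbounded : ∀ t, ∃ m, t < R.jumpTime m ω
  target_eq : ∀ m, R.target m ω = Fin.last n ∨ R.target m ω = (R.phase (m + 1) ω).castSucc
  target_ne : ∀ m, R.target m ω ≠ (R.phase m ω).castSucc

/-- `F` indicates a forbidden transition. Each such transition has mass zero under `nextLaw`, since
either the jump probability or the restart probability vanishes. -/
lemma ae_target [IsProbabilityMeasure P] (m : ℕ) :
    ∀ᵐ ω ∂P, (R.target m ω = Fin.last n ∨ R.target m ω = (R.phase (m + 1) ω).castSucc) ∧
      R.target m ω ≠ (R.phase m ω).castSucc := by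
  classical
  let F : (Fin m → Fin n × ℝ≥0 × Fin (n + 1)) × Fin n → ℝ≥0 × Fin (n + 1) × Fin n → ℝ≥0∞ :=
    fun θ z => if (z.2.1 = Fin.last n ∨ z.2.1 = z.2.2.castSucc) ∧ z.2.1 ≠ θ.2.castSucc then 0 else 1
  have hF : Measurable (Function.uncurry F) :=
    (measurable_of_countable (f := fun q : Fin n × Fin (n + 1) × Fin n =>
      if (q.2.1 = Fin.last n ∨ q.2.1 = q.2.2.castSucc) ∧ q.2.1 ≠ q.1.castSucc
        then (0 : ℝ≥0∞) else 1)).comp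
      (f := fun p : ((Fin m → Fin n × ℝ≥0 × Fin (n + 1)) × Fin n) × (ℝ≥0 × Fin (n + 1) × Fin n) =>
        (p.1.2, p.2.2)) (by fun_prop)
  have h := R.lintegral_next m hF
  have h0 : ∀ θ : (Fin m → Fin n × ℝ≥0 × Fin (n + 1)) × Fin n, ∫⁻ z, F θ z ∂M.nextLaw θ.2 = 0 := by
    intro θ
    rw [M.lintegral_nextLaw θ.2 (by exact hF.comp measurable_prodMk_left)]
    refine Finset.sum_eq_zero fun a _ => Finset.sum_eq_zero fun j _ => ?_
    by_cases h1 : (a = Fin.last n ∨ a = j.castSucc) ∧ a ≠ θ.2.castSucc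
    · simp [F, h1]
    · have h2 : M.jumpProb θ.2 a * M.restartProb a j = 0 := by
        unfold Model.jumpProb Model.restartProb
        split_ifs <;> simp_all
      rw [h2, ENNReal.ofReal_zero, zero_mul]
  have h1 : ∫⁻ ω, F (R.sojourns m ω, R.phase m ω) (R.next m ω) ∂P = 0 := by
    rw [h]
    simp_rw [fun ω => h0 (R.sojourns m ω, R.phase m ω)]
    exact lintegral_zero
  rw [lintegral_eq_zero_iff (by exact hF.comp (((R.measurable_sojourns m).prodMk
    (R.measurable_phase m)).prodMk (R.measurable_next m)))] at h1
  filter_upwards [h1] with ω hω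
  by_contra hcon
  have : F (R.sojourns m ω, R.phase m ω) (R.next m ω) = 1 := if_neg hcon
  rw [hω] at this
  simp at this

lemma jumpTime_eq_sum (m : ℕ) (ω : Ω) : R.jumpTime m ω = ∑ l, (R.sojourns m ω l).2.1 :=
  (Fin.sum_univ_eq_sum_range (fun l => R.hold l ω) m).symm

lemma jumpTime_succ (m : ℕ) (ω : Ω) : R.jumpTime (m + 1) ω = R.jumpTime m ω + R.hold m ω :=
  Finset.sum_range_succ _ _

lemma jumpTime_zero (ω : Ω) : R.jumpTime 0 ω = 0 := rfl

lemma monotone_jumpTime (ω : Ω) : Monotone fun m => R.jumpTime m ω :=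
  monotone_nat_of_le_succ fun m => by rw [jumpTime_succ]; exact le_self_add

/-- The expectation of `exp (-τ_m)` decreases geometrically: each sojourn contributes at most `ρ`,
the largest of finitely many Laplace transforms at `1`, all smaller than one. Hence the infimum over
`m` of `exp (-τ_m)` is almost surely zero. -/
lemma ae_unbounded [IsProbabilityMeasure P] : ∀ᵐ ω ∂P, ∀ t, ∃ m, t < R.jumpTime m ω := by
  let e : ℝ≥0 → ℝ≥0∞ := fun s => ENNReal.ofReal (Real.exp (-s))
  have he : Measurable e := by fun_prop
  let κ : Fin n → ℝ≥0∞ := fun i => ∫⁻ s, e s ∂expLaw (M.leaveRate i)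
  have hκ : ∀ i, κ i < 1 := by
    intro i
    have h1 : ∫⁻ _, 1 ∂expLaw (M.leaveRate i) = 1 := by simp
    rw [← h1]
    have hlt : ∀ᵐ s ∂expLaw (M.leaveRate i), e s < 1 := by
      filter_upwards [ae_expLaw_pos (M.leaveRate_pos i)] with s hs
      rw [← ENNReal.ofReal_one]
      exact (ENNReal.ofReal_lt_ofReal_iff one_pos).2
        (Real.exp_lt_one_iff.2 (neg_lt_zero.2 (NNReal.coe_pos.2 hs)))
    refine lintegral_strict_mono (IsProbabilityMeasure.ne_zero _) aemeasurable_const ?_ hlt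
    refine ((lintegral_mono_ae (hlt.mono fun _ h => h.le)).trans_lt ?_).ne
    rw [h1]; exact ENNReal.one_lt_top
  let ρ : ℝ≥0∞ := Finset.univ.sup κ
  have hρ : ρ < 1 := (Finset.sup_lt_iff (by simp)).2 fun i _ => hκ i
  have hstep : ∀ m, ∫⁻ ω, e (R.jumpTime (m + 1) ω) ∂P ≤ ρ * ∫⁻ ω, e (R.jumpTime m ω) ∂P := by
    intro m
    have hF : Measurable (Function.uncurry fun (θ : (Fin m → Fin n × ℝ≥0 × Fin (n + 1)) × Fin n)
        (z : ℝ≥0 × Fin (n + 1) × Fin n) => e (∑ l, (θ.1 l).2.1) * e z.1) :=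
      (he.comp (Finset.measurable_fun_sum _ fun l _ => by fun_prop)).mul
        (he.comp (measurable_fst.comp measurable_snd))
    have h := R.lintegral_next m hF
    simp only [← jumpTime_eq_sum, next] at h
    calc ∫⁻ ω, e (R.jumpTime (m + 1) ω) ∂P
        = ∫⁻ ω, e (R.jumpTime m ω) * e (R.hold m ω) ∂P := by
          refine lintegral_congr fun ω => ?_
          simp only [e]
          rw [← ENNReal.ofReal_mul (Real.exp_pos _).le, ← Real.exp_add, jumpTime_succ]
          congr 2
          push_cast
          ring
      _ = ∫⁻ ω, e (R.jumpTime m ω) * κ (R.phase m ω) ∂P := by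
          rw [h]
          refine lintegral_congr fun ω => ?_
          rw [lintegral_const_mul' _ _ ENNReal.ofReal_ne_top,
            M.lintegral_nextLaw _ (by exact he.comp measurable_fst)]
          simp only [← Finset.sum_mul]
          rw [M.sum_jumpProb_mul_restartProb, one_mul]
      _ ≤ ∫⁻ ω, ρ * e (R.jumpTime m ω) ∂P := by
          refine lintegral_mono fun ω => ?_
          rw [mul_comm]
          gcongr
          exact Finset.le_sup (Finset.mem_univ _)
      _ = ρ * ∫⁻ ω, e (R.jumpTime m ω) ∂P :=
          lintegral_const_mul _ (he.comp (R.measurable_jumpTime m))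
  have hpow : ∀ m, ∫⁻ ω, e (R.jumpTime m ω) ∂P ≤ ρ ^ m := by
    intro m
    induction m with
    | zero => simp [jumpTime_zero, e]
    | succ m ih =>
      rw [pow_succ, mul_comm]
      exact (hstep m).trans (by gcongr)
  have hinf : ∫⁻ ω, ⨅ m, e (R.jumpTime m ω) ∂P = 0 := by
    refine le_antisymm (ge_of_tendsto' (ENNReal.tendsto_pow_atTop_nhds_zero_of_lt_one hρ) fun m => ?_)
      bot_le
    exact (lintegral_mono fun ω => iInf_le _ m).trans (hpow m)
  rw [lintegral_eq_zero_iff (by exact Measurable.iInf fun m => he.comp (R.measurable_jumpTime m))] at hinf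
  filter_upwards [hinf] with ω hω t
  have h1 : ⨅ m, e (R.jumpTime m ω) < e t := by
    rw [hω]
    exact ENNReal.ofReal_pos.2 (Real.exp_pos _)
  obtain ⟨m, hm⟩ := iInf_lt_iff.1 h1
  refine ⟨m, ?_⟩
  have h2 := Real.exp_lt_exp.1 ((ENNReal.ofReal_lt_ofReal_iff (Real.exp_pos _)).1 hm)
  exact NNReal.coe_lt_coe.1 (neg_lt_neg_iff.1 h2)

lemma ae_isRegular [IsProbabilityMeasure P] : ∀ᵐ ω ∂P, R.IsRegular ω := by
  filter_upwards [ae_all_iff.2 R.ae_hold_pos, R.ae_unbounded, ae_all_iff.2 R.ae_target]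
    with ω h1 h2 h3
  exact ⟨h1, h2, fun m => (h3 m).1, fun m => (h3 m).2⟩

end RiskProcess

end Dividend

namespace Dividend

/-- Capping rational times at `t` puts `t` itself among countably many test times, which is needed
when a sojourn begins exactly at `t`. -/
lemma exists_rat_le_min_lt {a b t : ℝ≥0} (hat : a ≤ t) (hab : a < b) :
    ∃ q : ℚ, a ≤ min (q : ℝ).toNNReal t ∧ min (q : ℝ).toNNReal t < b := by
  rcases hat.eq_or_lt with rfl | hat
  · obtain ⟨q, -, h1, -⟩ := (NNReal.lt_iff_exists_rat_btwn a (a + 1)).1 (by simp)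
    exact ⟨q, by simp [h1.le], (min_le_right _ _).trans_lt hab⟩
  · obtain ⟨q, -, h1, h2⟩ := (NNReal.lt_iff_exists_rat_btwn a b).1 hab
    exact ⟨q, le_min h1.le hat.le, (min_le_left _ _).trans_lt h2⟩

lemma measurable_of_measurableSet_Iic {Ω : Type*} (m : MeasurableSpace Ω) {f : Ω → ℝ≥0}
    (h : ∀ a, MeasurableSet[m] (f ⁻¹' Set.Iic a)) : Measurable[m] f := measurable_of_Iic h

lemma measurable_of_measurableSet_Ioi {Ω : Type*} (m : MeasurableSpace Ω) {f : Ω → ℝ}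
    (h : ∀ a, MeasurableSet[m] (f ⁻¹' Set.Ioi a)) : Measurable[m] f := measurable_of_Ioi h

lemma measurableSet_ne {Ω : Type*} (m : MeasurableSpace Ω) {n : ℕ} {f g : Ω → Fin n × ℕ × ℝ}
    (hf : Measurable[m] f) (hg : Measurable[m] g) : MeasurableSet[m] {ω | f ω ≠ g ω} :=
  (measurableSet_eq_fun hf hg).compl

/-! ### Nondecreasing left-continuous adapted processes -/

/-- All paths of `D` are cumulative dividend paths. -/
def IsCumulative {Ω : Type*} (D : ℝ≥0 → Ω → ℝ) : Prop := ∀ ω, IsPath fun t => D t ω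

/-! ### Jump times as stopping times and the information available at them -/

namespace RiskProcess

variable {n : ℕ} {M : Model n} {Ω : Type*} [MeasurableSpace Ω] {P : Measure Ω}
  (R : RiskProcess M P)

/-- The aggregate claims after the first `m` jumps. -/
noncomputable def claimed (m : ℕ) (ω : Ω) : ℝ := ∑ k ∈ Finset.range (R.claimsBefore m ω), R.claim k ω

/-- What the filtration reveals about the situation after the `m`-th jump. -/
noncomputable def state (m : ℕ) (ω : Ω) : Fin n × ℕ × ℝ := (R.phase m ω, R.claimsBefore m ω, R.claimed m ω)

/-- What the filtration reveals about the situation at time `t`. -/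
noncomputable def observed (t : ℝ≥0) (ω : Ω) : Fin n × ℕ × ℝ :=
  (R.phaseAt t ω, R.claimCount t ω, R.totalClaims t ω)

lemma observed_eq (t : ℝ≥0) (ω : Ω) : R.observed t ω = R.state (R.jumpCount t ω) ω := rfl

variable {R} in
lemma IsRegular.strictMono {ω : Ω} (hω : R.IsRegular ω) : StrictMono fun m => R.jumpTime m ω :=
  strictMono_nat_of_lt_succ fun m => by
    rw [jumpTime_succ]; exact lt_add_of_pos_right _ (hω.hold_pos m)

variable {R} in
lemma IsRegular.jumpCount_eq {ω : Ω} (hω : R.IsRegular ω) {m : ℕ} {t : ℝ≥0}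
    (h1 : R.jumpTime m ω ≤ t) (h2 : t < R.jumpTime (m + 1) ω) : R.jumpCount t ω = m := by
  have hle : ∀ l, (if R.jumpTime l ω ≤ t then l else 0) ≤ m := by
    intro l
    split_ifs with h
    · exact Nat.lt_succ_iff.1 (hω.strictMono.lt_iff_lt.1 (h.trans_lt h2))
    · exact Nat.zero_le _
  refine le_antisymm (ciSup_le hle) ?_
  have := le_ciSup (f := fun l => if R.jumpTime l ω ≤ t then l else 0)
    ⟨m, by rintro _ ⟨l, rfl⟩; exact hle l⟩ m
  rwa [if_pos h1] at this

variable {R} in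
lemma IsRegular.exists_between {ω : Ω} (hω : R.IsRegular ω) (t : ℝ≥0) :
    ∃ m, R.jumpTime m ω ≤ t ∧ t < R.jumpTime (m + 1) ω := by
  classical
  have h := hω.unbounded t
  obtain ⟨m, hm⟩ : ∃ m, Nat.find h = m + 1 := by
    refine Nat.exists_eq_succ_of_ne_zero fun h0 => ?_
    have := Nat.find_spec h
    rw [h0, jumpTime_zero] at this
    exact not_lt_bot this
  refine ⟨m, not_lt.1 (Nat.find_min h (by omega)), hm ▸ Nat.find_spec h⟩

variable {R} in
lemma IsRegular.observed_eq {ω : Ω} (hω : R.IsRegular ω) {m : ℕ} {t : ℝ≥0}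
    (h1 : R.jumpTime m ω ≤ t) (h2 : t < R.jumpTime (m + 1) ω) : R.observed t ω = R.state m ω := by
  rw [R.observed_eq, hω.jumpCount_eq h1 h2]

lemma claimsBefore_succ (m : ℕ) (ω : Ω) : R.claimsBefore (m + 1) ω =
    R.claimsBefore m ω + if R.target m ω = Fin.last n then 1 else 0 :=
  Finset.sum_range_succ _ _

lemma claimed_succ (m : ℕ) (ω : Ω) : R.claimed (m + 1) ω =
    R.claimed m ω + if R.target m ω = Fin.last n then R.nextClaim m ω else 0 := by
  unfold claimed
  rw [claimsBefore_succ]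
  split_ifs with h
  · rw [Finset.sum_range_succ]; rfl
  · simp

variable {R} in
-- Every jump is visible: a claim raises the claim count, even if the phase restarts where it was,
-- and any other jump changes the phase.
lemma IsRegular.state_ne {ω : Ω} (hω : R.IsRegular ω) (m : ℕ) :
    R.state m ω ≠ R.state (m + 1) ω := by
  intro h
  have h1 : R.phase m ω = R.phase (m + 1) ω := congrArg Prod.fst h
  have h2 : R.claimsBefore m ω = R.claimsBefore (m + 1) ω := congrArg (fun z => z.2.1) h
  rw [claimsBefore_succ] at h2
  rcases hω.target_eq m with h3 | h3
  · simp [h3] at h2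
  · exact hω.target_ne m (h3.trans (by rw [h1]))

variable [P.IsComplete]

lemma measurableSet_filtration_congr {t : ℝ≥0} {A B : Set Ω}
    (hB : MeasurableSet[R.filtration t] B) (h : A =ᵐ[P] B) : MeasurableSet[R.filtration t] A :=
  EventuallyMeasurableSet.congr hB h

lemma measurable_observed {s t : ℝ≥0} (h : s ≤ t) :
    Measurable[R.filtration t] (R.observed s) := by
  have h1 : R.history t ≤ R.filtration t := le_eventuallyMeasurableSpace
  have h2 : MeasurableSpace.comap (R.observed s) inferInstance ≤ R.history t :=
    le_iSup (fun v : Set.Iic t => MeasurableSpace.comap (R.observed v) inferInstance) ⟨s, h⟩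
  exact measurable_iff_comap_le.2 (h2.trans h1)

/-- The jump times are stopping times. -/
lemma measurableSet_jumpTime_le [IsProbabilityMeasure P] (m : ℕ) (t : ℝ≥0) :
    MeasurableSet[R.filtration t] {ω | R.jumpTime m ω ≤ t} := by
  induction m generalizing t with
  | zero =>
    have : {ω | R.jumpTime 0 ω ≤ t} = Set.univ := by ext ω; simp [jumpTime_zero]
    rw [this]; exact MeasurableSet.univ
  | succ m ih =>
    let s : ℚ → ℝ≥0 := fun q => min (q : ℝ).toNNReal t
    -- The next jump has occurred by `t` exactly when, after the `m`-th jump, the observed triple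
    -- differs at two of the test times up to `t`.
    have hB : MeasurableSet[R.filtration t] (⋃ q, ⋃ q', {ω | R.jumpTime m ω ≤ s q ∧ s q ≤ s q' ∧
        R.observed (s q) ω ≠ R.observed (s q') ω}) := by
      refine MeasurableSet.iUnion fun q => MeasurableSet.iUnion fun q' => ?_
      have h1 := R.filtration.mono (min_le_right (q : ℝ).toNNReal t) _ (ih (s q))
      refine MeasurableSet.inter h1 (MeasurableSet.inter (MeasurableSet.const _) ?_)
      exact measurableSet_ne _ (R.measurable_observed (min_le_right _ _))
        (R.measurable_observed (min_le_right _ _))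
    refine R.measurableSet_filtration_congr hB ?_
    filter_upwards [R.ae_isRegular] with ω hω
    refine propext ?_
    change R.jumpTime (m + 1) ω ≤ t ↔ ω ∈ ⋃ q, ⋃ q', _
    simp only [Set.mem_iUnion, Set.mem_ofPred_eq]
    constructor
    · intro h
      have hlt := hω.strictMono (Nat.lt_succ_self m)
      have hlt' := hω.strictMono (Nat.lt_succ_self (m + 1))
      obtain ⟨q, h1, h2⟩ := exists_rat_le_min_lt (hlt.le.trans h) hlt
      obtain ⟨q', h3, h4⟩ := exists_rat_le_min_lt h hlt'
      refine ⟨q, q', h1, (h2.trans_le h3).le, ?_⟩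
      rw [hω.observed_eq h1 h2, hω.observed_eq h3 h4]
      exact hω.state_ne m
    · rintro ⟨q, q', h1, h2, h3⟩
      by_contra h
      have h4 : s q' < R.jumpTime (m + 1) ω := (min_le_right _ _).trans_lt (not_le.1 h)
      rw [hω.observed_eq h1 (h2.trans_lt h4), hω.observed_eq (h1.trans h2) h4] at h3
      exact h3 rfl

/-- The events known at the `m`-th jump. -/
@[reducible]
def jumpSpace [IsProbabilityMeasure P] (m : ℕ) : MeasurableSpace Ω where
  MeasurableSet' A := ∀ t, MeasurableSet[R.filtration t] (A ∩ {ω | R.jumpTime m ω ≤ t})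
  measurableSet_empty t := by rw [Set.empty_inter]; exact @MeasurableSet.empty _ (R.filtration t)
  measurableSet_compl A hA t := by
    have : Aᶜ ∩ {ω | R.jumpTime m ω ≤ t} =
        {ω | R.jumpTime m ω ≤ t} \ (A ∩ {ω | R.jumpTime m ω ≤ t}) := by
      ext ω
      simp only [Set.mem_inter_iff, Set.mem_compl_iff, Set.mem_sdiff]
      tauto
    rw [this]
    exact (R.measurableSet_jumpTime_le m t).diff (hA t)
  measurableSet_iUnion A hA t := by
    rw [Set.iUnion_inter]
    exact MeasurableSet.iUnion fun k => hA k t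

section JumpSpace

variable [IsProbabilityMeasure P]

lemma jumpSpace_mono : Monotone R.jumpSpace := by
  intro l m h A hA t
  have : A ∩ {ω | R.jumpTime m ω ≤ t} =
      A ∩ {ω | R.jumpTime l ω ≤ t} ∩ {ω | R.jumpTime m ω ≤ t} := by
    ext ω
    have := R.monotone_jumpTime ω h
    simp only [Set.mem_inter_iff, Set.mem_ofPred_eq]
    exact ⟨fun h => ⟨⟨h.1, this.trans h.2⟩, h.2⟩, fun h => ⟨h.1.1, h.2⟩⟩
  rw [this]
  exact (hA t).inter (R.measurableSet_jumpTime_le m t)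

lemma measurable_jumpSpace_jumpTime (m : ℕ) : Measurable[R.jumpSpace m] (R.jumpTime m) := by
  refine measurable_of_measurableSet_Iic _ fun a t => ?_
  have : R.jumpTime m ⁻¹' Set.Iic a ∩ {ω | R.jumpTime m ω ≤ t} =
      {ω | R.jumpTime m ω ≤ min a t} := by
    ext ω; simp
  rw [this]
  exact R.filtration.mono (min_le_right _ _) _ (R.measurableSet_jumpTime_le m _)

/-- The state is read off the observed triple at a test time that lies between the `m`-th jump and
the next one. -/
lemma measurable_jumpSpace_state (m : ℕ) : Measurable[R.jumpSpace m] (R.state m) := by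
  intro C hC t
  let s : ℚ → ℝ≥0 := fun q => min (q : ℝ).toNNReal t
  have hB : MeasurableSet[R.filtration t] (⋃ q, {ω | R.jumpTime m ω ≤ s q ∧
      ¬R.jumpTime (m + 1) ω ≤ s q ∧ R.observed (s q) ω ∈ C}) := by
    refine MeasurableSet.iUnion fun q => ?_
    have h1 := R.filtration.mono (min_le_right (q : ℝ).toNNReal t) _
      (R.measurableSet_jumpTime_le m (s q))
    have h2 := R.filtration.mono (min_le_right (q : ℝ).toNNReal t) _
      (R.measurableSet_jumpTime_le (m + 1) (s q))
    exact h1.inter (h2.compl.inter (R.measurable_observed (min_le_right _ _) hC))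
  refine R.measurableSet_filtration_congr hB ?_
  filter_upwards [R.ae_isRegular] with ω hω
  refine propext ?_
  change (R.state m ω ∈ C ∧ R.jumpTime m ω ≤ t) ↔ ω ∈ ⋃ q, _
  simp only [Set.mem_iUnion, Set.mem_ofPred_eq, not_le]
  constructor
  · rintro ⟨h1, h2⟩
    obtain ⟨q, h3, h4⟩ := exists_rat_le_min_lt h2 (hω.strictMono (Nat.lt_succ_self m))
    exact ⟨q, h3, h4, by rwa [hω.observed_eq h3 h4]⟩
  · rintro ⟨q, h1, h2, h3⟩
    rw [hω.observed_eq h1 h2] at h3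
    exact ⟨h3, h1.trans (min_le_right _ _)⟩

lemma measurable_filtration_ite {γ : Type*} [MeasurableSpace γ] {m : ℕ} {f : Ω → γ}
    (hf : Measurable[R.jumpSpace m] f) (c : γ) (t : ℝ≥0) :
    Measurable[R.filtration t] fun ω => if R.jumpTime m ω ≤ t then f ω else c := by
  intro C hC
  have : (fun ω => if R.jumpTime m ω ≤ t then f ω else c) ⁻¹' C =
      (f ⁻¹' C ∩ {ω | R.jumpTime m ω ≤ t}) ∪ ({ω | R.jumpTime m ω ≤ t}ᶜ ∩ {_ω | c ∈ C}) := by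
    ext ω
    by_cases h : R.jumpTime m ω ≤ t <;> simp [h]
  rw [this]
  exact (hf hC t).union ((R.measurableSet_jumpTime_le m t).compl.inter (MeasurableSet.const _))

lemma measurable_filtration_min_jumpTime (m : ℕ) (t : ℝ≥0) :
    Measurable[R.filtration t] fun ω => min t (R.jumpTime m ω) := by
  refine measurable_of_measurableSet_Iic _ fun a => ?_
  have : (fun ω => min t (R.jumpTime m ω)) ⁻¹' Set.Iic a =
      {_ω | t ≤ a} ∪ {ω | R.jumpTime m ω ≤ min a t} := by
    ext ω
    simp only [Set.mem_preimage, Set.mem_Iic, Set.mem_union, Set.mem_ofPred_eq, min_le_iff, le_min_iff]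
    constructor
    · rintro (h | h)
      · exact Or.inl h
      · rcases le_total t a with h' | h'
        · exact Or.inl h'
        · exact Or.inr ⟨h, h.trans h'⟩
    · rintro (h | h)
      · exact Or.inl h
      · exact Or.inr h.1
  rw [this]
  exact (MeasurableSet.const _).union
    (R.filtration.mono (min_le_right _ _) _ (R.measurableSet_jumpTime_le m _))

end JumpSpace

/-- By left continuity and monotonicity, each superlevel set at a nonnegative level is a countable
union of predictable rectangles starting at rational times. -/
lemma isStronglyPredictable {D : ℝ≥0 → Ω → ℝ} (hD : IsCumulative D)
    (had : ∀ t, Measurable[R.filtration t] (D t)) : IsStronglyPredictable R.filtration D := by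
  refine Measurable.stronglyMeasurable (measurable_of_measurableSet_Ioi _ fun a => ?_)
  by_cases ha : 0 ≤ a
  · have : Function.uncurry D ⁻¹' Set.Ioi a =
        ⋃ q : ℚ, Set.Ioi (q : ℝ).toNNReal ×ˢ {ω | a < D (q : ℝ).toNNReal ω} := by
      ext ⟨t, ω⟩
      simpa using (hD ω).lt_iff ha t
    rw [this]
    exact MeasurableSet.iUnion fun q =>
      measurableSet_predictable_Ioi_prod (had _ measurableSet_Ioi)
  · have : Function.uncurry D ⁻¹' Set.Ioi a = Set.univ := by
      ext ⟨t, ω⟩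
      simpa using (not_le.1 ha).trans_le ((hD ω).nonneg t)
    rw [this]
    exact MeasurableSet.univ

section Stopped

variable [IsProbabilityMeasure P]

lemma measurable_stopped {D : ℝ≥0 → Ω → ℝ} (hD : IsCumulative D)
    (had : ∀ t, Measurable[R.filtration t] (D t)) (m : ℕ) (t : ℝ≥0) :
    Measurable[R.filtration t] fun ω => D (min t (R.jumpTime m ω)) ω := by
  refine measurable_of_measurableSet_Ioi _ fun a => ?_
  by_cases ha : 0 ≤ a
  · have : (fun ω => D (min t (R.jumpTime m ω)) ω) ⁻¹' Set.Ioi a =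
        ⋃ q : ℚ, ({ω | R.jumpTime m ω ≤ min (q : ℝ).toNNReal t}ᶜ ∩ {_ω | (q : ℝ).toNNReal < t}) ∩
          {ω | a < D (min (q : ℝ).toNNReal t) ω} := by
      ext ω
      rw [Set.mem_preimage, Set.mem_Ioi, (hD ω).lt_iff ha]
      simp only [Set.mem_iUnion, Set.mem_inter_iff,
        Set.mem_compl_iff, Set.mem_ofPred_eq, not_le, lt_min_iff]
      constructor
      · rintro ⟨q, ⟨h1, h2⟩, h3⟩
        exact ⟨q, ⟨by rwa [min_eq_left h1.le], h1⟩, by rwa [min_eq_left h1.le]⟩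
      · rintro ⟨q, ⟨h1, h2⟩, h3⟩
        rw [min_eq_left h2.le] at h1 h3
        exact ⟨q, ⟨h2, h1⟩, h3⟩
    rw [this]
    refine MeasurableSet.iUnion fun q => MeasurableSet.inter (MeasurableSet.inter ?_
      (MeasurableSet.const _)) ?_
    · exact (R.filtration.mono (min_le_right _ _) _ (R.measurableSet_jumpTime_le m _)).compl
    · exact R.filtration.mono (min_le_right _ _) _ (had _ measurableSet_Ioi)
  · have : (fun ω => D (min t (R.jumpTime m ω)) ω) ⁻¹' Set.Ioi a = Set.univ := by
      ext ω
      simpa using (not_le.1 ha).trans_le ((hD ω).nonneg _)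
    rw [this]
    exact MeasurableSet.univ

lemma measurable_jumpSpace_stopped {D : ℝ≥0 → Ω → ℝ} (hD : IsCumulative D)
    (had : ∀ t, Measurable[R.filtration t] (D t)) (m : ℕ) :
    Measurable[R.jumpSpace m] fun ω => D (R.jumpTime m ω) ω := by
  intro C hC t
  have : (fun ω => D (R.jumpTime m ω) ω) ⁻¹' C ∩ {ω | R.jumpTime m ω ≤ t} =
      (fun ω => D (min t (R.jumpTime m ω)) ω) ⁻¹' C ∩ {ω | R.jumpTime m ω ≤ t} := by
    ext ω
    simp only [Set.mem_inter_iff, Set.mem_preimage, Set.mem_ofPred_eq, and_congr_left_iff]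
    intro h
    rw [min_eq_right h]
  rw [this]
  exact (R.measurable_stopped hD had m t hC).inter (R.measurableSet_jumpTime_le m t)

end Stopped

end RiskProcess

end Dividend

namespace Dividend

/-! ### Turning an arbitrary path into an affordable one -/

/-- The affordable path determined by the values of `p` at rational times. -/
noncomputable def envelope (c y : ℝ) (p : ℝ≥0 → ℝ) (s : ℝ≥0) : ℝ :=
  ⨆ q : ℚ, if (q : ℝ).toNNReal < s then
    max 0 (min (p (q : ℝ).toNNReal) (y + c * (q : ℝ).toNNReal)) else 0

lemma envelope_congr {c y : ℝ} {p p' : ℝ≥0 → ℝ} {s : ℝ≥0} (h : ∀ r < s, p r = p' r) :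
    envelope c y p s = envelope c y p' s := by
  unfold envelope
  congr 1 with q
  split_ifs with hq
  · rw [h _ hq]
  · rfl

section Envelope

variable {c y : ℝ} {p : ℝ≥0 → ℝ}

lemma envelope_term_le (hc : 0 ≤ c) (hy : 0 ≤ y) (s : ℝ≥0) (q : ℚ) :
    (if (q : ℝ).toNNReal < s then
      max 0 (min (p (q : ℝ).toNNReal) (y + c * (q : ℝ).toNNReal)) else 0) ≤ y + c * s := by
  split_ifs with h
  · have h1 : c * ((q : ℝ).toNNReal : ℝ) ≤ c * s := by gcongr
    exact max_le (by positivity) ((min_le_right _ _).trans (by linarith))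
  · positivity

lemma bddAbove_envelope (hc : 0 ≤ c) (hy : 0 ≤ y) (s : ℝ≥0) :
    BddAbove (Set.range fun q : ℚ => if (q : ℝ).toNNReal < s then
      max 0 (min (p (q : ℝ).toNNReal) (y + c * (q : ℝ).toNNReal)) else 0) :=
  ⟨y + c * s, by rintro _ ⟨q, rfl⟩; exact envelope_term_le hc hy s q⟩

lemma monotone_envelope (hc : 0 ≤ c) (hy : 0 ≤ y) : Monotone (envelope c y p) := by
  intro s t hst
  refine ciSup_mono (bddAbove_envelope hc hy t) fun q => ?_
  split_ifs with h1 h2 h2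
  · exact le_rfl
  · exact absurd (h1.trans_le hst) h2
  · exact le_max_left _ _
  · exact le_rfl

lemma lt_envelope_iff (hc : 0 ≤ c) (hy : 0 ≤ y) {a : ℝ} (ha : 0 ≤ a) (s : ℝ≥0) :
    a < envelope c y p s ↔ ∃ q : ℚ, (q : ℝ).toNNReal < s ∧
      a < min (p (q : ℝ).toNNReal) (y + c * (q : ℝ).toNNReal) := by
  unfold envelope
  rw [lt_ciSup_iff (bddAbove_envelope hc hy s)]
  refine exists_congr fun q => ?_
  split_ifs with h
  · simp [h, ha.not_gt]
  · simp [h, ha]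

lemma envelope_nonneg (s : ℝ≥0) : 0 ≤ envelope c y p s :=
  Real.iSup_nonneg fun q => by split_ifs <;> simp

lemma isPayout_envelope (hc : 0 ≤ c) (hy : 0 ≤ y) : IsPayout c y (envelope c y p) where
  mono := monotone_envelope hc hy
  left_continuous t := by
    refine tendsto_order.2 ⟨fun a ha => ?_, fun a ha => ?_⟩
    · by_cases h0 : 0 ≤ a
      · obtain ⟨q, h1, h2⟩ := (lt_envelope_iff hc hy h0 t).1 ha
        filter_upwards [mem_nhdsWithin_of_mem_nhds (Ioi_mem_nhds h1)] with s hs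
        exact (lt_envelope_iff hc hy h0 s).2 ⟨q, hs, h2⟩
      · exact Eventually.of_forall fun s => (not_le.1 h0).trans_le (envelope_nonneg s)
    · filter_upwards [self_mem_nhdsWithin] with s hs
      exact (monotone_envelope hc hy hs).trans_lt ha
  zero := by simp [envelope]
  le t := ciSup_le fun q => envelope_term_le hc hy t q

/-- The budget is needed only strictly before `h`, because the envelope looks only at earlier times.
This matters at the end of a sojourn, where a claim may strike. -/
lemma envelope_eq (hc : 0 ≤ c) (hy : 0 ≤ y) (hp : IsPath p) {h : ℝ≥0}
    (hb : ∀ s < h, p s ≤ y + c * s) {s : ℝ≥0} (hs : s ≤ h) : envelope c y p s = p s := by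
  refine eq_of_forall_lt_iff fun a => ?_
  by_cases ha : 0 ≤ a
  · rw [lt_envelope_iff hc hy ha, hp.lt_iff ha]
    refine exists_congr fun q => and_congr_right fun hq => ?_
    rw [min_eq_left (hb _ (hq.trans_le hs))]
  · have ha := not_le.1 ha
    exact iff_of_true (ha.trans_le (envelope_nonneg s)) (ha.trans_le (hp.nonneg s))

lemma measurable_envelope {α : Type*} [MeasurableSpace α] {c : ℝ} {y : α → ℝ} (hy : Measurable y)
    {p : α → ℝ≥0 → ℝ} (hp : ∀ s, Measurable fun a => p a s) :
    Measurable (Function.uncurry fun a => envelope c (y a) (p a)) := by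
  refine Measurable.iSup fun q => Measurable.ite ?_ ?_ measurable_const
  · exact measurableSet_lt measurable_const measurable_snd
  · exact measurable_const.max (((hp _).comp measurable_fst).min
      ((hy.comp measurable_fst).add measurable_const))

end Envelope

lemma truncate_truncate {r r' : ℕ} (h : r ≤ r') (v : ℕ → ℝ) :
    truncate r (truncate r' v) = truncate r v := by
  ext k
  unfold truncate
  split_ifs <;> first | rfl | omega

lemma coe_lt_ofReal_iff {r : ℝ≥0} {x : ℝ} : (r : ℝ≥0∞) < ENNReal.ofReal x ↔ (r : ℝ) < x := by
  rw [ENNReal.ofReal, ENNReal.coe_lt_coe, Real.lt_toNNReal_iff_coe_lt]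

/-- The sets that agree almost surely on `E` with a set of the σ-algebra `m`. -/
@[reducible]
def traceSpace {Ω : Type*} {m₀ : MeasurableSpace Ω} (P : Measure Ω) (m : MeasurableSpace Ω)
    (E : Set Ω) : MeasurableSpace Ω where
  MeasurableSet' A := ∃ B, MeasurableSet[m] B ∧ ∀ᵐ ω ∂P, ω ∈ E → (ω ∈ A ↔ ω ∈ B)
  measurableSet_empty := ⟨∅, @MeasurableSet.empty _ m, by simp⟩
  measurableSet_compl := by
    rintro A ⟨B, hB, h⟩
    refine ⟨Bᶜ, hB.compl, h.mono fun ω hω hq => ?_⟩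
    simp [hω hq]
  measurableSet_iUnion := by
    intro A hA
    choose B hB h using hA
    refine ⟨⋃ k, B k, MeasurableSet.iUnion hB, (ae_all_iff.2 h).mono fun ω hω hq => ?_⟩
    simp only [Set.mem_iUnion]
    exact exists_congr fun k => hω k hq

/-! ### Factoring adapted processes through the history at the last jump -/

namespace RiskProcess

variable {n : ℕ} {M : Model n} {Ω : Type*} [MeasurableSpace Ω] {P : Measure Ω}
  (R : RiskProcess M P)

/-- The σ-algebra generated by the information available just after the `m`-th jump. -/
@[reducible]
def histSpace (m : ℕ) : MeasurableSpace Ω := MeasurableSpace.comap (R.hist m) inferInstance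

lemma measurable_histSpace_hist (m : ℕ) : Measurable[R.histSpace m] (R.hist m) :=
  comap_measurable _

lemma monotone_claimsBefore (ω : Ω) : Monotone fun m => R.claimsBefore m ω :=
  monotone_nat_of_le_succ fun m => by rw [claimsBefore_succ]; exact Nat.le_add_right _ _

/-- `ρ` drops the last sojourn, keeping only its phase as the current one, and hides a claim that
ended it. -/
lemma histSpace_mono : Monotone R.histSpace := by
  refine monotone_nat_of_le_succ fun m => ?_
  let ρ : Hist n (m + 1) → Hist n m := fun h =>
    (((fun l => h.1.1 l.castSucc), (h.1.1 (Fin.last m)).1),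
      truncate (Hist.claimCount fun l : Fin m => h.1.1 l.castSucc) h.2)
  have h1 : Measurable fun h : Hist n (m + 1) => fun l : Fin m => h.1.1 l.castSucc := by fun_prop
  have hρ : Measurable ρ := by
    refine Measurable.prodMk (h1.prodMk (by fun_prop)) ?_
    exact measurable_eval (f := fun r (h : Hist n (m + 1)) => truncate r h.2)
      (fun r => (measurable_truncate r).comp measurable_snd) (Hist.measurable_claimCount.comp h1)
  have h2 : R.hist m = ρ ∘ R.hist (m + 1) := by
    ext ω : 1
    have h3 : (fun l : Fin m => R.sojourns (m + 1) ω l.castSucc) = R.sojourns m ω := rfl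
    simp only [Function.comp_apply, ρ, hist, h3, claimCount_sojourns,
      truncate_truncate (R.monotone_claimsBefore ω m.le_succ)]
    rfl
  have h3 := (hρ.comp (R.measurable_histSpace_hist (m + 1)))
  rw [← h2] at h3
  exact measurable_iff_comap_le.1 h3

lemma measurable_histSpace_jumpTime (m : ℕ) : Measurable[R.histSpace m] (R.jumpTime m) := by
  have h : Measurable fun h : Hist n m => ∑ l, (h.1.1 l).2.1 :=
    Finset.measurable_fun_sum _ fun l _ => by fun_prop
  have h1 : R.jumpTime m = (fun h : Hist n m => ∑ l, (h.1.1 l).2.1) ∘ R.hist m := by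
    ext ω : 1; exact R.jumpTime_eq_sum m ω
  rw [h1]
  exact h.comp (R.measurable_histSpace_hist m)

lemma measurable_histSpace_state (m : ℕ) : Measurable[R.histSpace m] (R.state m) := by
  let f : Hist n m → Fin n × ℕ × ℝ := fun h =>
    (h.1.2, Hist.claimCount h.1.1, ∑ k ∈ Finset.range (Hist.claimCount h.1.1), h.2 k)
  have hc : Measurable fun h : Hist n m => Hist.claimCount h.1.1 :=
    Hist.measurable_claimCount.comp (by fun_prop)
  have hf : Measurable f := by
    refine Measurable.prodMk (by fun_prop) (hc.prodMk ?_)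
    exact measurable_eval (f := fun r (h : Hist n m) => ∑ k ∈ Finset.range r, h.2 k)
      (fun r => Finset.measurable_fun_sum _ fun k _ => by fun_prop) hc
  have h1 : R.state m = f ∘ R.hist m := by
    ext ω : 1
    simp only [state, Function.comp_apply, f, hist, claimCount_sojourns, claimed, Prod.mk.injEq,
      true_and]
    refine Finset.sum_congr rfl fun k hk => ?_
    rw [truncate, if_pos (Finset.mem_range.1 hk)]
  rw [h1]
  exact hf.comp (R.measurable_histSpace_hist m)

variable [P.IsComplete] [IsProbabilityMeasure P]

/-- Until the next jump, the events of the filtration are determined by the information available at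
the last one. -/
lemma exists_measurableSet_histSpace (m : ℕ) (q : ℝ≥0) {A : Set Ω}
    (hA : MeasurableSet[R.filtration q] A) :
    ∃ B, MeasurableSet[R.histSpace m] B ∧
      ∀ᵐ ω ∂P, q < R.jumpTime (m + 1) ω → (ω ∈ A ↔ ω ∈ B) := by
  -- The sets with the desired property form a σ-algebra, so only the generators of the history have
  -- to be checked.
  have hS : R.history q ≤
      traceSpace P (R.histSpace m) {ω | q < R.jumpTime (m + 1) ω} := by
    refine iSup_le fun u => ?_
    rintro _ ⟨C, hC, rfl⟩
    have hu : (u : ℝ≥0) ≤ q := u.2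
    -- Sort by the sojourn `j ≤ m` that contains `u`. For `j = m` its end is not known from the
    -- history, but the event `q < τ_{m+1}` makes that condition automatic.
    refine ⟨⋃ j ∈ Finset.range (m + 1), {ω | R.jumpTime j ω ≤ u ∧
      (j = m ∨ (u : ℝ≥0) < R.jumpTime (j + 1) ω) ∧ R.state j ω ∈ C}, ?_, ?_⟩
    · refine Finset.measurableSet_biUnion _ fun j hj => ?_
      have hj : j ≤ m := Nat.lt_succ_iff.1 (Finset.mem_range.1 hj)
      have h1 : MeasurableSet[R.histSpace m] {ω | R.jumpTime j ω ≤ u} :=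
        R.histSpace_mono hj _ (R.measurable_histSpace_jumpTime j measurableSet_Iic)
      have h3 : MeasurableSet[R.histSpace m] {ω | R.state j ω ∈ C} :=
        R.histSpace_mono hj _ (R.measurable_histSpace_state j hC)
      refine h1.inter (MeasurableSet.inter ?_ h3)
      rcases hj.eq_or_lt with rfl | hj
      · simp only [true_or]; exact @MeasurableSet.univ _ (R.histSpace j)
      · simp only [hj.ne, false_or]
        exact R.histSpace_mono (Nat.succ_le_of_lt hj) _
          (R.measurable_histSpace_jumpTime (j + 1) measurableSet_Ioi)
    · filter_upwards [R.ae_isRegular] with ω hω hq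
      change R.observed u ω ∈ C ↔ _
      simp only [Set.mem_iUnion, Set.mem_ofPred_eq, Finset.mem_range]
      constructor
      · intro h
        obtain ⟨j, h1, h2⟩ := hω.exists_between u
        rw [hω.observed_eq h1 h2] at h
        exact ⟨j, hω.strictMono.lt_iff_lt.1 (h1.trans_lt (hu.trans_lt hq)), h1, Or.inr h2, h⟩
      · rintro ⟨j, -, h1, h2, h3⟩
        have h2 : (u : ℝ≥0) < R.jumpTime (j + 1) ω := by
          rcases h2 with rfl | h2
          · exact hu.trans_lt hq
          · exact h2
        rwa [hω.observed_eq h1 h2]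
  obtain ⟨A', hA', h⟩ := hA
  obtain ⟨B, hB, h'⟩ := hS A' hA'
  refine ⟨B, hB, ?_⟩
  filter_upwards [h, h'] with ω h1 h2 hq
  exact (iff_of_eq h1).trans (h2 hq)

/-- Replace each rational superlevel event by a history event, rebuild the variable as a supremum
over rational levels, and factor it through the history by Doob–Dynkin. -/
lemma exists_factor_of_measurable (m : ℕ) (q : ℝ≥0) {U : Ω → ℝ}
    (hU : Measurable[R.filtration q] U) :
    ∃ g : Hist n m → ℝ≥0∞, Measurable g ∧
      ∀ᵐ ω ∂P, q < R.jumpTime (m + 1) ω → ENNReal.ofReal (U ω) = g (R.hist m ω) := by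
  have h := fun a : ℚ => R.exists_measurableSet_histSpace m q (A := {ω | (a : ℝ) < U ω})
    (hU measurableSet_Ioi)
  choose B hB h using h
  classical
  have hV : Measurable[R.histSpace m]
      fun ω => ⨆ a : ℚ, if ω ∈ B a then ENNReal.ofReal (a : ℝ) else 0 :=
    Measurable.iSup fun a => Measurable.ite (hB a) measurable_const measurable_const
  obtain ⟨g, hg, hgV⟩ := Measurable.exists_eq_measurable_comp hV
  refine ⟨g, hg, ?_⟩
  filter_upwards [ae_all_iff.2 h] with ω hω hq
  have h1 : g (R.hist m ω) = ⨆ a : ℚ, if ω ∈ B a then ENNReal.ofReal (a : ℝ) else 0 :=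
    (congrFun hgV ω).symm
  rw [h1]
  refine le_antisymm (le_of_forall_lt fun z hz => ?_) (iSup_le fun a => ?_)
  · lift z to ℝ≥0 using (hz.trans ENNReal.ofReal_lt_top).ne with r
    have hr : (r : ℝ) < U ω := coe_lt_ofReal_iff.1 hz
    obtain ⟨a, h2, h3⟩ := exists_rat_btwn hr
    refine lt_of_lt_of_le ?_ (le_iSup _ a)
    rw [if_pos ((hω a hq).1 h3)]
    exact coe_lt_ofReal_iff.2 h2
  · split_ifs with ha
    · exact ENNReal.ofReal_le_ofReal ((hω a hq).2 ha).le
    · exact bot_le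

/-- Until the next jump, the dividends are a function of the information available at the last one
and of time. -/
lemma exists_factor_of_adapted (m : ℕ) {D : ℝ≥0 → Ω → ℝ} (hD : IsCumulative D)
    (had : ∀ t, Measurable[R.filtration t] (D t)) :
    ∃ G : Hist n m → ℝ≥0 → ℝ, Measurable (Function.uncurry G) ∧
      ∀ᵐ ω ∂P, ∀ t ≤ R.jumpTime (m + 1) ω, D t ω = G (R.hist m ω) t := by
  choose g hg h using fun q : ℚ => R.exists_factor_of_measurable m (q : ℝ).toNNReal (had _)
  -- Only times `q` strictly before `t` are used, so the identity extends to `t = τ_{m+1}` although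
  -- the filtration at that time may already reveal the jump.
  refine ⟨fun η t => (⨆ q : ℚ, if (q : ℝ).toNNReal < t then g q η else 0).toReal, ?_, ?_⟩
  · refine ENNReal.measurable_toReal.comp (Measurable.iSup fun q => Measurable.ite ?_ ?_
      measurable_const)
    · exact measurableSet_lt measurable_const measurable_snd
    · exact (hg q).comp measurable_fst
  · filter_upwards [ae_all_iff.2 h] with ω hω t ht
    suffices hs : ⨆ q : ℚ, (if (q : ℝ).toNNReal < t then g q (R.hist m ω) else 0) =
        ENNReal.ofReal (D t ω) by
      rw [hs, ENNReal.toReal_ofReal ((hD ω).nonneg t)]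
    refine le_antisymm (iSup_le fun q => ?_) (le_of_forall_lt fun z hz => ?_)
    · split_ifs with hq
      · rw [← hω q (hq.trans_le ht)]
        exact ENNReal.ofReal_le_ofReal ((hD ω).mono hq.le)
      · exact bot_le
    · lift z to ℝ≥0 using (hz.trans ENNReal.ofReal_lt_top).ne with r
      have hr : (r : ℝ) < D t ω := coe_lt_ofReal_iff.1 hz
      obtain ⟨q, h1, h2⟩ := ((hD ω).lt_iff r.2 t).1 hr
      refine lt_of_lt_of_le ?_ (le_iSup _ q)
      rw [if_pos h1, ← hω q (h1.trans_le ht)]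
      exact coe_lt_ofReal_iff.2 h2

end RiskProcess

end Dividend

namespace Dividend

/-! ### The discounted value of the dividends -/

lemma IsPath.leftLim_real {f : ℝ≥0 → ℝ} (hf : IsPath f) (s : ℝ) :
    Function.leftLim (fun s : ℝ => f s.toNNReal) s = f s.toNNReal := by
  refine ContinuousWithinAt.leftLim_eq ?_
  exact ContinuousWithinAt.comp (t := Set.Iic s.toNNReal) (hf.left_continuous _)
    continuous_real_toNNReal.continuousWithinAt fun r (hr : r ≤ s) => Real.toNNReal_le_toNNReal hr

/-- Write `exp (-δ s)` as the probability that an exponential time exceeds `s` and exchange the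
integrals; what remains is the mass of an interval `[0, min u h)`. -/
lemma IsPath.lintegral_stieltjes {f : ℝ≥0 → ℝ} (hf : IsPath f) {δ : ℝ} (hδ : 0 < δ) (h : ℝ≥0)
    (hm : Monotone fun s : ℝ => f s.toNNReal) :
    ∫⁻ s in {s : ℝ | 0 ≤ s ∧ ENNReal.ofReal s < h}, ENNReal.ofReal (Real.exp (-δ * s))
      ∂hm.stieltjesFunction.measure = pathValue δ f h := by
  have := isProbabilityMeasure_expLaw hδ
  have hset : {s : ℝ | 0 ≤ s ∧ ENNReal.ofReal s < h} = Set.Ico 0 (h : ℝ) := by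
    ext s
    simp only [Set.mem_ofPred_eq, Set.mem_Ico, and_congr_right_iff]
    intro hs
    rw [ENNReal.ofReal, ENNReal.coe_lt_coe, Real.toNNReal_lt_iff_lt_coe hs]
  -- The Stieltjes function is the right limit of the path, but its left limit is the path itself.
  -- At `0` this is `f 0 = 0`, so the initial payment is counted.
  have hlim : ∀ s, Function.leftLim hm.stieltjesFunction s = f s.toNNReal := fun s => by
    rw [← hf.leftLim_real s]
    exact leftLim_rightLim (hm.tendsto_leftLim s)
  have hI : MeasurableSet {p : ℝ × ℝ≥0 | p.1.toNNReal < p.2} :=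
    measurableSet_lt (by fun_prop) measurable_snd
  have h1 : ∀ s ∈ Set.Ico (0 : ℝ) h, ENNReal.ofReal (Real.exp (-δ * s)) =
      ∫⁻ u, {p : ℝ × ℝ≥0 | p.1.toNNReal < p.2}.indicator 1 (s, u) ∂expLaw δ := by
    intro s hs
    have h2 : ∀ u : ℝ≥0, {p : ℝ × ℝ≥0 | p.1.toNNReal < p.2}.indicator (1 : ℝ × ℝ≥0 → ℝ≥0∞) (s, u) =
        (Set.Ioi s.toNNReal).indicator 1 u := fun u => rfl
    simp_rw [h2]
    rw [lintegral_indicator_one measurableSet_Ioi, expLaw_Ioi hδ, Real.coe_toNNReal _ hs.1]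
  rw [hset, setLIntegral_congr_fun measurableSet_Ico h1, lintegral_lintegral_swap
    (by exact (measurable_one.indicator hI).aemeasurable)]
  refine lintegral_congr fun u => ?_
  have h3 : ∀ s : ℝ, {p : ℝ × ℝ≥0 | p.1.toNNReal < p.2}.indicator (1 : ℝ × ℝ≥0 → ℝ≥0∞) (s, u) =
      {s : ℝ | s.toNNReal < u}.indicator 1 s := fun s => rfl
  have h4 : MeasurableSet {s : ℝ | s.toNNReal < u} := measurableSet_lt (by fun_prop) measurable_const
  simp_rw [h3]
  rw [lintegral_indicator_one h4, Measure.restrict_apply h4]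
  have h5 : {s : ℝ | s.toNNReal < u} ∩ Set.Ico 0 (h : ℝ) = Set.Ico 0 ((min u h : ℝ≥0) : ℝ) := by
    ext s
    simp only [Set.mem_inter_iff, Set.mem_ofPred_eq, Set.mem_Ico, NNReal.coe_min, lt_min_iff]
    constructor
    · rintro ⟨h6, h7, h8⟩
      exact ⟨h7, (Real.toNNReal_lt_iff_lt_coe h7).1 h6, h8⟩
    · rintro ⟨h6, h7, h8⟩
      exact ⟨(Real.toNNReal_lt_iff_lt_coe h6).2 h7, h6, h8⟩
  rw [h5, StieltjesFunction.measure_Ico, hlim, hlim, Real.toNNReal_coe, Real.toNNReal_zero, hf.zero,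
    sub_zero]

namespace RiskProcess

variable {n : ℕ} {M : Model n} {Ω : Type*} [MeasurableSpace Ω] {P : Measure Ω}
  (R : RiskProcess M P)

/-! ### The surplus at the jump times -/

/-- The surplus at the `m`-th jump. -/
noncomputable def capital (x : ℝ) (D : ℝ≥0 → Ω → ℝ) (m : ℕ) (ω : Ω) : ℝ :=
  x + M.c * R.jumpTime m ω - R.claimed m ω - D (R.jumpTime m ω) ω

/-- No ruin has occurred up to the `m`-th jump. -/
def Alive (x : ℝ) (D : ℝ≥0 → Ω → ℝ) (m : ℕ) (ω : Ω) : Prop :=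
  ∀ l ≤ m, 0 ≤ R.capital x D l ω

/-- The discount factor of the `m`-th jump time. -/
noncomputable def discount (m : ℕ) (ω : Ω) : ℝ≥0∞ :=
  ENNReal.ofReal (Real.exp (-M.δ * R.jumpTime m ω))

/-- The dividends paid after the `m`-th jump. -/
def dividendsAfter (D : ℝ≥0 → Ω → ℝ) (m : ℕ) (ω : Ω) (s : ℝ≥0) : ℝ :=
  D (R.jumpTime m ω + s) ω - D (R.jumpTime m ω) ω

/-- The value at the `m`-th jump of the dividends paid up to the next one. -/
noncomputable def sojournGain (D : ℝ≥0 → Ω → ℝ) (m : ℕ) (ω : Ω) : ℝ≥0∞ :=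
  pathValue M.δ (R.dividendsAfter D m ω) (R.hold m ω)

open scoped Classical in
/-- The discount factor of the `m`-th jump time if ruin has not occurred. -/
noncomputable def weight (x : ℝ) (D : ℝ≥0 → Ω → ℝ) (m : ℕ) (ω : Ω) : ℝ≥0∞ :=
  if R.Alive x D m ω then R.discount m ω else 0

/-- Dividend payments never make the surplus negative. -/
def WithinBudget (x : ℝ) (D : ℝ≥0 → Ω → ℝ) (ω : Ω) : Prop :=
  ∀ t : ℝ≥0, (∀ s ≤ t, R.IsClaimTime s ω → 0 ≤ R.surplus x D s ω) →
    D t ω ≤ x + M.c * t - R.totalClaims t ω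

variable {R} {x : ℝ} {D : ℝ≥0 → Ω → ℝ} {ω : Ω}

lemma Alive.mono {l m : ℕ} (h : R.Alive x D m ω) (hlm : l ≤ m) : R.Alive x D l ω :=
  fun k hk => h k (hk.trans hlm)

lemma alive_succ_iff {m : ℕ} :
    R.Alive x D (m + 1) ω ↔ R.Alive x D m ω ∧ 0 ≤ R.capital x D (m + 1) ω := by
  constructor
  · exact fun h => ⟨h.mono m.le_succ, h _ le_rfl⟩
  · rintro ⟨h1, h2⟩ l hl
    rcases hl.eq_or_lt with rfl | hl
    · exact h2
    · exact h1 l (Nat.lt_succ_iff.1 hl)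

lemma IsRegular.totalClaims_eq (hω : R.IsRegular ω) {m : ℕ} {t : ℝ≥0}
    (h1 : R.jumpTime m ω ≤ t) (h2 : t < R.jumpTime (m + 1) ω) :
    R.totalClaims t ω = R.claimed m ω :=
  congrArg (fun z => z.2.2) (hω.observed_eq h1 h2)

lemma IsRegular.jumpTime_lt_succ (hω : R.IsRegular ω) (m : ℕ) :
    R.jumpTime m ω < R.jumpTime (m + 1) ω := hω.strictMono m.lt_succ_self

lemma IsRegular.surplus_jumpTime (hω : R.IsRegular ω) (m : ℕ) :
    R.surplus x D (R.jumpTime m ω) ω = R.capital x D m ω := by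
  unfold surplus capital
  rw [hω.totalClaims_eq le_rfl (hω.jumpTime_lt_succ m)]

/-- The premise of the budget concerns claim times up to `t` only; these are jump times of index at
most `m`, where survival gives nonnegative capital. -/
lemma IsRegular.le_of_alive (hω : R.IsRegular ω) (hb : R.WithinBudget x D ω) {m : ℕ}
    (ha : R.Alive x D m ω) {t : ℝ≥0} (h1 : R.jumpTime m ω ≤ t) (h2 : t < R.jumpTime (m + 1) ω) :
    D t ω ≤ x + M.c * t - R.claimed m ω := by
  rw [← hω.totalClaims_eq h1 h2]
  refine hb t ?_
  rintro s hs ⟨l, -, rfl⟩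
  rw [hω.surplus_jumpTime]
  exact ha _ (Nat.lt_succ_iff.1 (hω.strictMono.lt_iff_lt.1 (hs.trans_lt h2)))

lemma IsRegular.dividendsAfter_le (hω : R.IsRegular ω) (hb : R.WithinBudget x D ω) {m : ℕ}
    (ha : R.Alive x D m ω) {s : ℝ≥0} (hs : s < R.hold m ω) :
    R.dividendsAfter D m ω s ≤ R.capital x D m ω + M.c * s := by
  have h := hω.le_of_alive hb ha (t := R.jumpTime m ω + s) le_self_add
    (by rw [jumpTime_succ]; gcongr)
  unfold dividendsAfter capital
  push_cast at h
  linarith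

lemma capital_zero (hD : IsPath fun t => D t ω) : R.capital x D 0 ω = x := by
  have h0 := hD.zero
  simp only [capital, jumpTime_zero, claimed, claimsBefore, h0]
  simp

lemma capital_succ (m : ℕ) : R.capital x D (m + 1) ω = R.capital x D m ω + M.c * R.hold m ω -
    R.dividendsAfter D m ω (R.hold m ω) -
      if R.target m ω = Fin.last n then R.nextClaim m ω else 0 := by
  unfold capital dividendsAfter
  rw [claimed_succ, jumpTime_succ]
  push_cast
  ring

lemma discount_zero : R.discount 0 ω = 1 := by simp [discount, jumpTime_zero]

lemma discount_succ (m : ℕ) : R.discount (m + 1) ω =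
    R.discount m ω * ENNReal.ofReal (Real.exp (-M.δ * R.hold m ω)) := by
  unfold discount
  rw [← ENNReal.ofReal_mul (Real.exp_pos _).le, ← Real.exp_add, jumpTime_succ]
  push_cast
  ring_nf

open scoped Classical in
lemma weight_succ (m : ℕ) : R.weight x D (m + 1) ω = R.weight x D m ω *
    (ENNReal.ofReal (Real.exp (-M.δ * R.hold m ω)) *
      if 0 ≤ R.capital x D (m + 1) ω then 1 else 0) := by
  unfold weight
  rw [alive_succ_iff, discount_succ]
  by_cases h1 : R.Alive x D m ω <;> by_cases h2 : 0 ≤ R.capital x D (m + 1) ω <;> simp [h1, h2]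

lemma pathValue_jumpTime (hD : IsPath fun t => D t ω) (m : ℕ) :
    pathValue M.δ (fun t => D t ω) (R.jumpTime m ω) =
      ∑ l ∈ Finset.range m, R.discount l ω * R.sojournGain D l ω := by
  induction m with
  | zero => simp [jumpTime_zero, pathValue, hD.zero]
  | succ m ih =>
    rw [jumpTime_succ, pathValue_add hD.mono hD.zero, ih, Finset.sum_range_succ]
    rfl

namespace Strategy

variable [P.IsComplete] (S : R.Strategy x)

lemma isPath (ω : Ω) : IsPath fun t => S.D t ω := ⟨S.mono ω, S.left_continuous ω, S.zero ω⟩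

lemma isCumulative : IsCumulative S.D := S.isPath

lemma measurable_filtration (t : ℝ≥0) : Measurable[R.filtration t] (S.D t) :=
  (S.predictable.stronglyAdapted t).measurable

lemma ae_withinBudget : ∀ᵐ ω ∂P, R.WithinBudget x S.D ω := S.budget

lemma discounted_coe (h : ℝ≥0) (ω : Ω) :
    S.discounted h ω = pathValue M.δ (fun t => S.D t ω) h :=
  (S.isPath ω).lintegral_stieltjes M.δ_pos h (S.mono_real ω)

lemma discounted_top (hω : R.IsRegular ω) :
    S.discounted ⊤ ω = ∑' l, R.discount l ω * R.sojournGain S.D l ω := by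
  have hset : {s : ℝ | 0 ≤ s ∧ ENNReal.ofReal s < ⊤} =
      ⋃ m, {s : ℝ | 0 ≤ s ∧ ENNReal.ofReal s < R.jumpTime m ω} := by
    ext s
    simp only [ENNReal.ofReal_lt_top, and_true, Set.mem_ofPred_eq, Set.mem_iUnion, exists_and_left,
      iff_self_and]
    intro hs
    obtain ⟨m, hm⟩ := hω.unbounded s.toNNReal
    exact ⟨m, ENNReal.coe_lt_coe.2 hm⟩
  have hdir : Monotone fun m => {s : ℝ | 0 ≤ s ∧ ENNReal.ofReal s < R.jumpTime m ω} :=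
    fun l m h s hs => ⟨hs.1, hs.2.trans_le (ENNReal.coe_le_coe.2 (R.monotone_jumpTime ω h))⟩
  unfold discounted
  rw [hset, setLIntegral_iUnion_of_directed _ hdir.directed_le, ENNReal.tsum_eq_iSup_nat]
  refine iSup_congr fun m => ?_
  rw [← pathValue_jumpTime (S.isPath ω)]
  exact S.discounted_coe _ ω

/-- The discounted dividends before ruin, split at the jump times. -/
lemma discounted_ruinTime (hω : R.IsRegular ω) (hb : R.WithinBudget x S.D ω) :
    S.discounted (S.ruinTime ω) ω = ∑' l, R.weight x S.D l ω * R.sojournGain S.D l ω := by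
  classical
  -- As long as the company is alive, the budget keeps the surplus nonnegative throughout the
  -- sojourn, so ruin can occur only at a jump.
  have hneg : ∀ t, R.surplus x S.D t ω < 0 → ∃ l, R.jumpTime l ω ≤ t ∧ ¬R.Alive x S.D l ω := by
    intro t ht
    obtain ⟨l, h1, h2⟩ := hω.exists_between t
    refine ⟨l, h1, fun ha => ?_⟩
    have h3 := hω.le_of_alive hb ha h1 h2
    rw [surplus, hω.totalClaims_eq h1 h2] at ht
    linarith
  by_cases hall : ∀ m, R.Alive x S.D m ω
  · have hr : S.ruinTime ω = ⊤ := by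
      unfold ruinTime
      refine iInf₂_eq_top.2 fun t ht => ?_
      obtain ⟨l, -, h⟩ := hneg t ht
      exact absurd (hall l) h
    rw [hr, S.discounted_top hω]
    exact tsum_congr fun l => by rw [weight, if_pos (hall l)]
  · have hex := not_forall.1 hall
    have h1 : ¬R.Alive x S.D (Nat.find hex) ω := Nat.find_spec hex
    have h2 : ∀ l, R.Alive x S.D l ω ↔ l < Nat.find hex := fun l => by
      constructor
      · intro h
        by_contra hl
        exact h1 (h.mono (not_lt.1 hl))
      · exact fun h => not_not.1 (Nat.find_min hex h)
    have h3 : R.capital x S.D (Nat.find hex) ω < 0 := by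
      by_contra h
      refine h1 fun l hl => ?_
      rcases hl.eq_or_lt with rfl | hl
      · exact not_lt.1 h
      · exact (h2 l).2 hl l le_rfl
    have hr : S.ruinTime ω = R.jumpTime (Nat.find hex) ω := by
      refine le_antisymm (iInf₂_le (R.jumpTime (Nat.find hex) ω) ?_) (le_iInf₂ fun t ht => ?_)
      · rwa [hω.surplus_jumpTime]
      · obtain ⟨l, h4, h5⟩ := hneg t ht
        exact ENNReal.coe_le_coe.2 ((R.monotone_jumpTime ω (Nat.find_min' hex h5)).trans h4)
    rw [hr, S.discounted_coe, pathValue_jumpTime (S.isPath ω),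
      tsum_eq_sum (s := Finset.range (Nat.find hex))]
    · refine Finset.sum_congr rfl fun l hl => ?_
      rw [weight, if_pos ((h2 l).2 (Finset.mem_range.1 hl))]
    · intro l hl
      rw [weight, if_neg fun h => hl (Finset.mem_range.2 ((h2 l).1 h)), zero_mul]

end Strategy

end RiskProcess

end Dividend

/-! ### Averaging the payoff over the claim and the restart phase -/

namespace Dividend

namespace Model

variable {n : ℕ} {M : Model n}

/-- At a claim, survival means `y ≤ u`, which is the domain of integration in `claimValue`. At a
change of phase, `hu` guarantees survival. -/
lemma sum_restartProb_mul (W : Fin n → ℝ → ℝ≥0∞) (a : Fin (n + 1)) {u : ℝ} (hu : 0 ≤ u) :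
    ∑ j, ENNReal.ofReal (M.restartProb a j) *
      ∫⁻ y, (if 0 ≤ u - (if a = Fin.last n then y else 0)
        then W j (u - if a = Fin.last n then y else 0) else 0) ∂expMeasure M.β =
      M.extend W a u := by
  induction a using Fin.lastCases with
  | last =>
    simp only [extend, Fin.snoc_last, claimValue, restartProb, if_true]
    refine Finset.sum_congr rfl fun j _ => ?_
    rw [← lintegral_indicator measurableSet_Iic]
    congr 1
    refine lintegral_congr fun y => ?_
    simp only [sub_nonneg, Set.indicator, Set.mem_Iic]
  | cast k =>
    have h : ∀ j, ENNReal.ofReal (M.restartProb k.castSucc j) = if k = j then 1 else 0 := fun j => by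
      rw [restartProb, if_neg (Fin.castSucc_ne_last k)]
      simp only [Fin.castSucc_inj]
      split_ifs <;> simp
    simp [extend, h, hu, Fin.castSucc_ne_last]

variable (M)

/-- The capital `y` after a sojourn with the dividend path `f`, and after the claim that possibly
ends it. -/
noncomputable def capitalAfter (y : ℝ) (f : ℝ≥0 → ℝ) (z : ℝ≥0 × Fin (n + 1) × Fin n) (u : ℝ) : ℝ :=
  y + M.c * z.1 - f z.1 - if z.2.1 = Fin.last n then u else 0

/-- The payoff of the dividend path `f` during a sojourn, with terminal payoff `W` after the jump. -/
noncomputable def valueAfter (W : Fin n → ℝ → ℝ≥0∞) (y : ℝ) (f : ℝ≥0 → ℝ)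
    (z : ℝ≥0 × Fin (n + 1) × Fin n) (u : ℝ) : ℝ≥0∞ :=
  pathValue M.δ f z.1 + ENNReal.ofReal (Real.exp (-M.δ * z.1)) *
    if 0 ≤ M.capitalAfter y f z u then W z.2.2 (M.capitalAfter y f z u) else 0

variable {M}

lemma measurable_valueAfter {α : Type*} [MeasurableSpace α] {W : Fin n → ℝ → ℝ≥0∞}
    (hW : ∀ i, Measurable (W i)) {y : α → ℝ} (hy : Measurable y) {f : α → ℝ≥0 → ℝ}
    (hf : Measurable (Function.uncurry f)) {z : α → ℝ≥0 × Fin (n + 1) × Fin n} (hz : Measurable z)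
    {u : α → ℝ} (hu : Measurable u) :
    Measurable fun x => M.valueAfter W (y x) (f x) (z x) (u x) := by
  have hz1 : Measurable fun x => (z x).1 := measurable_fst.comp hz
  have hfz : Measurable fun x => f x (z x).1 := hf.comp (measurable_id.prodMk hz1)
  have hcap : Measurable fun x => M.capitalAfter (y x) (f x) (z x) (u x) := by
    unfold capitalAfter
    refine Measurable.sub (by fun_prop) (Measurable.ite ?_ hu measurable_const)
    exact (measurable_fst.comp (measurable_snd.comp hz)) (measurableSet_singleton _)
  have hW' : Measurable fun p : Fin n × ℝ => W p.1 p.2 := measurable_from_prod_countable_right hW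
  refine (measurable_pathValue M.δ_pos hf hz1).add (Measurable.mul (by fun_prop) ?_)
  exact Measurable.ite (measurableSet_le measurable_const hcap)
    (hW'.comp ((measurable_snd.comp (measurable_snd.comp hz)).prodMk hcap)) measurable_const

lemma measurable_sojournValue_fst {W : Fin n → ℝ → ℝ≥0∞} (hW : ∀ i, Measurable (W i))
    {y : ℝ} {f : ℝ≥0 → ℝ} (hf : Measurable f) :
    Measurable fun z : ℝ≥0 × Fin (n + 1) × Fin n => M.sojournValue W y f z.1 z.2.1 :=
  measurable_sojournValue hW measurable_const (f := fun _ => f) (hf.comp measurable_snd)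
    measurable_fst (measurable_fst.comp measurable_snd)

lemma lintegral_sojournValue {W : Fin n → ℝ → ℝ≥0∞} (hW : ∀ i, Measurable (W i)) (i : Fin n)
    {y : ℝ} {f : ℝ≥0 → ℝ} (hf : Measurable f) :
    ∫⁻ z, M.sojournValue W y f z.1 z.2.1 ∂M.nextLaw i = M.stepValue W i y f := by
  have hm : ∀ a, Measurable fun s => M.sojournValue W y f s a := fun a =>
    measurable_sojournValue hW measurable_const (f := fun _ => f) (hf.comp measurable_snd) measurable_id
      measurable_const
  rw [M.lintegral_nextLaw i (measurable_sojournValue_fst hW hf), stepValue,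
    lintegral_finsetSum _ fun a _ => (hm a).const_mul _]
  refine Finset.sum_congr rfl fun a _ => ?_
  dsimp only
  rw [lintegral_const_mul' _ _ ENNReal.ofReal_ne_top, ← Finset.sum_mul]
  simp_rw [ENNReal.ofReal_mul (M.jumpProb_nonneg i a)]
  rw [← Finset.mul_sum, ← ENNReal.ofReal_sum_of_nonneg fun j _ => M.restartProb_nonneg a j,
    sum_restartProb, ENNReal.ofReal_one, mul_one]

/-- Integrating out the claim size and the next phase turns the payoff after the jump into the
payoff just before it. Affordability makes the capital before the jump nonnegative. -/
lemma lintegral_valueAfter {W : Fin n → ℝ → ℝ≥0∞} (hW : ∀ i, Measurable (W i)) (i : Fin n)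
    {y : ℝ} {f : ℝ≥0 → ℝ} (hf : IsPayout M.c y f) :
    ∫⁻ z, ∫⁻ u, M.valueAfter W y f z u ∂expMeasure M.β ∂M.nextLaw i = M.stepValue W i y f := by
  have hfm := hf.measurable
  have hm : Measurable fun p : (ℝ≥0 × Fin (n + 1) × Fin n) × ℝ => M.valueAfter W y f p.1 p.2 :=
    measurable_valueAfter hW measurable_const (f := fun _ => f) (hfm.comp measurable_snd) measurable_fst
      measurable_snd
  have hm' : Measurable fun z => ∫⁻ u, M.valueAfter W y f z u ∂expMeasure M.β :=
    hm.lintegral_prod_right'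
  have hms : ∀ a j, Measurable fun s => ∫⁻ u, M.valueAfter W y f (s, a, j) u ∂expMeasure M.β :=
    fun a j => hm'.comp (f := fun s : ℝ≥0 => (s, a, j)) (by fun_prop)
  rw [M.lintegral_nextLaw i hm', stepValue]
  have h0 : ∀ a, ∑ j, ENNReal.ofReal (M.jumpProb i a * M.restartProb a j) *
      ∫⁻ s, ∫⁻ u, M.valueAfter W y f (s, a, j) u ∂expMeasure M.β ∂expLaw (M.leaveRate i) =
      ∫⁻ s, ∑ j, ENNReal.ofReal (M.jumpProb i a * M.restartProb a j) *
        ∫⁻ u, M.valueAfter W y f (s, a, j) u ∂expMeasure M.β ∂expLaw (M.leaveRate i) := by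
    intro a
    rw [lintegral_finsetSum _ fun j _ => (hms a j).const_mul _]
    exact Finset.sum_congr rfl fun j _ => (lintegral_const_mul _ (hms a j)).symm
  simp_rw [h0]
  rw [← lintegral_finsetSum _ fun a _ =>
    Finset.measurable_fun_sum _ fun j _ => (hms a j).const_mul _]
  refine lintegral_congr fun s => Finset.sum_congr rfl fun a _ => ?_
  have h1 : ∀ j, ∫⁻ u, M.valueAfter W y f (s, a, j) u ∂expMeasure M.β = pathValue M.δ f s +
      ENNReal.ofReal (Real.exp (-M.δ * s)) *
        ∫⁻ u, (if 0 ≤ y + M.c * s - f s - (if a = Fin.last n then u else 0)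
          then W j (y + M.c * s - f s - if a = Fin.last n then u else 0) else 0) ∂expMeasure M.β := by
    intro j
    unfold valueAfter capitalAfter
    rw [lintegral_add_left measurable_const, lintegral_const_mul' _ _ ENNReal.ofReal_ne_top]
    simp
  simp_rw [h1, ENNReal.ofReal_mul (M.jumpProb_nonneg i a), mul_assoc]
  rw [← Finset.mul_sum]
  congr 1
  simp_rw [mul_add, Finset.sum_add_distrib]
  rw [← Finset.sum_mul, ← ENNReal.ofReal_sum_of_nonneg fun j _ => M.restartProb_nonneg a j,
    sum_restartProb, ENNReal.ofReal_one, one_mul, sojournValue]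
  congr 1
  simp_rw [mul_left_comm _ (ENNReal.ofReal (Real.exp _)) _]
  rw [← Finset.mul_sum, sum_restartProb_mul]
  have := hf.le s
  linarith

end Model

/-! ### Representing a strategy by functions of the history -/

namespace RiskProcess

variable {n : ℕ} {M : Model n} {Ω : Type*} [MeasurableSpace Ω] {P : Measure Ω}
  (R : RiskProcess M P)

/-- The event that the initial phase is `i`. -/
def startsIn (i : Fin n) : Set Ω := {ω | R.phase 0 ω = i}

lemma measurableSet_startsIn (i : Fin n) : MeasurableSet (R.startsIn i) :=
  R.measurable_phase 0 (measurableSet_singleton i)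

/-- On `{J_0 = i}`, the weight, the capital and the dividends of the sojourn after the `m`-th jump
are the functions `w`, `y` and `f` of the information available at that jump. -/
structure IsRepresentation (x : ℝ) (D : ℝ≥0 → Ω → ℝ) (i : Fin n) (m : ℕ) (w : Hist n m → ℝ≥0∞)
    (y : Hist n m → ℝ) (f : Hist n m → ℝ≥0 → ℝ) : Prop where
  measurable_weight : Measurable w
  measurable_capital : Measurable y
  measurable_path : Measurable (Function.uncurry f)
  isPayout : ∀ η, w η ≠ 0 → IsPayout M.c (y η) (f η)
  weight_eq : ∀ᵐ ω ∂P, (R.startsIn i).indicator (R.weight x D m) ω = w (R.hist m ω)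
  capital_eq : ∀ᵐ ω ∂P, R.capital x D m ω = y (R.hist m ω)
  path_eq : ∀ᵐ ω ∂P, R.Alive x D m ω → ∀ s ≤ R.hold m ω,
    R.dividendsAfter D m ω s = f (R.hist m ω) s

variable {R} {x : ℝ} {D : ℝ≥0 → Ω → ℝ} {i : Fin n} {m : ℕ} {w : Hist n m → ℝ≥0∞}
  {y : Hist n m → ℝ} {f : Hist n m → ℝ≥0 → ℝ}

lemma alive_of_weight_ne_zero {ω : Ω} (h : R.weight x D m ω ≠ 0) : R.Alive x D m ω := by
  by_contra h'
  exact h (if_neg h')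

namespace IsRepresentation

lemma ae_eq (h : R.IsRepresentation x D i m w y f) : ∀ᵐ ω ∂P,
    (R.startsIn i).indicator (R.weight x D m) ω = w (R.hist m ω) ∧
      (w (R.hist m ω) ≠ 0 → R.capital x D m ω = y (R.hist m ω) ∧
        ∀ s ≤ R.hold m ω, R.dividendsAfter D m ω s = f (R.hist m ω) s) := by
  filter_upwards [h.weight_eq, h.capital_eq, h.path_eq] with ω h1 h2 h3
  refine ⟨h1, fun h0 => ⟨h2, h3 ?_⟩⟩
  rw [← h1] at h0
  refine alive_of_weight_ne_zero fun h4 => h0 ?_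
  by_cases hω : ω ∈ R.startsIn i
  · rw [Set.indicator_of_mem hω, h4]
  · rw [Set.indicator_of_notMem hω]

/-- The initial phase and survival are encoded in `w`; where `w` vanishes both integrands vanish, so
`g` and `g'` have to agree only on surviving paths. -/
lemma setLIntegral_eq (h : R.IsRepresentation x D i m w y f) {g g' : Ω → ℝ≥0∞}
    (hg : ∀ᵐ ω ∂P, w (R.hist m ω) ≠ 0 → R.capital x D m ω = y (R.hist m ω) →
      (∀ s ≤ R.hold m ω, R.dividendsAfter D m ω s = f (R.hist m ω) s) → g ω = g' ω) :
    ∫⁻ ω in R.startsIn i, R.weight x D m ω * g ω ∂P = ∫⁻ ω, w (R.hist m ω) * g' ω ∂P := by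
  rw [← lintegral_indicator (R.measurableSet_startsIn i)]
  refine lintegral_congr_ae ?_
  filter_upwards [h.ae_eq, hg] with ω h1 h2
  rw [← h1.1]
  by_cases h0 : w (R.hist m ω) = 0
  · rw [h1.1, h0, zero_mul]
    by_cases hω : ω ∈ R.startsIn i
    · rw [Set.indicator_of_mem hω] at h1 ⊢
      rw [h1.1, h0, zero_mul]
    · rw [Set.indicator_of_notMem hω]
  · rw [← h2 h0 (h1.2 h0).1 (h1.2 h0).2]
    by_cases hω : ω ∈ R.startsIn i <;> simp [hω]

lemma lintegral_weight (h : R.IsRepresentation x D i m w y f) (W : Fin n → ℝ → ℝ≥0∞) :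
    ∫⁻ ω in R.startsIn i, R.weight x D m ω * W (R.phase m ω) (R.capital x D m ω) ∂P =
      ∫⁻ ω, w (R.hist m ω) * W (R.phase m ω) (y (R.hist m ω)) ∂P :=
  h.setLIntegral_eq (Eventually.of_forall fun ω _ h2 _ => by rw [h2])

variable [IsProbabilityMeasure P]

/-- The expected payoff of one sojourn, evaluated just before the jump. -/
lemma lintegral_sojournValue (h : R.IsRepresentation x D i m w y f) {W : Fin n → ℝ → ℝ≥0∞}
    (hW : ∀ i, Measurable (W i)) :
    ∫⁻ ω in R.startsIn i, R.weight x D m ω * M.sojournValue W (R.capital x D m ω)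
      (R.dividendsAfter D m ω) (R.hold m ω) (R.target m ω) ∂P =
      ∫⁻ ω, w (R.hist m ω) * M.stepValue W (R.phase m ω) (y (R.hist m ω)) (f (R.hist m ω)) ∂P := by
  rw [h.setLIntegral_eq (g' := fun ω => M.sojournValue W (y (R.hist m ω)) (f (R.hist m ω))
    (R.next m ω).1 (R.next m ω).2.1)]
  · have hF : Measurable fun p : (Hist n m × (ℝ≥0 × Fin (n + 1) × Fin n)) × ℝ =>
        w p.1.1 * M.sojournValue W (y p.1.1) (f p.1.1) p.1.2.1 p.1.2.2.1 := by
      refine (h.measurable_weight.comp (by fun_prop)).mul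
        (Model.measurable_sojournValue hW (h.measurable_capital.comp (by fun_prop))
        (f := fun p : (Hist n m × (ℝ≥0 × Fin (n + 1) × Fin n)) × ℝ => f p.1.1) ?_
        (by fun_prop) (by fun_prop))
      exact h.measurable_path.comp (f := fun q :
        ((Hist n m × (ℝ≥0 × Fin (n + 1) × Fin n)) × ℝ) × ℝ≥0 => (q.1.1.1, q.2)) (by fun_prop)
    rw [R.lintegral_hist_next m (F := fun η z _ => w η * M.sojournValue W (y η) (f η) z.1 z.2.1) hF]
    refine lintegral_congr fun ω => ?_
    have hfm : Measurable (f (R.hist m ω)) := h.measurable_path.comp measurable_prodMk_left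
    simp only [lintegral_const, measure_univ, mul_one]
    rw [lintegral_const_mul _ (Model.measurable_sojournValue_fst hW hfm),
      Model.lintegral_sojournValue hW _ hfm]
  · refine Eventually.of_forall fun ω _ h2 h3 => ?_
    unfold Model.sojournValue
    rw [h2, h3 _ le_rfl, pathValue_congr h3]
    rfl

/-- The expected payoff of one sojourn, evaluated after the jump. -/
lemma lintegral_sojournGain_add (h : R.IsRepresentation x D i m w y f) {W : Fin n → ℝ → ℝ≥0∞}
    (hW : ∀ i, Measurable (W i)) :
    ∫⁻ ω in R.startsIn i, R.weight x D m ω * R.sojournGain D m ω ∂P +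
      ∫⁻ ω in R.startsIn i, R.weight x D (m + 1) ω *
        W (R.phase (m + 1) ω) (R.capital x D (m + 1) ω) ∂P =
      ∫⁻ ω, w (R.hist m ω) * M.stepValue W (R.phase m ω) (y (R.hist m ω)) (f (R.hist m ω)) ∂P := by
  classical
  have hfp := h.measurable_path
  have hw : Measurable fun ω => w (R.hist m ω) := h.measurable_weight.comp (R.measurable_hist m)
  -- Survival up to the `m`-th jump stays in the weight, and survival of the next jump becomes a
  -- sign test inside the payoff, as in `valueAfter`.
  have h1 : ∀ ω, R.weight x D (m + 1) ω * W (R.phase (m + 1) ω) (R.capital x D (m + 1) ω) =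
      R.weight x D m ω * (ENNReal.ofReal (Real.exp (-M.δ * R.hold m ω)) *
        if 0 ≤ R.capital x D (m + 1) ω
          then W (R.phase (m + 1) ω) (R.capital x D (m + 1) ω) else 0) := by
    intro ω
    rw [weight_succ, mul_assoc, mul_assoc]
    split_ifs <;> simp
  simp_rw [h1]
  rw [h.setLIntegral_eq (g' := fun ω => pathValue M.δ (f (R.hist m ω)) (R.hold m ω)),
    h.setLIntegral_eq (g' := fun ω => ENNReal.ofReal (Real.exp (-M.δ * R.hold m ω)) *
      if 0 ≤ M.capitalAfter (y (R.hist m ω)) (f (R.hist m ω)) (R.next m ω) (R.nextClaim m ω)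
        then W (R.phase (m + 1) ω)
          (M.capitalAfter (y (R.hist m ω)) (f (R.hist m ω)) (R.next m ω) (R.nextClaim m ω))
        else 0), ← lintegral_add_left]
  · have hF : Measurable fun p : (Hist n m × (ℝ≥0 × Fin (n + 1) × Fin n)) × ℝ =>
        w p.1.1 * M.valueAfter W (y p.1.1) (f p.1.1) p.1.2 p.2 := by
      refine (h.measurable_weight.comp (by fun_prop)).mul
        (Model.measurable_valueAfter hW (h.measurable_capital.comp (by fun_prop))
        (f := fun p : (Hist n m × (ℝ≥0 × Fin (n + 1) × Fin n)) × ℝ => f p.1.1) ?_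
        (by fun_prop) (by fun_prop))
      exact h.measurable_path.comp (f := fun q :
        ((Hist n m × (ℝ≥0 × Fin (n + 1) × Fin n)) × ℝ) × ℝ≥0 => (q.1.1.1, q.2)) (by fun_prop)
    have h2 := R.lintegral_hist_next m (F := fun η z u => w η * M.valueAfter W (y η) (f η) z u) hF
    simp_rw [← mul_add]
    refine h2.trans (lintegral_congr fun ω => ?_)
    by_cases h0 : w (R.hist m ω) = 0
    · simp [h0]
    have hp := h.isPayout _ h0
    have hv : Measurable fun p : (ℝ≥0 × Fin (n + 1) × Fin n) × ℝ =>
        M.valueAfter W (y (R.hist m ω)) (f (R.hist m ω)) p.1 p.2 :=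
      Model.measurable_valueAfter hW measurable_const (f := fun _ => f (R.hist m ω))
        (hp.measurable.comp measurable_snd) measurable_fst measurable_snd
    rw [← Model.lintegral_valueAfter hW _ hp, ← lintegral_const_mul _ hv.lintegral_prod_right']
    refine lintegral_congr fun z => ?_
    rw [lintegral_const_mul _ (by exact hv.comp measurable_prodMk_left)]
  · refine hw.mul (measurable_pathValue M.δ_pos (d := fun ω => f (R.hist m ω)) ?_
      (R.measurable_hold m))
    exact hfp.comp (((R.measurable_hist m).comp measurable_fst).prodMk measurable_snd)
  · refine Eventually.of_forall fun ω _ h2 h3 => ?_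
    have hc : R.capital x D (m + 1) ω =
        M.capitalAfter (y (R.hist m ω)) (f (R.hist m ω)) (R.next m ω) (R.nextClaim m ω) := by
      rw [capital_succ, h2, h3 _ le_rfl]
      rfl
    rw [hc]
  · exact Eventually.of_forall fun ω _ _ h3 => pathValue_congr h3

end IsRepresentation

variable [P.IsComplete] [IsProbabilityMeasure P]

/-- The factorisation through the history is valid only almost surely, whereas the path must be
affordable for every history of nonzero weight. The envelope enforces this and changes nothing on
surviving paths within the budget. -/
lemma Strategy.exists_isRepresentation (S : R.Strategy x) (i : Fin n) (m : ℕ) :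
    ∃ w y f, R.IsRepresentation x S.D i m w y f := by
  classical
  have : Nonempty (Fin n × ℕ × ℝ) := ⟨(i, 0, 0)⟩
  obtain ⟨G, hG, hGD⟩ := R.exists_factor_of_adapted m S.isCumulative S.measurable_filtration
  -- Dummy values for `l > m` make the factors total functions of `l`, ready for `choose`.
  have hT : ∀ l, ∃ T : Hist n m → ℝ≥0, Measurable T ∧ (l ≤ m → R.jumpTime l = T ∘ R.hist m) := by
    intro l
    by_cases hl : l ≤ m
    · obtain ⟨T, h1, h2⟩ := Measurable.exists_eq_measurable_comp
        (measurable_iff_comap_le.2 ((measurable_iff_comap_le.1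
          (R.measurable_histSpace_jumpTime l)).trans (R.histSpace_mono hl)))
      exact ⟨T, h1, fun _ => h2⟩
    · exact ⟨fun _ => 0, measurable_const, fun h => absurd h hl⟩
  have hZ : ∀ l, ∃ Z : Hist n m → Fin n × ℕ × ℝ, Measurable Z ∧
      (l ≤ m → R.state l = Z ∘ R.hist m) := by
    intro l
    by_cases hl : l ≤ m
    · obtain ⟨Z, h1, h2⟩ := Measurable.exists_eq_measurable_comp
        (measurable_iff_comap_le.2 ((measurable_iff_comap_le.1
          (R.measurable_histSpace_state l)).trans (R.histSpace_mono hl)))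
      exact ⟨Z, h1, fun _ => h2⟩
    · exact ⟨fun _ => (i, 0, 0), measurable_const, fun h => absurd h hl⟩
  choose T hTm hT using hT
  choose Z hZm hZ using hZ
  let X : ℕ → Hist n m → ℝ := fun l η => x + M.c * T l η - (Z l η).2.2 - G η (T l η)
  have hXm : ∀ l, Measurable (X l) := fun l => by
    have h1 : Measurable fun η => G η (T l η) := hG.comp (measurable_id.prodMk (hTm l))
    have h2 : Measurable fun η => (Z l η).2.2 :=
      (measurable_snd.comp measurable_snd).comp (hZm l)
    have h3 := hTm l
    fun_prop
  have hX : ∀ᵐ ω ∂P, ∀ l ≤ m, R.capital x S.D l ω = X l (R.hist m ω) := by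
    filter_upwards [hGD] with ω hω l hl
    have h1 : R.jumpTime l ω = T l (R.hist m ω) := congrFun (hT l hl) ω
    have h2 : R.claimed l ω = (Z l (R.hist m ω)).2.2 := congrArg (fun z => z.2.2) (congrFun (hZ l hl) ω)
    have h3 := hω (R.jumpTime l ω) (R.monotone_jumpTime ω (hl.trans m.le_succ))
    simp only [capital, X]
    rw [h3, h2, h1]
  let A : Set (Hist n m) := {η | (Z 0 η).1 = i ∧ ∀ l ∈ Finset.range (m + 1), 0 ≤ X l η}
  have hA : MeasurableSet A := by
    have h1 : {η | ∀ l ∈ Finset.range (m + 1), 0 ≤ X l η} =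
        ⋂ l ∈ Finset.range (m + 1), {η | 0 ≤ X l η} := by ext; simp
    have h2 : MeasurableSet {η | ∀ l ∈ Finset.range (m + 1), 0 ≤ X l η} := by
      rw [h1]
      exact Finset.measurableSet_biInter _ fun l _ => measurableSet_le measurable_const (hXm l)
    exact ((measurable_fst.comp (hZm 0)) (measurableSet_singleton i)).inter h2
  have hshift : Measurable fun p : Hist n m × ℝ≥0 =>
      G p.1 (T m p.1 + p.2) - G p.1 (T m p.1) := by
    have h1 := hTm m
    exact (hG.comp (f := fun p : Hist n m × ℝ≥0 => (p.1, T m p.1 + p.2)) (by fun_prop)).sub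
      (hG.comp (f := fun p : Hist n m × ℝ≥0 => (p.1, T m p.1)) (by fun_prop))
  refine ⟨fun η => if η ∈ A then ENNReal.ofReal (Real.exp (-M.δ * T m η)) else 0, X m,
    fun η => envelope M.c (X m η) fun s => G η (T m η + s) - G η (T m η), ?_, hXm m, ?_, ?_, ?_, ?_,
    ?_⟩
  · have h1 := hTm m
    exact Measurable.ite hA (by fun_prop) measurable_const
  · exact measurable_envelope (hXm m) fun s =>
      hshift.comp (f := fun η => (η, s)) (by fun_prop)
  · intro η hη
    have : η ∈ A := by by_contra h; exact hη (if_neg h)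
    exact isPayout_envelope M.c_pos.le (this.2 m (by simp))
  · filter_upwards [hX] with ω hω
    have h1 : R.jumpTime m ω = T m (R.hist m ω) := congrFun (hT m le_rfl) ω
    have h2 : R.phase 0 ω = (Z 0 (R.hist m ω)).1 := congrArg Prod.fst (congrFun (hZ 0 m.zero_le) ω)
    have h3 : R.Alive x S.D m ω ↔ ∀ l ∈ Finset.range (m + 1), 0 ≤ X l (R.hist m ω) := by
      simp only [Finset.mem_range, Nat.lt_succ_iff]
      exact forall₂_congr fun l hl => by rw [hω l hl]
    simp only [Set.indicator, startsIn, Set.mem_ofPred_eq, weight, discount, h1, h2, h3, A]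
    split_ifs <;> tauto
  · filter_upwards [hX] with ω hω
    exact hω m le_rfl
  · filter_upwards [R.ae_isRegular, S.ae_withinBudget, hX, hGD] with ω hω hb h1 h2 ha s hs
    have h3 : R.jumpTime m ω = T m (R.hist m ω) := congrFun (hT m le_rfl) ω
    have hpath : IsPath (R.dividendsAfter S.D m ω) := (S.isPath ω).shift _
    rw [← envelope_eq M.c_pos.le (ha m le_rfl) hpath (fun r hr => hω.dividendsAfter_le hb ha hr) hs,
      h1 m le_rfl]
    refine envelope_congr fun r hr => ?_
    have h4 : R.jumpTime m ω + r ≤ R.jumpTime (m + 1) ω := by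
      rw [jumpTime_succ]; gcongr; exact hr.le.trans hs
    have h5 : R.jumpTime m ω ≤ R.jumpTime (m + 1) ω := R.monotone_jumpTime ω m.le_succ
    unfold dividendsAfter
    rw [h2 _ h4, h2 _ h5, h3]

end RiskProcess

end Dividend

namespace Dividend

/-- Stopping and shifting a dividend path. -/
lemma IsPath.stop_shift {f : ℝ≥0 → ℝ} (hf : IsPath f) (a b : ℝ≥0) :
    IsPath fun t => f (min t b - a) where
  mono _ _ h := hf.mono (tsub_le_tsub_right (min_le_min_right b h) a)
  left_continuous t := by
    refine (hf.left_continuous (min t b - a)).comp (t := Set.Iic (min t b - a)) (by fun_prop) ?_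
    intro s (hs : s ≤ t)
    exact tsub_le_tsub_right (min_le_min_right b hs) a
  zero := by simp [hf.zero]

lemma IsPath.add {f g : ℝ≥0 → ℝ} (hf : IsPath f) (hg : IsPath g) : IsPath fun t => f t + g t where
  mono := hf.mono.add hg.mono
  left_continuous t := (hf.left_continuous t).add (hg.left_continuous t)
  zero := by rw [hf.zero, hg.zero, add_zero]

lemma isPath_zero : IsPath fun _ => 0 := ⟨monotone_const, fun _ => continuousWithinAt_const, rfl⟩

namespace RiskProcess

variable {n : ℕ} {M : Model n} {Ω : Type*} [MeasurableSpace Ω] {P : Measure Ω}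
  {R : RiskProcess M P} {x : ℝ} {ω : Ω}

/-- The premise tests claim times only. At any other jump the budget inequality itself says that the
capital is nonnegative. -/
lemma IsRegular.alive_of_withinBudget (hω : R.IsRegular ω) {D : ℝ≥0 → Ω → ℝ}
    (hb : R.WithinBudget x D ω) {m : ℕ}
    (h : ∀ s ≤ R.jumpTime m ω, R.IsClaimTime s ω → 0 ≤ R.surplus x D s ω) :
    R.Alive x D m ω := by
  intro l hl
  have h1 := R.monotone_jumpTime ω hl
  have h2 := hb (R.jumpTime l ω) fun s hs => h s (hs.trans h1)
  rw [← hω.surplus_jumpTime, surplus]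
  linarith

/-! ### Modifying a strategy after a jump -/

section Agreement

variable {D D' : ℝ≥0 → Ω → ℝ} {m : ℕ}

lemma capital_congr (h : ∀ t ≤ R.jumpTime m ω, D' t ω = D t ω) {l : ℕ} (hl : l ≤ m) :
    R.capital x D' l ω = R.capital x D l ω := by
  have h1 : R.jumpTime l ω ≤ R.jumpTime m ω := R.monotone_jumpTime ω hl
  unfold capital
  rw [h _ h1]

lemma alive_congr (h : ∀ t ≤ R.jumpTime m ω, D' t ω = D t ω) {l : ℕ} (hl : l ≤ m) :
    R.Alive x D' l ω ↔ R.Alive x D l ω :=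
  forall₂_congr fun k hk => by rw [capital_congr h (hk.trans hl)]

lemma weight_congr (h : ∀ t ≤ R.jumpTime m ω, D' t ω = D t ω) {l : ℕ} (hl : l ≤ m) :
    R.weight x D' l ω = R.weight x D l ω := by
  have h1 := alive_congr (x := x) h hl
  by_cases ha : R.Alive x D l ω
  · rw [weight, weight, if_pos ha, if_pos (h1.2 ha)]
  · rw [weight, weight, if_neg ha, if_neg fun h => ha (h1.1 h)]

lemma dividendsAfter_congr (h : ∀ t ≤ R.jumpTime (m + 1) ω, D' t ω = D t ω) {s : ℝ≥0}
    (hs : s ≤ R.hold m ω) : R.dividendsAfter D' m ω s = R.dividendsAfter D m ω s := by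
  have h1 : R.jumpTime m ω + s ≤ R.jumpTime (m + 1) ω := by rw [jumpTime_succ]; gcongr
  unfold dividendsAfter
  rw [h _ h1, h _ (le_self_add.trans h1)]

lemma sojournGain_congr (h : ∀ t ≤ R.jumpTime (m + 1) ω, D' t ω = D t ω) :
    R.sojournGain D' m ω = R.sojournGain D m ω :=
  pathValue_congr fun _ hs => dividendsAfter_congr h hs

end Agreement

open scoped Classical in
/-- The dividends `D` up to the `m`-th jump, continued, if ruin has not occurred, during the next
sojourn by the path `φ i y` chosen according to the phase `i` and the capital `y` at that jump. -/
noncomputable def continueWith (R : RiskProcess M P) (x : ℝ) (D : ℝ≥0 → Ω → ℝ) (m : ℕ)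
    (φ : Fin n → ℝ → ℝ≥0 → ℝ) (t : ℝ≥0) (ω : Ω) : ℝ :=
  D (min t (R.jumpTime m ω)) ω + if R.Alive x D m ω then
    φ (R.phase m ω) (R.capital x D m ω) (min t (R.jumpTime (m + 1) ω) - R.jumpTime m ω) else 0

section Continue

variable {D : ℝ≥0 → Ω → ℝ} {m : ℕ} {φ : Fin n → ℝ → ℝ≥0 → ℝ}

lemma continueWith_of_le (hφ : ∀ i y, 0 ≤ y → IsPayout M.c y (φ i y)) {t : ℝ≥0}
    (ht : t ≤ R.jumpTime m ω) : R.continueWith x D m φ t ω = D t ω := by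
  unfold continueWith
  rw [min_eq_left ht, tsub_eq_zero_of_le ((min_le_left _ _).trans ht)]
  split_ifs with h
  · rw [(hφ _ _ (h m le_rfl)).zero, add_zero]
  · rw [add_zero]

lemma continueWith_of_alive (ha : R.Alive x D m ω) {s : ℝ≥0} (hs : s ≤ R.hold m ω) :
    R.continueWith x D m φ (R.jumpTime m ω + s) ω =
      D (R.jumpTime m ω) ω + φ (R.phase m ω) (R.capital x D m ω) s := by
  unfold continueWith
  rw [min_eq_right le_self_add, if_pos ha, jumpTime_succ, min_eq_left (by gcongr),
    add_tsub_cancel_left]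

lemma continueWith_of_ge {t : ℝ≥0} (ht : R.jumpTime (m + 1) ω ≤ t) :
    R.continueWith x D m φ t ω = R.continueWith x D m φ (R.jumpTime (m + 1) ω) ω := by
  have h : R.jumpTime m ω ≤ R.jumpTime (m + 1) ω := R.monotone_jumpTime ω m.le_succ
  unfold continueWith
  rw [min_eq_right ht, min_self, min_eq_right h, min_eq_right (h.trans ht)]

lemma dividendsAfter_continueWith (hφ : ∀ i y, 0 ≤ y → IsPayout M.c y (φ i y))
    (ha : R.Alive x D m ω) {s : ℝ≥0} (hs : s ≤ R.hold m ω) :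
    R.dividendsAfter (R.continueWith x D m φ) m ω s = φ (R.phase m ω) (R.capital x D m ω) s := by
  unfold dividendsAfter
  rw [continueWith_of_alive ha hs, continueWith_of_le hφ le_rfl]
  ring

lemma isCumulative_continueWith (hD : IsCumulative D)
    (hφ : ∀ i y, 0 ≤ y → IsPayout M.c y (φ i y)) : IsCumulative (R.continueWith x D m φ) := by
  intro ω
  have h1 := (hD ω).stop_shift 0 (R.jumpTime m ω)
  simp only [tsub_zero] at h1
  unfold continueWith
  refine h1.add ?_
  split_ifs with h
  · exact (hφ _ _ (h m le_rfl)).toIsPath.stop_shift _ _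
  · exact isPath_zero

/-- Up to the `m`-th jump the budget is that of `D`. Afterwards the capital stays nonnegative from
jump to jump: at a claim by the premise of the budget, at a change of phase because `φ` is
affordable during one sojourn and nothing is paid later. -/
lemma IsRegular.withinBudget_continueWith (hω : R.IsRegular ω) (hb : R.WithinBudget x D ω)
    (hφ : ∀ i y, 0 ≤ y → IsPayout M.c y (φ i y)) :
    R.WithinBudget x (R.continueWith x D m φ) ω := by
  intro t ht
  have hD : ∀ t ≤ R.jumpTime m ω, R.continueWith x D m φ t ω = D t ω := fun t h =>
    continueWith_of_le hφ h
  have hs : ∀ t ≤ R.jumpTime m ω, R.surplus x (R.continueWith x D m φ) t ω = R.surplus x D t ω :=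
    fun t h => by rw [surplus, surplus, hD t h]
  rcases le_total t (R.jumpTime m ω) with h | h
  · rw [hD t h]
    exact hb t fun s h1 h2 => by rw [← hs s (h1.trans h)]; exact ht s h1 h2
  have ha : R.Alive x D m ω := hω.alive_of_withinBudget hb fun s h1 h2 => by
    rw [← hs s h1]; exact ht s (h1.trans h) h2
  obtain ⟨l, h1, h2⟩ := hω.exists_between t
  have hml : m ≤ l := Nat.lt_succ_iff.1 (hω.strictMono.lt_iff_lt.1 (h.trans_lt h2))
  have hstep : ∀ j, m ≤ j → 0 ≤ R.capital x (R.continueWith x D m φ) j ω → ∀ s ≤ R.hold j ω,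
      R.dividendsAfter (R.continueWith x D m φ) j ω s ≤
        R.capital x (R.continueWith x D m φ) j ω + M.c * s := by
    intro j hj hc s hsj
    rcases hj.eq_or_lt with rfl | hj
    · rw [dividendsAfter_continueWith hφ ha hsj, capital_congr hD le_rfl]
      exact (hφ _ _ (ha m le_rfl)).le s
    · have h3 : R.jumpTime (m + 1) ω ≤ R.jumpTime j ω := R.monotone_jumpTime ω hj
      have h4 := mul_nonneg M.c_pos.le s.coe_nonneg
      rw [dividendsAfter, continueWith_of_ge h3, continueWith_of_ge (h3.trans le_self_add), sub_self]
      linarith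
  have hcap : ∀ j, m ≤ j → j ≤ l → 0 ≤ R.capital x (R.continueWith x D m φ) j ω := by
    intro j hj
    induction j, hj using Nat.le_induction with
    | base => exact fun _ => by rw [capital_congr hD le_rfl]; exact ha m le_rfl
    | succ j hj ih =>
      intro hjl
      by_cases hT : R.target j ω = Fin.last n
      · have h3 := ht (R.jumpTime (j + 1) ω) ((R.monotone_jumpTime ω hjl).trans h1) ⟨j, hT, rfl⟩
        rwa [hω.surplus_jumpTime] at h3
      · have h3 := hstep j hj (ih (j.le_succ.trans hjl)) _ le_rfl
        rw [capital_succ, if_neg hT]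
        linarith
  have h5 := hstep l hml (hcap l hml le_rfl) (t - R.jumpTime l ω) (by
    rw [tsub_le_iff_left, ← jumpTime_succ]; exact h2.le)
  rw [dividendsAfter, add_tsub_cancel_of_le h1, NNReal.coe_sub h1, capital] at h5
  rw [hω.totalClaims_eq h1 h2]
  linarith

variable [P.IsComplete] [IsProbabilityMeasure P]

lemma measurable_jumpSpace_capital (hD : IsCumulative D)
    (had : ∀ t, Measurable[R.filtration t] (D t)) (m : ℕ) :
    Measurable[R.jumpSpace m] (R.capital x D m) := by
  have h : Measurable fun p : ℝ≥0 × (Fin n × ℕ × ℝ) × ℝ =>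
      x + M.c * p.1 - p.2.1.2.2 - p.2.2 := by fun_prop
  exact h.comp ((R.measurable_jumpSpace_jumpTime m).prodMk ((R.measurable_jumpSpace_state m).prodMk
    (R.measurable_jumpSpace_stopped hD had m)))

lemma measurable_jumpSpace_alive (hD : IsCumulative D)
    (had : ∀ t, Measurable[R.filtration t] (D t)) (m : ℕ) :
    Measurable[R.jumpSpace m] (R.Alive x D m) := by
  have h : {ω | R.Alive x D m ω} = ⋂ l : Fin (m + 1), R.capital x D l ⁻¹' Set.Ici 0 := by
    ext ω
    simp only [Alive, Set.mem_ofPred_eq, Set.mem_iInter, Set.mem_preimage, Set.mem_Ici]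
    exact ⟨fun h l => h l (Nat.lt_succ_iff.1 l.2), fun h l hl => h ⟨l, Nat.lt_succ_iff.2 hl⟩⟩
  refine measurable_to_prop ?_
  have h' : R.Alive x D m ⁻¹' {True} = {ω | R.Alive x D m ω} := by ext; simp
  rw [h', h]
  exact MeasurableSet.iInter fun l => R.jumpSpace_mono (Nat.lt_succ_iff.1 l.2) _
    (measurable_jumpSpace_capital hD had l measurableSet_Ici)

lemma measurable_continueWith (hD : IsCumulative D)
    (had : ∀ t, Measurable[R.filtration t] (D t))
    (hφm : ∀ i, Measurable (Function.uncurry (φ i)))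
    (hφ : ∀ i y, 0 ≤ y → IsPayout M.c y (φ i y)) (t : ℝ≥0) :
    Measurable[R.filtration t] (R.continueWith x D m φ t) := by
  classical
  obtain ⟨ω₀⟩ := nonempty_of_isProbabilityMeasure P
  refine Measurable.add (R.measurable_stopped hD had m t) ?_
  have hf : Measurable[R.jumpSpace m] fun ω =>
      (R.phase m ω, R.capital x D m ω, R.jumpTime m ω, R.Alive x D m ω) :=
    (measurable_fst.comp (R.measurable_jumpSpace_state m)).prodMk
      ((measurable_jumpSpace_capital hD had m).prodMk
        ((R.measurable_jumpSpace_jumpTime m).prodMk (measurable_jumpSpace_alive hD had m)))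
  -- Before the `m`-th jump its data are unknown and are replaced by constants. This does no harm,
  -- since the continuation has then paid nothing.
  have hg := (R.measurable_filtration_ite hf (R.phase m ω₀, 0, 0, False) t).prodMk
    (R.measurable_filtration_min_jumpTime (m + 1) t)
  have hΨ : Measurable fun q : (Fin n × ℝ × ℝ≥0 × Prop) × ℝ≥0 =>
      if q.1.2.2.2 then φ q.1.1 q.1.2.1 (q.2 - q.1.2.2.1) else 0 := by
    have h1 : Measurable fun p : Fin n × ℝ × ℝ≥0 => φ p.1 p.2.1 p.2.2 :=
      measurable_from_prod_countable_right (f := fun p : Fin n × ℝ × ℝ≥0 => φ p.1 p.2.1 p.2.2) hφm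
    refine Measurable.ite ?_ (h1.comp (f := fun q : (Fin n × ℝ × ℝ≥0 × Prop) × ℝ≥0 =>
      (q.1.1, q.1.2.1, q.2 - q.1.2.2.1)) (by fun_prop)) measurable_const
    exact measurableSet_setOfPred.2
      (measurable_snd.comp (measurable_snd.comp (measurable_snd.comp measurable_fst)))
  convert hΨ.comp hg using 1
  funext ω
  simp only [Function.comp_apply]
  by_cases h : R.jumpTime m ω ≤ t
  · simp only [if_pos h]
  · simp only [if_neg h, if_false]
    rw [tsub_eq_zero_of_le ((min_le_left _ _).trans (not_le.1 h).le)]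
    split_ifs with ha
    · exact (hφ _ _ (ha m le_rfl)).zero
    · rfl

end Continue

variable [P.IsComplete] [IsProbabilityMeasure P]

/-- The strategy that continues `S` after the `m`-th jump by the paths `φ`. -/
noncomputable def Strategy.continueWith (S : R.Strategy x) (m : ℕ) (φ : Fin n → ℝ → ℝ≥0 → ℝ)
    (hφm : ∀ i, Measurable (Function.uncurry (φ i)))
    (hφ : ∀ i y, 0 ≤ y → IsPayout M.c y (φ i y)) : R.Strategy x where
  D := R.continueWith x S.D m φ
  predictable := R.isStronglyPredictable (isCumulative_continueWith S.isCumulative hφ)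
    (measurable_continueWith S.isCumulative S.measurable_filtration hφm hφ)
  zero ω := (isCumulative_continueWith S.isCumulative hφ ω).zero
  mono ω := (isCumulative_continueWith S.isCumulative hφ ω).mono
  left_continuous ω := (isCumulative_continueWith S.isCumulative hφ ω).left_continuous
  budget := by
    filter_upwards [R.ae_isRegular, S.ae_withinBudget] with ω h1 h2
    exact h1.withinBudget_continueWith h2 hφ

variable (R) in
/-- The strategy that never pays dividends. -/
noncomputable def zeroStrategy (hx : 0 ≤ x) : R.Strategy x where
  D _ _ := 0
  predictable := R.isStronglyPredictable (fun _ => isPath_zero) fun _ => measurable_const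
  zero _ := rfl
  mono _ := monotone_const
  left_continuous _ _ := continuousWithinAt_const
  budget := by
    filter_upwards [R.ae_isRegular] with ω hω t ht
    obtain ⟨l, h1, h2⟩ := hω.exists_between t
    have hcap : ∀ j ≤ l, 0 ≤ R.capital x (fun _ _ => 0) j ω := by
      intro j
      induction j with
      | zero => exact fun _ => by rwa [capital_zero (by exact isPath_zero)]
      | succ j ih =>
        intro hjl
        by_cases hT : R.target j ω = Fin.last n
        · have h3 := ht (R.jumpTime (j + 1) ω) ((R.monotone_jumpTime ω hjl).trans h1) ⟨j, hT, rfl⟩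
          rwa [hω.surplus_jumpTime] at h3
        · have h3 := ih (j.le_succ.trans hjl)
          have h4 := mul_nonneg M.c_pos.le (R.hold j ω).coe_nonneg
          rw [capital_succ, if_neg hT, dividendsAfter]
          linarith
    have h3 := hcap l le_rfl
    have h4 : M.c * R.jumpTime l ω ≤ M.c * t := mul_le_mul_of_nonneg_left h1 M.c_pos.le
    rw [capital] at h3
    rw [hω.totalClaims_eq h1 h2]
    linarith

end RiskProcess

end Dividend

/-! ### Comparison of the value function with the iterates -/

namespace Dividend

namespace RiskProcess

variable {n : ℕ} {M : Model n} {Ω : Type*} [MeasurableSpace Ω] {P : Measure Ω}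
  {R : RiskProcess M P} {x : ℝ} {ω : Ω}

lemma weight_zero {D : ℝ≥0 → Ω → ℝ} (hD : IsPath fun t => D t ω) (hx : 0 ≤ x) :
    R.weight x D 0 ω = 1 := by
  rw [weight, if_pos, discount_zero]
  intro l hl
  rwa [Nat.le_zero.1 hl, capital_zero hD]

lemma weight_le_one {D : ℝ≥0 → Ω → ℝ} (m : ℕ) : R.weight x D m ω ≤ 1 := by
  unfold weight
  split_ifs
  · refine ENNReal.ofReal_le_one.2 (Real.exp_le_one_iff.2 ?_)
    have := mul_nonneg M.δ_pos.le (R.jumpTime m ω).coe_nonneg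
    linarith
  · exact zero_le_one

lemma setLIntegral_startsIn_congr {i : Fin n} {f g : Ω → ℝ≥0∞}
    (h : ∀ ω, R.phase 0 ω = i → f ω = g ω) :
    ∫⁻ ω in R.startsIn i, f ω ∂P = ∫⁻ ω in R.startsIn i, g ω ∂P :=
  setLIntegral_congr_fun (R.measurableSet_startsIn i) fun ω hω => h ω hω

lemma lintegral_cond_startsIn (i : Fin n) (g : Ω → ℝ≥0∞) :
    ∫⁻ ω, g ω ∂(cond P {ω | R.phase 0 ω = i}) =
      (P (R.startsIn i))⁻¹ * ∫⁻ ω in R.startsIn i, g ω ∂P := by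
  rw [ProbabilityTheory.cond, lintegral_smul_measure]
  rfl

lemma measure_startsIn_mul_inv [IsFiniteMeasure P] (i : Fin n) : P (R.startsIn i) * (P (R.startsIn i))⁻¹ = 1 :=
  ENNReal.mul_inv_cancel (R.initial i) (measure_ne_top _ _)

lemma setLIntegral_start [P.IsComplete] (S : R.Strategy x) (hx : 0 ≤ x) (i : Fin n) (W : Fin n → ℝ → ℝ≥0∞) :
    ∫⁻ ω in R.startsIn i, R.weight x S.D 0 ω * W (R.phase 0 ω) (R.capital x S.D 0 ω) ∂P =
      W i x * P (R.startsIn i) := by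
  rw [← setLIntegral_const]
  refine setLIntegral_startsIn_congr fun ω hω => ?_
  rw [weight_zero (S.isPath ω) hx, capital_zero (S.isPath ω), hω, one_mul]

/-- A representation of `S` yields one of every continuation of `S`. -/
lemma IsRepresentation.continueWith {D : ℝ≥0 → Ω → ℝ} {i : Fin n} {m : ℕ}
    {w : Hist n m → ℝ≥0∞} {y : Hist n m → ℝ} {f : Hist n m → ℝ≥0 → ℝ}
    (h : R.IsRepresentation x D i m w y f) {φ : Fin n → ℝ → ℝ≥0 → ℝ}
    (hφm : ∀ i, Measurable (Function.uncurry (φ i)))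
    (hφ : ∀ i y, 0 ≤ y → IsPayout M.c y (φ i y)) :
    R.IsRepresentation x (R.continueWith x D m φ) i m w y fun η => φ η.phase (y η) := by
  have hD : ∀ ω, ∀ t ≤ R.jumpTime m ω, R.continueWith x D m φ t ω = D t ω :=
    fun ω t ht => continueWith_of_le hφ ht
  refine ⟨h.measurable_weight, h.measurable_capital, ?_, ?_, ?_, ?_, ?_⟩
  · have h1 : Measurable fun p : Fin n × ℝ × ℝ≥0 => φ p.1 p.2.1 p.2.2 :=
      measurable_from_prod_countable_right (f := fun p : Fin n × ℝ × ℝ≥0 => φ p.1 p.2.1 p.2.2) hφm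
    exact h1.comp ((Hist.measurable_phase.comp measurable_fst).prodMk
      ((h.measurable_capital.comp measurable_fst).prodMk measurable_snd))
  · exact fun η hη => hφ _ _ (h.isPayout η hη).start_nonneg
  · filter_upwards [h.weight_eq] with ω hω
    rw [← hω]
    by_cases h1 : ω ∈ R.startsIn i
    · rw [Set.indicator_of_mem h1, Set.indicator_of_mem h1, weight_congr (hD ω) le_rfl]
    · rw [Set.indicator_of_notMem h1, Set.indicator_of_notMem h1]
  · filter_upwards [h.capital_eq] with ω hω
    rw [capital_congr (hD ω) le_rfl, hω]
  · filter_upwards [h.capital_eq] with ω hω ha s hs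
    rw [dividendsAfter_continueWith hφ ((alive_congr (hD ω) le_rfl).1 ha) hs, hω]
    rfl

section Bound

variable [P.IsComplete] [IsProbabilityMeasure P]

/-- The value of the dividends during finitely many sojourns is at most that of the deterministic
control problem. -/
lemma sum_lintegral_sojournGain_le (S : R.Strategy x) (i : Fin n) (k m : ℕ) :
    ∑ l ∈ Finset.range k,
      ∫⁻ ω in R.startsIn i, R.weight x S.D (m + l) ω * R.sojournGain S.D (m + l) ω ∂P ≤
      ∫⁻ ω in R.startsIn i, R.weight x S.D m ω *
        M.stepIterate k (R.phase m ω) (R.capital x S.D m ω) ∂P := by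
  induction k generalizing m with
  | zero => simp
  | succ k ih =>
    obtain ⟨w, y, f, hrep⟩ := S.exists_isRepresentation i m
    rw [Finset.sum_range_succ', hrep.lintegral_weight, add_comm, add_zero]
    simp_rw [← add_assoc, add_right_comm m _ 1]
    -- The later sojourns are bounded from the next jump on; the one-step identity then merges that
    -- bound with the gain of the current sojourn.
    refine (add_le_add_right (ih (m + 1)) _).trans ?_
    rw [hrep.lintegral_sojournGain_add fun j => M.measurable_stepIterate k j]
    refine lintegral_mono fun ω => ?_
    by_cases h0 : w (R.hist m ω) = 0
    · simp [h0]
    · gcongr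
      exact M.stepValue_le_optimalStep _ _ (hrep.isPayout _ h0)

/-- The representation supplies a measurable version, as needed to exchange sum and integral. -/
lemma aemeasurable_weight_mul_sojournGain (S : R.Strategy x) (i : Fin n) (m : ℕ) :
    AEMeasurable (fun ω => R.weight x S.D m ω * R.sojournGain S.D m ω)
      (P.restrict (R.startsIn i)) := by
  obtain ⟨w, y, f, hrep⟩ := S.exists_isRepresentation i m
  refine ⟨fun ω => w (R.hist m ω) * pathValue M.δ (f (R.hist m ω)) (R.hold m ω), ?_, ?_⟩
  · refine (hrep.measurable_weight.comp (R.measurable_hist m)).mul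
      (measurable_pathValue M.δ_pos (d := fun ω => f (R.hist m ω)) ?_ (R.measurable_hold m))
    exact hrep.measurable_path.comp
      (((R.measurable_hist m).comp measurable_fst).prodMk measurable_snd)
  · rw [EventuallyEq, ae_restrict_iff' (R.measurableSet_startsIn i)]
    filter_upwards [hrep.ae_eq] with ω h1 hω
    rw [Set.indicator_of_mem hω] at h1
    rw [h1.1]
    by_cases h0 : w (R.hist m ω) = 0
    · simp [h0]
    · rw [sojournGain, pathValue_congr (h1.2 h0).2]

lemma setLIntegral_discounted_ruinTime (S : R.Strategy x) (i : Fin n) :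
    ∫⁻ ω in R.startsIn i, S.discounted (S.ruinTime ω) ω ∂P =
      ∑' l, ∫⁻ ω in R.startsIn i, R.weight x S.D l ω * R.sojournGain S.D l ω ∂P := by
  rw [← lintegral_tsum fun l => aemeasurable_weight_mul_sojournGain S i l]
  refine lintegral_congr_ae (ae_restrict_of_ae ?_)
  filter_upwards [R.ae_isRegular, S.ae_withinBudget] with ω h1 h2
  exact S.discounted_ruinTime h1 h2

/-- Payments are nonnegative, so the total is the supremum of its partial sums over sojourns and no
remainder has to be estimated. -/
lemma value_le_iSup_stepIterate (hx : 0 ≤ x) (i : Fin n) :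
    R.value i x ≤ ⨆ k, M.stepIterate k i x := by
  refine iSup_le fun S => ?_
  have h : ∫⁻ ω in R.startsIn i, S.discounted (S.ruinTime ω) ω ∂P ≤
      (⨆ k, M.stepIterate k i x) * P (R.startsIn i) := by
    rw [setLIntegral_discounted_ruinTime, ENNReal.tsum_eq_iSup_nat, ENNReal.iSup_mul]
    refine iSup_mono fun k => ?_
    have h1 := sum_lintegral_sojournGain_le S i k 0
    rw [setLIntegral_start S hx] at h1
    simpa only [zero_add] using h1
  rw [lintegral_cond_startsIn]
  calc (P (R.startsIn i))⁻¹ * ∫⁻ ω in R.startsIn i, S.discounted (S.ruinTime ω) ω ∂P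
      ≤ (P (R.startsIn i))⁻¹ * ((⨆ k, M.stepIterate k i x) * P (R.startsIn i)) := by gcongr
    _ = ⨆ k, M.stepIterate k i x := by
      rw [mul_comm, mul_assoc, measure_startsIn_mul_inv, mul_one]

/-- The value of the deterministic control problem over finitely many sojourns is nearly attained
by a continuation of any given strategy. -/
lemma exists_continuation (i : Fin n) (k : ℕ) : ∀ (m : ℕ) (S : R.Strategy x) {ε : ℝ≥0∞}, ε ≠ 0 →
    ∃ S' : R.Strategy x, (∀ ω, ∀ t ≤ R.jumpTime m ω, S'.D t ω = S.D t ω) ∧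
      ∫⁻ ω in R.startsIn i, R.weight x S.D m ω *
        M.stepIterate k (R.phase m ω) (R.capital x S.D m ω) ∂P ≤
      ∑ l ∈ Finset.range k,
        ∫⁻ ω in R.startsIn i, R.weight x S'.D (m + l) ω * R.sojournGain S'.D (m + l) ω ∂P + ε := by
  induction k with
  | zero => exact fun m S ε _ => ⟨S, fun _ _ _ => rfl, by simp [Model.stepIterate]⟩
  | succ k ih =>
    intro m S ε hε
    -- Half of `ε` is spent on this sojourn and half on the later ones. The first half is halved
    -- again because the measurable selection loses its tolerance twice.
    have hε2 : ε / 2 ≠ 0 := ENNReal.half_pos hε |>.ne'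
    have hε4 : ε / 2 / 2 ≠ 0 := ENNReal.half_pos hε2 |>.ne'
    choose φ hφm hφ hopt using fun j => Model.exists_measurable_nearly_optimal
      (M := M) (fun j u => M.stepIterate_le_payoutBound k j u) hε4 j
    simp only [ENNReal.add_halves] at hopt
    obtain ⟨w, y, f, hrep⟩ := S.exists_isRepresentation i m
    have hrep' := hrep.continueWith hφm hφ
    -- The path of the current sojourn is fixed first; the induction hypothesis then alters the
    -- strategy only after the next jump, so the gain of this sojourn is preserved.
    obtain ⟨S', hS', hle⟩ := ih (m + 1) (S.continueWith m φ hφm hφ) hε2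
    have hD : ∀ ω, ∀ t ≤ R.jumpTime m ω, (S.continueWith m φ hφm hφ).D t ω = S.D t ω :=
      fun ω t ht => continueWith_of_le hφ ht
    have hm : ∀ ω, R.jumpTime m ω ≤ R.jumpTime (m + 1) ω := fun ω =>
      R.monotone_jumpTime ω m.le_succ
    refine ⟨S', fun ω t ht => (hS' ω t (ht.trans (hm ω))).trans (hD ω t ht), ?_⟩
    -- The loss is uniform in the history and weights are at most one, so integrating does not
    -- enlarge it.
    have h1 : ∫⁻ ω, w (R.hist m ω) * (ε / 2) ∂P ≤ ε / 2 := by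
      calc ∫⁻ ω, w (R.hist m ω) * (ε / 2) ∂P ≤ ∫⁻ _, ε / 2 ∂P := by
            refine lintegral_mono_ae ?_
            filter_upwards [hrep.weight_eq] with ω hω
            refine mul_le_of_le_one_left' ?_
            rw [← hω]
            exact Set.indicator_apply_le' (fun _ => weight_le_one m) fun _ => zero_le_one
        _ = ε / 2 := by simp
    have h2 : ∫⁻ ω in R.startsIn i, R.weight x S.D m ω *
          M.stepIterate (k + 1) (R.phase m ω) (R.capital x S.D m ω) ∂P ≤
        ∫⁻ ω, w (R.hist m ω) * M.stepValue (M.stepIterate k) (R.phase m ω) (y (R.hist m ω))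
          (φ (R.hist m ω).phase (y (R.hist m ω))) ∂P + ε / 2 := by
      rw [hrep.lintegral_weight]
      refine le_trans ?_ (add_le_add_right h1 _)
      rw [← lintegral_add_right _
        (by exact (hrep.measurable_weight.comp (R.measurable_hist m)).mul_const _)]
      refine lintegral_mono fun ω => ?_
      by_cases h0 : w (R.hist m ω) = 0
      · simp [h0]
      · rw [← mul_add]
        gcongr
        exact hopt _ _ (hrep.isPayout _ h0).start_nonneg
    have h3 : ∫⁻ ω in R.startsIn i, R.weight x (S.continueWith m φ hφm hφ).D m ω *
          R.sojournGain (S.continueWith m φ hφm hφ).D m ω ∂P =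
        ∫⁻ ω in R.startsIn i, R.weight x S'.D m ω * R.sojournGain S'.D m ω ∂P := by
      refine lintegral_congr fun ω => ?_
      rw [weight_congr (hS' ω) m.le_succ, sojournGain_congr (hS' ω)]
    refine h2.trans ?_
    rw [← hrep'.lintegral_sojournGain_add fun j => M.measurable_stepIterate k j,
      Finset.sum_range_succ', add_zero]
    simp_rw [← add_assoc, add_right_comm m _ 1]
    refine (add_le_add_left (add_le_add_right hle _) _).trans (le_of_eq ?_)
    rw [← h3, add_assoc, add_assoc, ENNReal.add_halves, ← add_assoc, add_comm (∑ l ∈ _, _)]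
    rfl

/-- The continuation is made from the very first sojourn, starting from the strategy that pays
nothing. Dividends after the `k`-th jump are nonnegative and may be added. -/
lemma stepIterate_le_value (hx : 0 ≤ x) (i : Fin n) (k : ℕ) :
    M.stepIterate k i x ≤ R.value i x := by
  have h : M.stepIterate k i x * P (R.startsIn i) ≤ R.value i x * P (R.startsIn i) := by
    refine ENNReal.le_of_forall_pos_le_add fun ε hε _ => ?_
    obtain ⟨S, -, hS⟩ := exists_continuation i k 0 (R.zeroStrategy hx)
      (ENNReal.coe_ne_zero.2 hε.ne')
    rw [setLIntegral_start _ hx] at hS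
    refine hS.trans (add_le_add_left ?_ _)
    simp only [zero_add]
    have h1 : ∫⁻ ω in R.startsIn i, S.discounted (S.ruinTime ω) ω ∂P ≤
        R.value i x * P (R.startsIn i) := by
      have h2 := le_iSup (fun S : R.Strategy x =>
        ∫⁻ ω, S.discounted (S.ruinTime ω) ω ∂(cond P {ω | R.phase 0 ω = i})) S
      simp only [lintegral_cond_startsIn] at h2
      calc ∫⁻ ω in R.startsIn i, S.discounted (S.ruinTime ω) ω ∂P
          = (P (R.startsIn i))⁻¹ * (∫⁻ ω in R.startsIn i, S.discounted (S.ruinTime ω) ω ∂P) *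
              P (R.startsIn i) := by
            rw [mul_comm, ← mul_assoc, measure_startsIn_mul_inv, one_mul]
        _ ≤ R.value i x * P (R.startsIn i) := by
            gcongr
            simpa only [value, lintegral_cond_startsIn] using h2
    refine le_trans ?_ h1
    rw [setLIntegral_discounted_ruinTime]
    exact ENNReal.sum_le_tsum _
  exact (ENNReal.mul_le_mul_iff_left (R.initial i) (measure_ne_top _ _)).1 h

/-- Almost surely no claim occurs at time `0`, so the budget there reads `0 ≤ x`. For negative
capital the supremum is thus over the empty set. -/
lemma le_of_strategy (S : R.Strategy x) : 0 ≤ x := by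
  obtain ⟨ω, h1, h2⟩ := (R.ae_isRegular.and S.ae_withinBudget).exists
  have h3 := h2 0 fun s hs ⟨l, _, h4⟩ => absurd (h4 ▸ hs) (not_le.2 (by
    have := h1.strictMono l.succ_pos
    exact this))
  rw [h1.totalClaims_eq (m := 0) (t := 0) le_rfl (h1.jumpTime_lt_succ 0), S.zero] at h3
  simpa [claimed, claimsBefore] using h3

/-- The problem that ends at the first jump is the deterministic control problem over one
sojourn. -/
lemma onePhaseValue_eq {W : Fin n → ℝ → ℝ≥0∞} (hW : ∀ i, Measurable (W i)) (i : Fin n) (x : ℝ) :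
    R.onePhaseValue W i x = M.optimalStep W i x := by
  by_cases hx : 0 ≤ x
  swap
  · rw [M.optimalStep_of_neg W i (not_le.1 hx)]
    refine le_antisymm (iSup_le fun S => ?_) bot_le
    exact absurd (le_of_strategy S) hx
  have key : ∀ (S : R.Strategy x) w y f, R.IsRepresentation x S.D i 0 w y f →
      ∫⁻ ω, (S.discounted (R.hold 0 ω) ω + ENNReal.ofReal (Real.exp (-M.δ * R.hold 0 ω)) *
        M.extend W (R.target 0 ω) (x + M.c * R.hold 0 ω - S.D (R.hold 0 ω) ω))
        ∂(cond P {ω | R.phase 0 ω = i}) = (P (R.startsIn i))⁻¹ *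
      ∫⁻ ω, w (R.hist 0 ω) * M.stepValue W (R.phase 0 ω) (y (R.hist 0 ω)) (f (R.hist 0 ω)) ∂P := by
    intro S w y f hrep
    rw [lintegral_cond_startsIn, ← hrep.lintegral_sojournValue hW]
    congr 1
    refine setLIntegral_startsIn_congr fun ω hω => ?_
    have h1 : R.dividendsAfter S.D 0 ω = fun t => S.D t ω := by
      funext s
      rw [dividendsAfter, jumpTime_zero, zero_add, S.zero, sub_zero]
    rw [weight_zero (S.isPath ω) hx, capital_zero (S.isPath ω), h1, one_mul, S.discounted_coe]
    rfl
  refine le_antisymm (iSup_le fun S => ?_) (iSup₂_le fun f hf => ?_)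
  · obtain ⟨w, y, f, hrep⟩ := S.exists_isRepresentation i 0
    rw [key S w y f hrep]
    calc (P (R.startsIn i))⁻¹ * ∫⁻ ω, w (R.hist 0 ω) *
          M.stepValue W (R.phase 0 ω) (y (R.hist 0 ω)) (f (R.hist 0 ω)) ∂P
        ≤ (P (R.startsIn i))⁻¹ * (M.optimalStep W i x * P (R.startsIn i)) := by
          gcongr
          rw [← setLIntegral_start S hx, hrep.lintegral_weight]
          refine lintegral_mono fun ω => ?_
          by_cases h0 : w (R.hist 0 ω) = 0
          · simp [h0]
          · gcongr
            exact M.stepValue_le_optimalStep _ _ (hrep.isPayout _ h0)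
      _ = M.optimalStep W i x := by
          rw [mul_comm, mul_assoc, measure_startsIn_mul_inv, mul_one]
  -- Only the capital `x` occurs at time `0`. Below `x` the path `f` may be unaffordable and is
  -- replaced by paying nothing.
  · let φ : Fin n → ℝ → ℝ≥0 → ℝ := fun _ y t => if x ≤ y then f t else 0
    have hφm : ∀ j, Measurable (Function.uncurry (φ j)) := fun j =>
      Measurable.ite (measurableSet_le measurable_const measurable_fst)
        (hf.measurable.comp measurable_snd) measurable_const
    have hφ : ∀ j y, 0 ≤ y → IsPayout M.c y (φ j y) := by
      intro j y hy
      by_cases hxy : x ≤ y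
      · simp only [φ, if_pos hxy]
        exact ⟨hf.toIsPath, fun t => (hf.le t).trans (by gcongr)⟩
      · simp only [φ, if_neg hxy]
        exact isPayout_zero M.c_pos.le hy
    obtain ⟨w, y, g, hrep⟩ := (R.zeroStrategy hx).exists_isRepresentation i 0
    refine le_trans (le_of_eq ?_) (le_iSup _ ((R.zeroStrategy hx).continueWith 0 φ hφm hφ))
    have hint := hrep.lintegral_weight fun j u => M.stepValue W j u (φ j u)
    rw [setLIntegral_start _ hx i fun j u => M.stepValue W j u (φ j u)] at hint
    have hx' : φ i x = f := by simp [φ]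
    rw [hx'] at hint
    refine Eq.trans ?_ (key _ _ _ _ (hrep.continueWith hφm hφ)).symm
    refine Eq.trans ?_ (congrArg (fun v => (P (R.startsIn i))⁻¹ * v) hint)
    rw [mul_comm, mul_assoc, measure_startsIn_mul_inv, mul_one]

lemma iterate_eq_stepIterate (k : ℕ) : R.iterate k = M.stepIterate k := by
  induction k with
  | zero => rfl
  | succ k ih =>
    funext i x
    rw [iterate, ih, onePhaseValue_eq fun j => M.measurable_stepIterate k j]
    rfl

end Bound

end RiskProcess

end Dividend

theorem mainTheorem5 {n : ℕ} (M : Dividend.Model n) {Ω : Type*} [MeasurableSpace Ω]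
    (P : Measure Ω) [IsProbabilityMeasure P] [P.IsComplete] (R : Dividend.RiskProcess M P)
    (i : Fin n) (x : ℝ) (hx : 0 ≤ x) :
    Monotone (fun k : ℕ => R.iterate k i x) ∧
      (∀ k : ℕ, R.iterate k i x ≤ R.value i x) ∧
      R.value i x < ⊤ ∧
      Tendsto (fun k : ℕ => R.iterate k i x) atTop (𝓝 (R.value i x)) := by
  have hmono : Monotone fun k : ℕ => M.stepIterate k i x := fun _ _ h => M.stepIterate_mono h i x
  have hle : ∀ k, M.stepIterate k i x ≤ R.value i x :=
    Dividend.RiskProcess.stepIterate_le_value hx i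
  have heq : R.value i x = ⨆ k, M.stepIterate k i x :=
    le_antisymm (Dividend.RiskProcess.value_le_iSup_stepIterate hx i) (iSup_le hle)
  simp only [Dividend.RiskProcess.iterate_eq_stepIterate]
  refine ⟨hmono, hle, ?_, ?_⟩
  · rw [heq]
    exact (iSup_le fun k => M.stepIterate_le_payoutBound k i x).trans_lt (M.payoutBound_lt_top x)
  · rw [heq]
    exact tendsto_atTop_iSup hmono
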